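/- For $n\ge 1$ and $x\in\mathbb R^n$ put $\Delta_n(x)=\prod_{j<k}(x_k-x_j)$. Given functions $f_1,\dots,f_n:[0,\infty)\to\mathbb R$ with $\int_0^\infty x^{j-1}|f_k(x)|\,dx<\infty$ for $j,k=1,\dots,n$, we say that $n$ random positive numbers $x_1,\dots,x_n$ (with no prescribed order) are a polynomial ensemble with functions $f_1,\dots,f_n$ if, for some constant $Z_n\neq 0$, the function $$\frac1{Z_n}\,\Delta_n(x)\,\det\bigl[f_k(x_j)\bigr]_{j,k=1}^n ,\qquad \text{all } x_j>0,$$ is non-negative with total integral $1$ over $(0,\infty)^n$, and is the joint density of the unordered points $x_1,\dots,x_n$; that is, $\mathbb P\bigl((x_1,\dots,x_n)\in B\bigr)$ is its integral over $B\cap(0,\infty)^n$ for every permutation-invariant Borel set $B\subset\mathbb R^n$. Let $n,\nu,m$ be positive integers with $n\le m-1$ and $\nu\le m-n-1$. Let $X$ be a random positive semidefinite Hermitian $m\times m$ matrix with, almost surely, a zero eigenvalue of multiplicity $m-n$, and whose non-zero eigenvalues $x_1,\dots,x_n$ are a polynomial ensemble with functions $f_1,\dots,f_n$. Let $U$ be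 a Haar distributed unitary $m\times m$ matrix, independent of $X$, and let $Y$ be a principal submatrix of $UXU^*$ of size $(n+\nu)\times(n+\nu)$. Then, with probability one, $Y$ has exactly $n$ non-zero eigenvalues $y_1,\dots,y_n$ and these are distinct; moreover, the non-zero eigenvalues $y_1,\dots,y_n$ are a polynomial ensemble $$\frac1{\tilde Z_n}\,\Delta_n(y)\,\det\bigl[g_k(y_j)\bigr]_{j,k=1}^n,\qquad \text{all } y_j>0,$$ with functions $$g_k(y)=\int_0^1 x^{\nu}(1-x)^{m-n-\nu-1}f_k\!\left(\frac yx\right)\frac{dx}{x},\qquad y>0,\quad k=1,\dots,n,$$ where these integrals converge absolutely for every $y>0$. -/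

import Mathlib

open MeasureTheory ProbabilityTheory
open scoped ComplexOrder

/-- The entrywise (Borel) measurable structure on complex matrices. -/
noncomputable instance complexMatrixMeasurableSpace {m : ℕ} :
    MeasurableSpace (Matrix (Fin m) (Fin m) ℂ) :=
  MeasurableSpace.pi (X := fun _ : Fin m => Fin m → ℂ)

instance complexMatrixBorelSpace {m : ℕ} : BorelSpace (Matrix (Fin m) (Fin m) ℂ) :=
  inferInstanceAs (BorelSpace (Fin m → Fin m → ℂ))

/-- The Vandermonde determinant `∏_{j < k} (x_k - x_j)`. -/
def vandermondeProd {n : ℕ} (x : Fin n → ℝ) : ℝ :=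
  ∏ j, ∏ k ∈ Finset.Ioi j, (x k - x j)

/-- `Z⁻¹ Δ_n(x) det [f_k(x_j)]`, the expression defining a polynomial ensemble. -/
noncomputable def polyEnsembleFun {n : ℕ} (f : Fin n → ℝ → ℝ) (Z : ℝ) (x : Fin n → ℝ) : ℝ :=
  Z⁻¹ * (vandermondeProd x * (Matrix.of fun j k : Fin n => f k (x j)).det)

/-- `Z⁻¹ Δ_n(x) det [f_k(x_j)]` is a probability density on `D ^ n` (extended by zero outside),
for functions `f_k` whose values on `D` alone matter: it is non-negative, has total mass one, and
the moments `∫_D t ^ j f_k(t) dt`, `0 ≤ j ≤ n - 1`, converge absolutely. -/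
structure IsPolyEnsembleDensity {n : ℕ} (D : Set ℝ) (f : Fin n → ℝ → ℝ) (Z : ℝ) : Prop where
  moments : ∀ j k : Fin n, IntegrableOn (fun t : ℝ => t ^ (j : ℕ) * f k t) D
  nonneg : ∀ x : Fin n → ℝ, (∀ j, x j ∈ D) → 0 ≤ polyEnsembleFun f Z x
  normalized : ∫⁻ x in {x : Fin n → ℝ | ∀ j, x j ∈ D}, ENNReal.ofReal (polyEnsembleFun f Z x) = 1

/-- The random finite collection of real numbers `S` (with multiplicities, without an order) is a
polynomial ensemble on `D` with functions `f_1, …, f_n`: it has a measurable enumeration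
`x_1, …, x_n` such that, for a suitable normalization constant `Z`, the function
`Z⁻¹ Δ_n(x) det [f_k(x_j)]` is a probability density on `D ^ n` and gives the probability of each
event that does not depend on the order of the `x_j`. -/
def IsPolyEnsemble {Ω : Type*} [MeasurableSpace Ω] (P : Measure Ω) {n : ℕ}
    (S : Ω → Multiset ℝ) (D : Set ℝ) (f : Fin n → ℝ → ℝ) : Prop :=
  ∃ (Z : ℝ) (x : Ω → Fin n → ℝ),
    IsPolyEnsembleDensity D f Z ∧
    Measurable x ∧
    (∀ᵐ ω ∂P, S ω = (Finset.univ : Finset (Fin n)).val.map (x ω)) ∧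
    ∀ B : Set (Fin n → ℝ), MeasurableSet B →
      (∀ (σ : Equiv.Perm (Fin n)) (v : Fin n → ℝ), v ∈ B → v ∘ σ ∈ B) →
      P {ω | x ω ∈ B} =
        ∫⁻ v in B ∩ {v | ∀ j, v j ∈ D}, ENNReal.ofReal (polyEnsembleFun f Z v)

/-- The non-zero eigenvalues, with multiplicities, of a complex matrix with real eigenvalues
(such as a Hermitian matrix). -/
noncomputable def nonzeroEigenvalues {N : ℕ} (A : Matrix (Fin N) (Fin N) ℂ) : Multiset ℝ :=
  (A.charpoly.roots.filter (fun z => z ≠ 0)).map Complex.re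

/-- The principal submatrix of `U X U*` on the rows and columns chosen by `e`. -/
def compressedMatrix {m N : ℕ} (e : Fin N ↪ Fin m) (U : Matrix.unitaryGroup (Fin m) ℂ)
    (X : Matrix (Fin m) (Fin m) ℂ) : Matrix (Fin N) (Fin N) ℂ :=
  ((U : Matrix (Fin m) (Fin m) ℂ) * X * (U : Matrix (Fin m) (Fin m) ℂ).conjTranspose).submatrix e e

/-!
A principal submatrix of codimension `r + 1` is reached by removing one row and column at a time,
so it suffices to understand one removal and to iterate.

Let `A` be a Hermitian matrix of size `n + ν + 1` with non-zero eigenvalues `0 < a_1 < ⋯ < a_n`, and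
let `V` be a Haar distributed unitary matrix. By the secular equation (`charpoly_truncation`) the
non-zero eigenvalues `y_1, …, y_n` of the truncation of `V A V*` are the roots of
`∏ (X - a_j) + ∑ w_i a_i ∏_{j ≠ i} (X - a_j)`, where `w_i` is the squared modulus of an entry of the
last row of `V W`, for a unitary `W` that diagonalizes `A`. They interlace the `a_j`. This row is
uniformly distributed on the sphere, so the `w_i` have a density proportional to
`(1 - ∑ w_i) ^ ν` on the simplex (`haar_lastRowWeight`). The Jacobian of the map from `y` to `w` is a
Cauchy determinant, and the change of variables (`setLIntegral_openSimplex`) shows that, given `a`,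
the vector `y` has a density proportional to `(∏ y_j) ^ ν Δ(y) / ((∏ a_j) ^ (ν + 1) Δ(a))` on the
interlacing region (`haar_truncate_mem_spectralSet`).

The indicator of interlacing is `det 1[y_j < a_i]` (`det_indicator_lt`), so this density is
`Δ(y) / Δ(a)` times the determinant of the kernel `y ^ ν / t ^ (ν + 1)` on `y < t`. Integrated against
a polynomial ensemble density in `a`, the factors `Δ(a)` cancel, and Andréief's identity
(`andreief`) leaves the polynomial ensemble density whose functions are the transforms of the `f_k`
by this kernel (`HasSpectralLaw.map_truncate`). A truncation of a unitarily invariant matrix is again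
unitarily invariant, so the step can be repeated. The kernels of successive truncations compose
to multiples of `(y / t) ^ ν (1 - y / t) ^ r / t` (`powKernel_mul_truncKernel`), and the substitution
`x = y / t` gives the stated integrals.

The invariant carried through the iteration is `HasSpectralLaw`: unitary invariance, together
with the law of the increasing enumeration of the non-zero eigenvalues. The latter is equivalent to
the law of the points without order by the symmetry of the density (`setLIntegral_inter_orthant`).
-/

/-! ### Symmetric integrals over the orthant, and Andréief's identity -/

/-- The Weyl chamber `0 < y_1 < ⋯ < y_n`. -/
def chamber (n : ℕ) : Set (Fin n → ℝ) := {y | StrictMono y ∧ ∀ j, 0 < y j}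

/-- The positive orthant `(0, ∞) ^ n`. -/
def orthant (n : ℕ) : Set (Fin n → ℝ) := {y | ∀ j, y j ∈ Set.Ioi (0 : ℝ)}

lemma measurableSet_chamber (n : ℕ) : MeasurableSet (chamber n) := by
  have h : chamber n = (⋂ i, ⋂ j, {y : Fin n → ℝ | i < j → y i < y j}) ∩ ⋂ j, {y | 0 < y j} := by
    ext y
    simp [chamber, StrictMono]
  rw [h]
  refine MeasurableSet.inter (MeasurableSet.iInter fun i => MeasurableSet.iInter fun j => ?_)
    (MeasurableSet.iInter fun j => measurableSet_lt measurable_const (measurable_pi_apply j))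
  by_cases hij : i < j
  · simpa [hij] using measurableSet_lt (measurable_pi_apply i) (measurable_pi_apply j)
  · simp [hij]

lemma orthant_eq_pi (n : ℕ) : orthant n = Set.univ.pi fun _ => Set.Ioi (0 : ℝ) := by
  ext y
  simp [orthant]

lemma measurableSet_orthant (n : ℕ) : MeasurableSet (orthant n) := by
  rw [orthant_eq_pi]
  exact MeasurableSet.univ_pi fun _ => measurableSet_Ioi

lemma chamber_subset_orthant (n : ℕ) : chamber n ⊆ orthant n := fun _ hy => hy.2

lemma measurePreserving_comp_perm {n : ℕ} (σ : Equiv.Perm (Fin n)) :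
    MeasurePreserving (fun y : Fin n → ℝ => y ∘ σ) :=
  volume_preserving_arrowCongr' σ.symm (MeasurableEquiv.refl ℝ) (MeasurePreserving.id _)

lemma measurableEmbedding_comp_perm {n : ℕ} (σ : Equiv.Perm (Fin n)) :
    MeasurableEmbedding (fun y : Fin n → ℝ => y ∘ σ) :=
  (MeasurableEquiv.arrowCongr' σ.symm (MeasurableEquiv.refl ℝ)).measurableEmbedding

lemma comp_sort_mem_chamber {n : ℕ} {y : Fin n → ℝ} (hy : Function.Injective y)
    (hpos : ∀ j, 0 < y j) : y ∘ Tuple.sort y ∈ chamber n :=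
  ⟨(Tuple.monotone_sort y).strictMono_of_injective (hy.comp (Tuple.sort y).injective),
    fun _ => hpos _⟩

lemma strictMono_comp_perm_unique {n : ℕ} {y : Fin n → ℝ} {σ τ : Equiv.Perm (Fin n)}
    (hσ : StrictMono (y ∘ σ)) (hτ : StrictMono (y ∘ τ)) : σ = τ := by
  have h : y ∘ σ = y ∘ τ := Tuple.unique_monotone hσ.monotone hτ.monotone
  have hinj : Function.Injective y := by
    have := hσ.injective.comp σ.symm.injective
    simpa [Function.comp_assoc] using this
  ext i
  exact congrArg Fin.val (hinj (congrFun h i))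

/-- A symmetric function that vanishes where two coordinates agree has the same integral over each
of the `n!` chambers of the orthant. -/
lemma setLIntegral_orthant_eq {n : ℕ} (F : (Fin n → ℝ) → ENNReal)
    (hsymm : ∀ (σ : Equiv.Perm (Fin n)) y, F (y ∘ σ) = F y)
    (hzero : ∀ y, ¬ Function.Injective y → F y = 0) :
    ∫⁻ y in orthant n, F y = (n.factorial : ENNReal) * ∫⁻ y in chamber n, F y := by
  set S : Equiv.Perm (Fin n) → Set (Fin n → ℝ) := fun σ => {y | y ∘ σ ∈ chamber n}
  have hSm : ∀ σ, MeasurableSet (S σ) := fun σ =>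
    (measurableEmbedding_comp_perm σ).measurable (measurableSet_chamber n)
  have hdisj : Pairwise (Function.onFun Disjoint S) := by
    intro σ τ hst
    refine Set.disjoint_left.2 fun y hσ hτ => hst ?_
    exact strictMono_comp_perm_unique hσ.1 hτ.1
  have h1 : ∫⁻ y in orthant n, F y = ∫⁻ y in ⋃ σ, S σ, F y := by
    rw [← lintegral_indicator (measurableSet_orthant n),
      ← lintegral_indicator (MeasurableSet.iUnion hSm)]
    congr 1
    ext y
    by_cases hinj : Function.Injective y
    · have hiff : y ∈ orthant n ↔ y ∈ ⋃ σ, S σ := by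
        rw [Set.mem_iUnion]
        constructor
        · intro hy
          exact ⟨Tuple.sort y, comp_sort_mem_chamber hinj hy⟩
        · rintro ⟨σ, hσ⟩ j
          have := hσ.2 (σ.symm j)
          rwa [Function.comp_apply, Equiv.apply_symm_apply] at this
      by_cases hy : y ∈ orthant n
      · rw [Set.indicator_of_mem hy, Set.indicator_of_mem (hiff.1 hy)]
      · rw [Set.indicator_of_notMem hy, Set.indicator_of_notMem (fun h => hy (hiff.2 h))]
    · rw [Set.indicator_apply_eq_zero.2 fun _ => hzero y hinj,
        Set.indicator_apply_eq_zero.2 fun _ => hzero y hinj]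
  rw [h1, lintegral_iUnion hSm hdisj, tsum_fintype]
  have h2 : ∀ σ : Equiv.Perm (Fin n), ∫⁻ y in S σ, F y = ∫⁻ y in chamber n, F y := by
    intro σ
    have := (measurePreserving_comp_perm σ).setLIntegral_comp_preimage_emb
      (measurableEmbedding_comp_perm σ) F (chamber n)
    rw [← this]
    refine setLIntegral_congr_fun (hSm σ) fun y _ => (hsymm σ y).symm
  rw [Finset.sum_congr rfl fun σ _ => h2 σ, Finset.sum_const, Finset.card_univ, Fintype.card_perm,
    Fintype.card_fin, nsmul_eq_mul]

/-- Half-open interlacing `y_1 < a_1 ≤ y_2 < a_2 ≤ ⋯ ≤ y_n < a_n`. -/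
def Interlaces {n : ℕ} (a y : Fin n → ℝ) : Prop := ∀ i j, y j < a i ↔ j ≤ i

lemma mem_iff_lt_card_of_isLowerSet {n : ℕ} {s : Finset (Fin n)}
    (hs : IsLowerSet (s : Set (Fin n))) (j : Fin n) : j ∈ s ↔ (j : ℕ) < s.card := by
  constructor
  · intro hj
    have h : Finset.Iic j ⊆ s := fun i hi => hs (Finset.mem_Iic.1 hi) hj
    have := Finset.card_le_card h
    rw [Fin.card_Iic] at this
    omega
  · intro hj
    by_contra hjs
    have h : s ⊆ Finset.Iio j := by
      intro i hi
      rw [Finset.mem_Iio]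
      by_contra hij
      exact hjs (hs (not_lt.1 hij) hi)
    have := Finset.card_le_card h
    rw [Fin.card_Iio] at this
    omega

open Classical in
/-- The rows of the matrix `1[y_j < a_i]` are initial segments; if they are distinct and non-zero,
their lengths are `1, …, n`. -/
lemma det_indicator_lt {n : ℕ} {a y : Fin n → ℝ} (ha : StrictMono a) (hy : StrictMono y) :
    (Matrix.of fun i j => if y j < a i then (1 : ℝ) else 0).det =
      if Interlaces a y then 1 else 0 := by
  split_ifs with h
  · rw [Matrix.det_of_isLowerTriangular]
    · simp [h _ _]
    · intro i j hij
      have : i < j := hij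
      simp [h i j, this]
  · by_contra hdet
    apply h
    set M : Matrix (Fin n) (Fin n) ℝ := Matrix.of fun i j => if y j < a i then (1 : ℝ) else 0
      with hM
    set L : Fin n → Finset (Fin n) := fun i => Finset.univ.filter fun j => y j < a i with hL
    have hlow : ∀ i, IsLowerSet (L i : Set (Fin n)) := by
      intro i j k hkj hj
      simp only [hL, Finset.coe_filter, Finset.mem_univ, true_and, Set.mem_ofPred_eq] at hj ⊢
      exact (hy.monotone hkj).trans_lt hj
    have hmem : ∀ i j, y j < a i ↔ (j : ℕ) < (L i).card := by
      intro i j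
      rw [← mem_iff_lt_card_of_isLowerSet (hlow i) j]
      simp [hL]
    have hinj : Function.Injective fun i => (L i).card := by
      intro i k hik
      by_contra hne
      refine hdet (Matrix.det_zero_of_row_eq hne ?_)
      ext j
      simp only [hM, Matrix.of_apply, hmem]
      simp only at hik
      rw [hik]
    have hpos : ∀ i, 0 < (L i).card := by
      intro i
      by_contra h0
      refine hdet (Matrix.det_eq_zero_of_row_eq_zero i fun j => ?_)
      have h0' : (L i).card = 0 := by omega
      simp [hM, hmem, h0']
    have hmono : Monotone fun i => (L i).card := by
      intro i k hik
      refine Finset.card_le_card fun j hj => ?_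
      simp only [hL, Finset.mem_filter, Finset.mem_univ, true_and] at hj ⊢
      exact hj.trans_le (ha.monotone hik)
    have hle : ∀ i, (L i).card ≤ n := fun i => by
      simpa using Finset.card_le_univ (L i)
    set c : Fin n → Fin n := fun i => ⟨(L i).card - 1, by have := hle i; have := hpos i; omega⟩
      with hc
    have hcmono : StrictMono c := by
      intro i k hik
      have h1 : (L i).card < (L k).card := hmono.strictMono_of_injective hinj hik
      have := hpos i
      simp only [hc, Fin.lt_def]
      omega
    intro i j
    have h1 : c i = i := le_antisymm (hcmono.apply_le) hcmono.le_apply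
    have h2 : (L i).card - 1 = i := congrArg Fin.val h1
    have h3 := hpos i
    rw [hmem i j, Fin.le_def]
    omega

/-- Andréief's identity, and the integrability that it needs. -/
lemma andreief {n : ℕ} (μ : Measure ℝ) [SigmaFinite μ] (h κ : Fin n → ℝ → ℝ)
    (hint : ∀ k j, Integrable (fun t => h k t * κ j t) μ) :
    Integrable (fun a : Fin n → ℝ => (Matrix.of fun i k => h k (a i)).det *
      (Matrix.of fun i j => κ j (a i)).det) (Measure.pi fun _ => μ) ∧
    ∫ a, (Matrix.of fun i k => h k (a i)).det * (Matrix.of fun i j => κ j (a i)).det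
        ∂(Measure.pi fun _ => μ) =
      n.factorial * (Matrix.of fun j k => ∫ t, h k t * κ j t ∂μ).det := by
  have hexp : ∀ a : Fin n → ℝ, (Matrix.of fun i k => h k (a i)).det *
      (Matrix.of fun i j => κ j (a i)).det =
      ∑ σ : Equiv.Perm (Fin n), ∑ τ : Equiv.Perm (Fin n),
        ((Equiv.Perm.sign σ : ℤ) : ℝ) * ((Equiv.Perm.sign τ : ℤ) : ℝ) *
          ∏ i, (h (σ i) (a i) * κ (τ i) (a i)) := by
    intro a
    rw [← Matrix.det_transpose, ← Matrix.det_transpose (Matrix.of fun i j => κ j (a i)),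
      Matrix.det_apply', Matrix.det_apply', Finset.sum_mul_sum]
    refine Finset.sum_congr rfl fun σ _ => Finset.sum_congr rfl fun τ _ => ?_
    simp only [Matrix.transpose_apply, Matrix.of_apply, Finset.prod_mul_distrib]
    ring
  have hI : ∀ σ τ : Equiv.Perm (Fin n), Integrable (fun a : Fin n → ℝ =>
      ((Equiv.Perm.sign σ : ℤ) : ℝ) * ((Equiv.Perm.sign τ : ℤ) : ℝ) *
          ∏ i, (h (σ i) (a i) * κ (τ i) (a i))) (Measure.pi fun _ => μ) := fun σ τ =>
    (Integrable.fintype_prod (f := fun i t => h (σ i) t * κ (τ i) t)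
      (fun i => hint _ _)).const_mul _
  simp_rw [hexp]
  refine ⟨integrable_finsetSum _ fun σ _ => integrable_finsetSum _ fun τ _ => hI σ τ, ?_⟩
  rw [integral_finsetSum _ fun σ _ => integrable_finsetSum _ fun τ _ => hI σ τ]
  have hprod : ∀ σ τ : Equiv.Perm (Fin n),
      ∫ a, ∏ i, (h (σ i) (a i) * κ (τ i) (a i)) ∂(Measure.pi fun _ => μ) =
        ∏ i, ∫ t, h (σ i) t * κ (τ i) t ∂μ := fun σ τ =>
    integral_fintype_prod_eq_prod (μ := fun _ => μ) fun i t => h (σ i) t * κ (τ i) t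
  have hsum : ∀ σ : Equiv.Perm (Fin n), ∫ a, ∑ τ : Equiv.Perm (Fin n),
        ((Equiv.Perm.sign σ : ℤ) : ℝ) * ((Equiv.Perm.sign τ : ℤ) : ℝ) *
          ∏ i, (h (σ i) (a i) * κ (τ i) (a i)) ∂(Measure.pi fun _ => μ) =
      ∑ τ : Equiv.Perm (Fin n), ((Equiv.Perm.sign σ : ℤ) : ℝ) * ((Equiv.Perm.sign τ : ℤ) : ℝ) *
        ∏ i, ∫ t, h (σ i) t * κ (τ i) t ∂μ := fun σ => by
    rw [integral_finsetSum _ fun τ _ => hI σ τ]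
    exact Finset.sum_congr rfl fun τ _ => by rw [integral_const_mul, hprod]
  simp_rw [hsum]
  set G : Matrix (Fin n) (Fin n) ℝ := Matrix.of fun j k => ∫ t, h k t * κ j t ∂μ with hG
  have hσ : ∀ σ : Equiv.Perm (Fin n), ∑ τ : Equiv.Perm (Fin n),
      ((Equiv.Perm.sign σ : ℤ) : ℝ) * ((Equiv.Perm.sign τ : ℤ) : ℝ) *
        ∏ i, ∫ t, h (σ i) t * κ (τ i) t ∂μ = G.det := by
    intro σ
    have : ∀ τ : Equiv.Perm (Fin n), ∏ i, ∫ t, h (σ i) t * κ (τ i) t ∂μ =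
        ∏ i, (G.submatrix id σ) (τ i) i := fun τ => by simp [hG]
    simp_rw [this, mul_assoc]
    rw [← Finset.mul_sum, ← Matrix.det_apply', Matrix.det_permute', ← mul_assoc]
    rcases Int.units_eq_one_or (Equiv.Perm.sign σ) with h | h <;> simp [h]
  rw [Finset.sum_congr rfl fun σ _ => hσ σ, Finset.sum_const, Finset.card_univ, Fintype.card_perm,
    Fintype.card_fin, nsmul_eq_mul]

/-! ### The secular polynomial and its change of variables -/

open Polynomial in
/-- The monic polynomial `∏_j (X - a_j) + ∑_i w_i a_i ∏_{j ≠ i} (X - a_j)`. When the weights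
`w_0 = 1 - ∑ w_i` at `0` and `w_i` at `a_i` are positive, it is the numerator of the secular
function `w_0 / t + ∑ w_i / (t - a_i)`. -/
noncomputable def secularPoly {n : ℕ} (a w : Fin n → ℝ) : ℝ[X] :=
  ∏ j, (X - C (a j)) + ∑ i, C (w i * a i) * ∏ j ∈ Finset.univ.erase i, (X - C (a j))

/-- The weights `w_i` for which the roots of `secularPoly a w` are `y_1, …, y_n`. -/
noncomputable def secularWeight {n : ℕ} (a y : Fin n → ℝ) (i : Fin n) : ℝ :=
  (∏ k, (a i - y k)) / (a i * ∏ k ∈ Finset.univ.erase i, (a i - a k))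

/-- The open simplex `w_i > 0`, `∑ w_i < 1`. -/
def openSimplex (n : ℕ) : Set (Fin n → ℝ) := {w | (∀ i, 0 < w i) ∧ ∑ i, w i < 1}

/-- The region `0 < y_1 < a_1 < y_2 < ⋯ < y_n < a_n`, for increasing `a`. -/
def interlaceRegion {n : ℕ} (a : Fin n → ℝ) : Set (Fin n → ℝ) :=
  {y | (∀ j, 0 < y j) ∧ ∀ i j, (j ≤ i → y j < a i) ∧ (i < j → a i < y j)}

lemma interlaceRegion_subset_chamber {n : ℕ} (a : Fin n → ℝ) : interlaceRegion a ⊆ chamber n :=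
  fun _ hy => ⟨fun i j hij => ((hy.2 i i).1 le_rfl).trans ((hy.2 i j).2 hij), hy.1⟩

lemma measurableSet_interlaceRegion {n : ℕ} (a : Fin n → ℝ) :
    MeasurableSet (interlaceRegion a) := by
  have h : interlaceRegion a = (⋂ j, {y : Fin n → ℝ | 0 < y j}) ∩
      ⋂ i, ⋂ j, ({y | j ≤ i → y j < a i} ∩ {y | i < j → a i < y j}) := by
    ext y
    simp [interlaceRegion]
  rw [h]
  refine MeasurableSet.inter
    (MeasurableSet.iInter fun j => measurableSet_lt measurable_const (measurable_pi_apply j))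
    (MeasurableSet.iInter fun i => MeasurableSet.iInter fun j => MeasurableSet.inter ?_ ?_)
  · by_cases hij : j ≤ i
    · simpa [hij] using measurableSet_lt (measurable_pi_apply j) measurable_const
    · simp [hij]
  · by_cases hij : i < j
    · simpa [hij] using measurableSet_lt measurable_const (measurable_pi_apply j)
    · simp [hij]

lemma measurableSet_openSimplex (n : ℕ) : MeasurableSet (openSimplex n) := by
  have h : openSimplex n = (⋂ i, {w : Fin n → ℝ | 0 < w i}) ∩ {w | ∑ i, w i < 1} := by
    ext y
    simp [openSimplex]
  rw [h]
  exact MeasurableSet.inter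
    (MeasurableSet.iInter fun j => measurableSet_lt measurable_const (measurable_pi_apply j))
    (measurableSet_lt (by fun_prop) measurable_const)

section Secular

open Polynomial

variable {n : ℕ}

lemma degree_nodal (y : Fin n → ℝ) : (∏ j, (X - C (y j)) : ℝ[X]).degree = (n : WithBot ℕ) := by
  rw [degree_prod]
  simp

lemma monic_nodal (y : Fin n → ℝ) : (∏ j, (X - C (y j))).Monic :=
  monic_prod_of_monic _ _ fun _ _ => monic_X_sub_C _

lemma degree_secular_tail_lt (a w : Fin n → ℝ) :
    (∑ i, C (w i * a i) * ∏ j ∈ Finset.univ.erase i, (X - C (a j))).degree <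
      (∏ j, (X - C (a j))).degree := by
  rw [degree_nodal]
  rw [← mem_degreeLT]
  refine Submodule.sum_mem _ fun i _ => ?_
  rw [mem_degreeLT]
  refine (degree_mul_le _ _).trans_lt ?_
  have h1 : (∏ j ∈ Finset.univ.erase i, (X - C (a j))).degree = ((n - 1 : ℕ) : WithBot ℕ) := by
    rw [degree_prod]
    simp [Finset.card_erase_of_mem]
  rw [h1]
  refine (add_le_add degree_C_le le_rfl).trans_lt ?_
  have := i.pos
  rw [zero_add]
  exact_mod_cast (by omega : n - 1 < n)

lemma degree_secularPoly (a w : Fin n → ℝ) : (secularPoly a w).degree = n := by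
  rw [secularPoly, degree_add_eq_left_of_degree_lt (degree_secular_tail_lt a w), degree_nodal]

lemma monic_secularPoly (a w : Fin n → ℝ) : (secularPoly a w).Monic :=
  (monic_nodal a).add_of_left (degree_secular_tail_lt a w)

lemma eval_secularPoly (a w : Fin n → ℝ) (i : Fin n) :
    (secularPoly a w).eval (a i) = w i * a i * ∏ k ∈ Finset.univ.erase i, (a i - a k) := by
  rw [secularPoly, eval_add, eval_finsetSum, eval_prod,
    Finset.prod_eq_zero (Finset.mem_univ i) (by simp), zero_add, Finset.sum_eq_single i]
  · simp [eval_prod]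
  · intro j _ hj
    rw [eval_mul, eval_prod,
      Finset.prod_eq_zero (Finset.mem_erase.2 ⟨hj.symm, Finset.mem_univ i⟩) (by simp), mul_zero]
  · simp

lemma eval_zero_secularPoly (a w : Fin n → ℝ) :
    (secularPoly a w).eval 0 = (1 - ∑ i, w i) * ∏ j, (-a j) := by
  rw [secularPoly, eval_add, eval_finsetSum, eval_prod, sub_mul, one_mul, Finset.sum_mul,
    sub_eq_add_neg, ← Finset.sum_neg_distrib]
  congr 1
  · simp
  · refine Finset.sum_congr rfl fun i _ => ?_
    rw [← Finset.mul_prod_erase _ _ (Finset.mem_univ i)]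
    simp only [eval_mul, eval_C, eval_prod, eval_sub, eval_X, zero_sub]
    ring

lemma secularPoly_eq_of_eval {a w y v : Fin n → ℝ} (hv : Function.Injective v)
    (h : ∀ i, (secularPoly a w).eval (v i) = ∏ k, (v i - y k)) :
    secularPoly a w = ∏ k, (X - C (y k)) := by
  refine eq_of_degree_le_of_eval_index_eq (v := v) Finset.univ hv.injOn ?_ ?_ ?_ ?_
  · rw [degree_secularPoly]
    simp
  · rw [degree_secularPoly, degree_nodal]
  · rw [(monic_secularPoly a w).leadingCoeff, (monic_nodal y).leadingCoeff]
  · intro i _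
    rw [h, eval_prod]
    simp

lemma prod_erase_sub_ne_zero {a : Fin n → ℝ} (ha : Function.Injective a) (i : Fin n) :
    ∏ k ∈ Finset.univ.erase i, (a i - a k) ≠ 0 :=
  Finset.prod_ne_zero_iff.2 fun _ hk => sub_ne_zero.2 fun h => (Finset.mem_erase.1 hk).1 (ha h.symm)

lemma secularPoly_secularWeight {a : Fin n → ℝ} (ha : a ∈ chamber n) (y : Fin n → ℝ) :
    secularPoly a (secularWeight a y) = ∏ k, (X - C (y k)) := by
  refine secularPoly_eq_of_eval ha.1.injective fun i => ?_
  rw [eval_secularPoly, secularWeight]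
  have h1 := (ha.2 i).ne'
  have h2 := prod_erase_sub_ne_zero ha.1.injective i
  field_simp

lemma one_sub_sum_secularWeight {a : Fin n → ℝ} (ha : a ∈ chamber n) (y : Fin n → ℝ) :
    1 - ∑ i, secularWeight a y i = (∏ j, y j) / ∏ j, a j := by
  have h := eval_zero_secularPoly a (secularWeight a y)
  rw [secularPoly_secularWeight ha, eval_prod] at h
  have h1 : ∏ j, a j ≠ 0 := Finset.prod_ne_zero_iff.2 fun j _ => (ha.2 j).ne'
  simp only [eval_sub, eval_X, eval_C, zero_sub, Finset.prod_neg] at h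
  rw [eq_div_iff h1]
  have h2 : (-1 : ℝ) ^ (Finset.univ : Finset (Fin n)).card ≠ 0 := by simp
  apply mul_left_cancel₀ h2
  rw [h]
  ring

lemma secularWeight_pos {a y : Fin n → ℝ} (ha : a ∈ chamber n) (hy : y ∈ interlaceRegion a)
    (i : Fin n) : 0 < secularWeight a y i := by
  rw [secularWeight, ← Finset.mul_prod_erase _ _ (Finset.mem_univ i), mul_div_mul_comm,
    ← Finset.prod_div_distrib]
  refine mul_pos (div_pos (sub_pos.2 ((hy.2 i i).1 le_rfl)) (ha.2 i))
    (Finset.prod_pos fun k hk => ?_)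
  rcases lt_or_gt_of_ne (Finset.mem_erase.1 hk).1 with h | h
  · exact div_pos (sub_pos.2 ((hy.2 i k).1 h.le)) (sub_pos.2 (ha.1 h))
  · exact div_pos_of_neg_of_neg (sub_neg.2 ((hy.2 i k).2 h)) (sub_neg.2 (ha.1 h))

lemma secularWeight_mem_openSimplex {a y : Fin n → ℝ} (ha : a ∈ chamber n)
    (hy : y ∈ interlaceRegion a) : secularWeight a y ∈ openSimplex n := by
  refine ⟨secularWeight_pos ha hy, ?_⟩
  rw [← sub_pos, one_sub_sum_secularWeight ha]
  exact div_pos (Finset.prod_pos fun j _ => hy.1 j) (Finset.prod_pos fun j _ => ha.2 j)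

lemma sign_prod_erase_sub {a : Fin n → ℝ} (ha : StrictMono a) (i : Fin n) :
    0 < (-1 : ℝ) ^ (n - 1 - i : ℕ) * ∏ k ∈ Finset.univ.erase i, (a i - a k) := by
  have hu : (Finset.univ.erase i : Finset (Fin n)) = Finset.Iio i ∪ Finset.Ioi i := by
    ext k
    simp [lt_or_lt_iff_ne]
  have hd : Disjoint (Finset.Iio i) (Finset.Ioi i) :=
    Finset.disjoint_left.2 fun k h1 h2 => lt_asymm (Finset.mem_Iio.1 h1) (Finset.mem_Ioi.1 h2)
  have h1 : (-1 : ℝ) ^ (n - 1 - i : ℕ) * ∏ k ∈ Finset.Ioi i, (a i - a k) =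
      ∏ k ∈ Finset.Ioi i, (a k - a i) := by
    rw [← Fin.card_Ioi, ← Finset.prod_const, ← Finset.prod_mul_distrib]
    exact Finset.prod_congr rfl fun k _ => by ring
  rw [hu, Finset.prod_union hd, mul_left_comm, h1]
  exact mul_pos (Finset.prod_pos fun k hk => sub_pos.2 (ha (Finset.mem_Iio.1 hk)))
    (Finset.prod_pos fun k hk => sub_pos.2 (ha (Finset.mem_Ioi.1 hk)))

/-- For positive weights the secular polynomial changes sign between consecutive points of
`0 < a_1 < ⋯ < a_n`, so its roots interlace these points. -/
lemma exists_secularWeight_eq {a w : Fin n → ℝ} (ha : a ∈ chamber n) (hw : w ∈ openSimplex n) :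
    ∃ y ∈ interlaceRegion a, secularWeight a y = w := by
  set p := secularPoly a w with hp
  have hsa : ∀ i : Fin n, 0 < (-1 : ℝ) ^ (n - 1 - i : ℕ) * p.eval (a i) := by
    intro i
    rw [hp, eval_secularPoly, mul_left_comm]
    exact mul_pos (mul_pos (hw.1 i) (ha.2 i)) (sign_prod_erase_sub ha.1 i)
  have hs0 : 0 < (-1 : ℝ) ^ n * p.eval 0 := by
    rw [hp, eval_zero_secularPoly, Finset.prod_neg, Finset.card_univ, Fintype.card_fin,
      show (-1 : ℝ) ^ n * ((1 - ∑ i, w i) * ((-1) ^ n * ∏ i, a i)) =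
        ((-1) ^ n * (-1) ^ n) * ((1 - ∑ i, w i) * ∏ i, a i) by ring, ← mul_pow]
    simpa using mul_pos (sub_pos.2 hw.2) (Finset.prod_pos fun j _ => ha.2 j)
  have hroot : ∀ j : Fin n, ∃ t, 0 < t ∧ t < a j ∧ (∀ i, i < j → a i < t) ∧ p.eval t = 0 := by
    intro j
    have hcont : Continuous fun t => (-1 : ℝ) ^ (n - 1 - j : ℕ) * p.eval t := by fun_prop
    obtain ⟨l, hl0, hlj, hli, hls⟩ : ∃ l, 0 ≤ l ∧ l < a j ∧ (∀ i, i < j → a i ≤ l) ∧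
        (-1 : ℝ) ^ (n - 1 - j : ℕ) * p.eval l < 0 := by
      have hj := j.2
      by_cases h0 : (j : ℕ) = 0
      · refine ⟨0, le_rfl, ha.2 j, fun i hi => ?_, ?_⟩
        · rw [Fin.lt_def] at hi
          omega
        · have : n = (n - 1 - j) + 1 := by omega
          rw [this, pow_succ] at hs0
          linarith
      · set i : Fin n := ⟨j - 1, by omega⟩ with hi
        refine ⟨a i, (ha.2 i).le, ha.1 (by rw [Fin.lt_def, hi]; simp; omega), fun k hk => ?_, ?_⟩
        · refine ha.1.monotone ?_
          rw [Fin.lt_def] at hk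
          rw [Fin.le_def, hi]
          simp
          omega
        · have h := hsa i
          have : n - 1 - (i : ℕ) = (n - 1 - j) + 1 := by simp [hi]; omega
          rw [this, pow_succ] at h
          linarith
    obtain ⟨t, ht, ht0⟩ := intermediate_value_Ioo hlj.le hcont.continuousOn
      (Set.mem_Ioo.2 ⟨hls, hsa j⟩)
    refine ⟨t, hl0.trans_lt ht.1, ht.2, fun i hi => (hli i hi).trans_lt ht.1, ?_⟩
    simpa using ht0
  choose y hy0 hya hay hyp using hroot
  have hreg : y ∈ interlaceRegion a :=
    ⟨hy0, fun i j => ⟨fun hij => (hya j).trans_le (ha.1.monotone hij), hay j i⟩⟩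
  have hpy : p = ∏ k, (X - C (y k)) := by
    refine secularPoly_eq_of_eval (v := y) (interlaceRegion_subset_chamber a hreg).1.injective
      fun i => ?_
    rw [← hp, hyp i, Finset.prod_eq_zero (Finset.mem_univ i) (sub_self _)]
  refine ⟨y, hreg, ?_⟩
  ext i
  have h := eval_secularPoly a w i
  rw [← hp, hpy, eval_prod] at h
  simp only [eval_sub, eval_X, eval_C] at h
  rw [secularWeight, h]
  have h1 := (ha.2 i).ne'
  have h2 := prod_erase_sub_ne_zero ha.1.injective i
  field_simp

lemma injOn_secularWeight {a : Fin n → ℝ} (ha : a ∈ chamber n) :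
    Set.InjOn (secularWeight a) (interlaceRegion a) := by
  intro y hy z hz hyz
  have h : ∏ k, (X - C (y k)) = ∏ k, (X - C (z k)) := by
    rw [← secularPoly_secularWeight ha, ← secularPoly_secularWeight ha, hyz]
  ext j
  have h1 : ∏ k, (y j - z k) = 0 := by
    have := congrArg (eval (y j)) h
    rw [eval_prod, eval_prod, Finset.prod_eq_zero (Finset.mem_univ j) (by simp)] at this
    simpa using this.symm
  obtain ⟨k, -, hk⟩ := Finset.prod_eq_zero_iff.1 h1
  have hk' : y j = z k := sub_eq_zero.1 hk
  rcases lt_trichotomy j k with hjk | rfl | hjk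
  · have h2 := (hy.2 j j).1 le_rfl
    have h3 := (hz.2 j k).2 hjk
    linarith
  · exact hk'
  · have h2 := (hz.2 k k).1 le_rfl
    have h3 := (hy.2 k j).2 hjk
    linarith

lemma image_secularWeight {a : Fin n → ℝ} (ha : a ∈ chamber n) :
    secularWeight a '' interlaceRegion a = openSimplex n := by
  refine Set.Subset.antisymm ?_ fun w hw => ?_
  · rintro _ ⟨y, hy, rfl⟩
    exact secularWeight_mem_openSimplex ha hy
  · exact exists_secularWeight_eq ha hw

lemma vandermondeProd_eq_det (x : Fin n → ℝ) :
    vandermondeProd x = (Matrix.vandermonde x).det := (Matrix.det_vandermonde x).symm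

lemma vandermondeProd_pos {x : Fin n → ℝ} (hx : StrictMono x) : 0 < vandermondeProd x :=
  Finset.prod_pos fun _ _ => Finset.prod_pos fun _ hk => sub_pos.2 (hx (Finset.mem_Ioi.1 hk))

lemma abs_prod_prod_erase_sub (x : Fin n → ℝ) :
    |∏ i, ∏ k ∈ Finset.univ.erase i, (x i - x k)| = vandermondeProd x ^ 2 := by
  have h : ∀ i, ∏ k ∈ Finset.univ.erase i, (x i - x k) =
      (∏ k ∈ Finset.Iio i, (x i - x k)) * ∏ k ∈ Finset.Ioi i, (x i - x k) := by
    intro i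
    have hu : (Finset.univ.erase i : Finset (Fin n)) = Finset.Iio i ∪ Finset.Ioi i := by
      ext k
      simp [lt_or_lt_iff_ne]
    rw [hu, Finset.prod_union]
    exact Finset.disjoint_left.2 fun k h1 h2 =>
      lt_asymm (Finset.mem_Iio.1 h1) (Finset.mem_Ioi.1 h2)
  have h2 : ∏ i, ∏ k ∈ Finset.Iio i, (x i - x k) = vandermondeProd x := by
    refine Finset.prod_comm' fun i k => ?_
    simp
  have h3 : |∏ i, ∏ k ∈ Finset.Ioi i, (x i - x k)| = |vandermondeProd x| := by
    simp only [vandermondeProd, Finset.abs_prod]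
    exact Finset.prod_congr rfl fun i _ => Finset.prod_congr rfl fun k _ => abs_sub_comm _ _
  simp_rw [h]
  rw [Finset.prod_mul_distrib, abs_mul, h2, h3, ← sq, sq_abs]

/-- A Cauchy determinant with denominators cleared. -/
lemma abs_det_prod_erase_sub {a y : Fin n → ℝ} (hy : Function.Injective y) :
    |(Matrix.of fun i j => ∏ k ∈ Finset.univ.erase j, (a i - y k)).det| =
      |vandermondeProd a| * |vandermondeProd y| := by
  set p : Fin n → ℝ[X] := fun j => ∏ k ∈ Finset.univ.erase j, (X - C (y k)) with hp
  -- Both determinants are Vandermonde determinants times the same determinant of coefficients,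
  -- which the diagonal case `a = y` evaluates.
  have hfac : ∀ x : Fin n → ℝ,
      (Matrix.of fun i j => ∏ k ∈ Finset.univ.erase j, (x i - y k)) =
        Matrix.vandermonde x * Matrix.of fun i j : Fin n => (p j).coeff i := by
    intro x
    ext i j
    have hdeg : (p j).natDegree < n := by
      rw [hp, natDegree_prod_of_monic _ _ fun k _ => monic_X_sub_C _]
      simp [Finset.card_erase_of_mem]
      exact j.pos
    have h : ∏ k ∈ Finset.univ.erase j, (x i - y k) = (p j).eval (x i) := by
      simp [hp, eval_prod]
    rw [Matrix.of_apply, h, eval_eq_sum_range' hdeg, Finset.sum_range]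
    simp [Matrix.mul_apply, Matrix.vandermonde_apply, mul_comm]
  have hdet : ∀ x : Fin n → ℝ,
      (Matrix.of fun i j => ∏ k ∈ Finset.univ.erase j, (x i - y k)).det =
        vandermondeProd x * (Matrix.of fun i j : Fin n => (p j).coeff i).det := by
    intro x
    rw [hfac, Matrix.det_mul, vandermondeProd_eq_det]
  have hdiag : (Matrix.of fun i j => ∏ k ∈ Finset.univ.erase j, (y i - y k)) =
      Matrix.diagonal fun i => ∏ k ∈ Finset.univ.erase i, (y i - y k) := by
    ext i j
    by_cases hij : i = j
    · simp [hij]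
    · rw [Matrix.diagonal_apply_ne _ hij]
      exact Finset.prod_eq_zero (Finset.mem_erase.2 ⟨hij, Finset.mem_univ i⟩) (sub_self _)
  have hy0 : vandermondeProd y ≠ 0 := by
    rw [vandermondeProd_eq_det]
    exact Matrix.det_vandermonde_ne_zero_iff.2 hy
  have h1 := congrArg abs (hdet y)
  rw [hdiag, Matrix.det_diagonal, abs_prod_prod_erase_sub, abs_mul, ← sq_abs, sq] at h1
  rw [hdet, abs_mul, ← mul_left_cancel₀ (abs_ne_zero.2 hy0) h1]

/-- The Jacobian matrix of `secularWeight a`. -/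
noncomputable def secularJacobian (a y : Fin n → ℝ) : Matrix (Fin n) (Fin n) ℝ :=
  Matrix.of fun i j => (a i * ∏ k ∈ Finset.univ.erase i, (a i - a k))⁻¹ *
    ∏ k ∈ Finset.univ.erase j, (a i - y k)

lemma hasFDerivAt_secularWeight (a y : Fin n → ℝ) :
    HasFDerivAt (secularWeight a)
      (LinearMap.toContinuousLinearMap (-(Matrix.toLin' (secularJacobian a y)))) y := by
  rw [hasFDerivAt_pi']
  intro i
  have h : HasFDerivAt (fun y : Fin n → ℝ => ∏ k, (a i - y k))
      (∑ j, (∏ k ∈ Finset.univ.erase j, (a i - y k)) •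
        (-(ContinuousLinearMap.proj (R := ℝ) (φ := fun _ : Fin n => ℝ) j))) y := by
    refine HasFDerivAt.finsetProd fun j _ => ?_
    exact (ContinuousLinearMap.proj (R := ℝ) (φ := fun _ : Fin n => ℝ) j).hasFDerivAt.const_sub _
  have h2 := h.mul_const (a i * ∏ k ∈ Finset.univ.erase i, (a i - a k))⁻¹
  simp only [← div_eq_mul_inv] at h2
  refine h2.congr_fderiv ?_
  ext v
  simp only [secularJacobian, smul_apply, sum_apply, neg_apply, ContinuousLinearMap.proj_apply, smul_eq_mul, mul_neg,
    Finset.sum_neg_distrib, ContinuousLinearMap.comp_apply, LinearMap.coe_toContinuousLinearMap',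
    LinearMap.neg_apply, Matrix.toLin'_apply, Pi.neg_apply, Matrix.mulVec, dotProduct,
    Matrix.of_apply, Finset.mul_sum, neg_inj]
  exact Finset.sum_congr rfl fun j _ => by ring

lemma abs_det_secularJacobian {a y : Fin n → ℝ} (ha : a ∈ chamber n) (hy : y ∈ chamber n) :
    |(LinearMap.toContinuousLinearMap (-(Matrix.toLin' (secularJacobian a y)))).det| =
      vandermondeProd y / ((∏ i, a i) * vandermondeProd a) := by
  have h1 : secularJacobian a y = Matrix.of fun i j =>
      (fun i => (a i * ∏ k ∈ Finset.univ.erase i, (a i - a k))⁻¹) i *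
        (Matrix.of fun i j => ∏ k ∈ Finset.univ.erase j, (a i - y k)) i j := rfl
  have hVa := vandermondeProd_pos ha.1
  have hVy := vandermondeProd_pos hy.1
  have hprod : 0 < ∏ i, a i := Finset.prod_pos fun j _ => ha.2 j
  rw [ContinuousLinearMap.det, LinearMap.coe_toContinuousLinearMap, ← neg_one_smul ℝ,
    LinearMap.det_smul, abs_mul, LinearMap.det_toLin', h1, Matrix.det_mul_column, abs_mul,
    abs_det_prod_erase_sub hy.1.injective, Finset.prod_inv_distrib, abs_inv,
    Finset.prod_mul_distrib, abs_mul, abs_prod_prod_erase_sub, abs_of_pos hVa, abs_of_pos hVy,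
    abs_of_pos hprod, abs_pow]
  simp only [abs_neg, abs_one, one_pow, one_mul]
  field_simp

/-- The change of variables from the weights to the roots of the secular polynomial. -/
lemma setLIntegral_openSimplex {a : Fin n → ℝ} (ha : a ∈ chamber n)
    (φ : (Fin n → ℝ) → ENNReal) :
    ∫⁻ w in openSimplex n, φ w = ∫⁻ y in interlaceRegion a,
      ENNReal.ofReal (vandermondeProd y / ((∏ i, a i) * vandermondeProd a)) *
        φ (secularWeight a y) := by
  rw [← image_secularWeight ha, lintegral_image_eq_lintegral_abs_det_fderiv_mul volume
    (measurableSet_interlaceRegion a)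
    (fun y _ => (hasFDerivAt_secularWeight a y).hasFDerivWithinAt) (injOn_secularWeight ha)]
  refine setLIntegral_congr_fun (measurableSet_interlaceRegion a) fun y hy => ?_
  simp only [abs_det_secularJacobian ha (interlaceRegion_subset_chamber a hy)]

end Secular

/-! ### Images of Lebesgue measure under quadratic functions -/

instance complexMatrixSecondCountableTopology {m : ℕ} :
    SecondCountableTopology (Matrix (Fin m) (Fin m) ℂ) :=
  inferInstanceAs (SecondCountableTopology (Fin m → Fin m → ℂ))

instance unitaryGroupCompactSpace {m : ℕ} : CompactSpace (Matrix.unitaryGroup (Fin m) ℂ) := by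
  suffices h : IsCompact
      ((Matrix.unitaryGroup (Fin m) ℂ : Submonoid _) : Set (Matrix (Fin m) (Fin m) ℂ)) from
    isCompact_iff_compactSpace.1 h
  have hK : IsCompact (X := Matrix (Fin m) (Fin m) ℂ) (Set.univ.pi fun _ : Fin m =>
      Set.univ.pi fun _ : Fin m => Metric.closedBall (0 : ℂ) 1) :=
    isCompact_univ_pi (X := fun _ : Fin m => Fin m → ℂ) fun _ =>
      isCompact_univ_pi fun _ => isCompact_closedBall _ _
  refine hK.of_isClosed_subset ?_ fun A hA i _ j _ => ?_
  · have h : ((Matrix.unitaryGroup (Fin m) ℂ : Submonoid _) : Set (Matrix (Fin m) (Fin m) ℂ)) =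
        {A | A * star A = 1} := by
      ext A
      exact Matrix.mem_unitaryGroup_iff
    rw [h]
    exact isClosed_eq (by fun_prop) continuous_const
  · rw [mem_closedBall_zero_iff]
    exact entry_norm_bound_of_unitary hA i j

open scoped Pointwise in
lemma measure_quadratic_le {E : Type*} [NormedAddCommGroup E] [NormedSpace ℝ E]
    [MeasurableSpace E] [BorelSpace E] [FiniteDimensional ℝ E] (μ : Measure E)
    [μ.IsAddHaarMeasure] {q : E → ℝ} (hhom : ∀ (t : ℝ) x, q (t • x) = t ^ 2 * q x)
    (hbd : ∀ x, ‖x‖ ^ 2 ≤ q x) {k : ℕ} (hk : Module.finrank ℝ E = 2 * (k + 1)) (t : ℝ) :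
    μ {x | q x ≤ t} = ENNReal.ofReal ((max t 0) ^ (k + 1)) * μ {x | q x ≤ 1} := by
  have hscale : ∀ t : ℝ, 0 ≤ t →
      μ {x | q x ≤ t} = ENNReal.ofReal (t ^ (k + 1)) * μ {x | q x ≤ 1} := by
    intro t ht
    have hset : {x | q x ≤ t} = Real.sqrt t • {x | q x ≤ 1} := by
      rcases ht.eq_or_lt with rfl | ht'
      · have hq0 : q 0 = 0 := by simpa using hhom 0 0
        have hne : {x : E | q x ≤ 1}.Nonempty := ⟨0, by simp [hq0]⟩
        rw [Real.sqrt_zero, Set.zero_smul_set hne]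
        ext x
        constructor
        · intro hx
          have := (hbd x).trans hx
          have h0 : ‖x‖ = 0 := by nlinarith [norm_nonneg x]
          simpa using h0
        · intro hx
          have hx' : x = 0 := by simpa using hx
          simp [hx', hq0]
      · have hs : Real.sqrt t ≠ 0 := (Real.sqrt_pos.2 ht').ne'
        ext x
        rw [Set.mem_smul_set_iff_inv_smul_mem₀ hs]
        simp only [Set.mem_ofPred_eq, hhom, inv_pow, Real.sq_sqrt ht]
        rw [inv_mul_le_iff₀ ht', mul_one]
    rw [hset, Measure.addHaar_smul, hk, pow_mul, Real.sq_sqrt ht, abs_of_nonneg (by positivity)]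
  rcases le_total 0 t with ht | ht
  · rw [max_eq_left ht, hscale t ht]
  · rw [max_eq_right ht, ← hscale 0 le_rfl]
    refine le_antisymm (measure_mono fun x hx => le_trans hx ht) ?_
    rw [hscale 0 le_rfl]
    simp

/-- The image of Lebesgue measure under a definite quadratic function on a real vector space of
dimension `2 (k + 1)` has density proportional to `r ^ k` on `(0, ∞)`. -/
lemma map_quadratic {E : Type*} [NormedAddCommGroup E] [NormedSpace ℝ E]
    [MeasurableSpace E] [BorelSpace E] [FiniteDimensional ℝ E] (μ : Measure E)
    [μ.IsAddHaarMeasure] {q : E → ℝ} (hq : Continuous q)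
    (hhom : ∀ (t : ℝ) x, q (t • x) = t ^ 2 * q x)
    (hbd : ∀ x, ‖x‖ ^ 2 ≤ q x) {k : ℕ} (hk : Module.finrank ℝ E = 2 * (k + 1)) :
    ∃ c : ENNReal, c ≠ ⊤ ∧ μ.map q =
      c • (volume.restrict (Set.Ioi (0 : ℝ))).withDensity fun r => ENNReal.ofReal (r ^ k) := by
  set v := μ {x | q x ≤ 1} with hv
  have hvtop : v ≠ ⊤ := by
    refine ((measure_mono (t := Metric.closedBall (0 : E) 1) fun x hx => ?_).trans_lt
      measure_closedBall_lt_top).ne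
    have h1 : ‖x‖ ^ 2 ≤ 1 := (hbd x).trans hx
    rw [mem_closedBall_zero_iff]
    exact (sq_le_one_iff₀ (norm_nonneg x)).1 h1
  have hle := measure_quadratic_le μ hhom hbd hk
  rw [← hv] at hle
  have hfin : ∀ t, μ {x | q x ≤ t} ≠ ⊤ := fun t => by
    rw [hle]
    exact ENNReal.mul_ne_top ENNReal.ofReal_ne_top hvtop
  have hmeas : ∀ t, MeasurableSet {x | q x ≤ t} := fun t =>
    measurableSet_le hq.measurable measurable_const
  have hIoc : ∀ a b : ℝ, a < b → μ.map q (Set.Ioc a b) =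
      ENNReal.ofReal ((max b 0) ^ (k + 1) - (max a 0) ^ (k + 1)) * v := by
    intro a b hab
    have hset : q ⁻¹' Set.Ioc a b = {x | q x ≤ b} \ {x | q x ≤ a} := by
      ext x
      simp [and_comm]
    have hsub : {x | q x ≤ a} ⊆ {x | q x ≤ b} := fun x hx => le_trans hx hab.le
    rw [Measure.map_apply hq.measurable measurableSet_Ioc, hset, measure_sdiff hsub (hmeas a).nullMeasurableSet (hfin a), hle, hle,
      ENNReal.ofReal_sub _ (by positivity), ENNReal.sub_mul fun _ _ => hvtop]
  refine ⟨(k + 1 : ℕ) * v, ENNReal.mul_ne_top (ENNReal.natCast_ne_top _) hvtop, ?_⟩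
  refine Measure.ext_of_Ioc' _ _ (fun a b hab => ?_) fun a b hab => ?_
  · rw [hIoc a b hab]
    exact ENNReal.mul_ne_top ENNReal.ofReal_ne_top hvtop
  · have hmax : max a 0 ≤ max b 0 := max_le_max hab.le le_rfl
    have hint : ∫⁻ r in Set.Ioc (max a 0) (max b 0), ENNReal.ofReal (r ^ k) =
        ENNReal.ofReal (((max b 0) ^ (k + 1) - (max a 0) ^ (k + 1)) / (k + 1)) := by
      rw [← integral_pow, intervalIntegral.integral_of_le hmax,
        ofReal_integral_eq_lintegral_ofReal]
      · exact (intervalIntegrable_iff_integrableOn_Ioc_of_le hmax).1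
          (Continuous.intervalIntegrable (by fun_prop) _ _)
      · filter_upwards [ae_restrict_mem measurableSet_Ioc] with r hr
        exact pow_nonneg ((le_max_right a 0).trans hr.1.le) k
    have hset : Set.Ioc a b ∩ Set.Ioi 0 = Set.Ioc (max a 0) (max b 0) := by
      ext r
      simp only [Set.mem_inter_iff, Set.mem_Ioc, Set.mem_Ioi, max_lt_iff, le_max_iff]
      constructor
      · rintro ⟨⟨h1, h2⟩, h3⟩
        exact ⟨⟨h1, h3⟩, Or.inl h2⟩
      · rintro ⟨⟨h1, h3⟩, h2⟩
        exact ⟨⟨h1, h2.resolve_right (not_le.2 h3)⟩, h3⟩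
    rw [hIoc a b hab, Measure.smul_apply, withDensity_apply _ measurableSet_Ioc,
      Measure.restrict_restrict measurableSet_Ioc, hset, hint, smul_eq_mul, mul_right_comm]
    congr 1
    rw [← ENNReal.ofReal_natCast, ← ENNReal.ofReal_mul (by positivity)]
    congr 1
    push_cast
    field_simp

/-- The squared Euclidean norm of a complex vector. -/
noncomputable def normSqSum {k : ℕ} (g : Fin k → ℂ) : ℝ := ∑ i, Complex.normSq (g i)

lemma continuous_normSqSum {k : ℕ} : Continuous (normSqSum (k := k)) :=
  continuous_finsetSum _ fun i _ => Complex.continuous_normSq.comp (continuous_apply i)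

lemma normSqSum_nonneg {k : ℕ} (g : Fin k → ℂ) : 0 ≤ normSqSum g :=
  Finset.sum_nonneg fun _ _ => Complex.normSq_nonneg _

lemma normSq_real_smul (t : ℝ) (z : ℂ) : Complex.normSq (t • z) = t ^ 2 * Complex.normSq z := by
  rw [Complex.real_smul, Complex.normSq_mul, Complex.normSq_ofReal, sq]

lemma normSqSum_smul {k : ℕ} (t : ℝ) (g : Fin k → ℂ) :
    normSqSum (t • g) = t ^ 2 * normSqSum g := by
  simp only [normSqSum, Pi.smul_apply, normSq_real_smul, Finset.mul_sum]

lemma sq_norm_le_normSqSum {k : ℕ} (g : Fin k → ℂ) : ‖g‖ ^ 2 ≤ normSqSum g := by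
  have h : ‖g‖ ≤ Real.sqrt (normSqSum g) := by
    refine (pi_norm_le_iff_of_nonneg (Real.sqrt_nonneg _)).2 fun i => ?_
    refine Real.le_sqrt_of_sq_le ?_
    rw [← Complex.normSq_eq_norm_sq]
    exact Finset.single_le_sum (f := fun i => Complex.normSq (g i))
      (fun _ _ => Complex.normSq_nonneg _) (Finset.mem_univ i)
  calc ‖g‖ ^ 2 ≤ Real.sqrt (normSqSum g) ^ 2 := by gcongr
    _ = normSqSum g := Real.sq_sqrt (normSqSum_nonneg g)

lemma map_normSq : ∃ c : ENNReal, c ≠ ⊤ ∧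
    (volume : Measure ℂ).map Complex.normSq = c • volume.restrict (Set.Ioi (0 : ℝ)) := by
  obtain ⟨c, hc, h⟩ := map_quadratic (volume : Measure ℂ) Complex.continuous_normSq
    normSq_real_smul (fun z => (Complex.normSq_eq_norm_sq z).ge) (k := 0)
    (by rw [Complex.finrank_real_complex])
  refine ⟨c, hc, ?_⟩
  simpa using h

lemma map_normSqSum (k : ℕ) : ∃ c : ENNReal, c ≠ ⊤ ∧
    (volume : Measure (Fin (k + 1) → ℂ)).map normSqSum =
      c • (volume.restrict (Set.Ioi (0 : ℝ))).withDensity fun r => ENNReal.ofReal (r ^ k) :=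
  map_quadratic volume continuous_normSqSum normSqSum_smul sq_norm_le_normSqSum (by
    rw [Module.finrank_pi_fintype]
    simp [Complex.finrank_real_complex, mul_comm])

lemma map_pi_normSq (n : ℕ) : ∃ c : ENNReal, c ≠ ⊤ ∧
    (volume : Measure (Fin n → ℂ)).map (fun g i => Complex.normSq (g i)) =
      c • volume.restrict (orthant n) := by
  obtain ⟨c, hc, h⟩ := map_normSq
  have hσ : SigmaFinite (Measure.map Complex.normSq (volume : Measure ℂ)) := by
    rw [h]
    lift c to NNReal using hc
    exact inferInstanceAs (SigmaFinite (c • volume.restrict (Set.Ioi (0 : ℝ))))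
  refine ⟨c ^ n, ENNReal.pow_ne_top hc, ?_⟩
  rw [volume_pi, Measure.pi_map_pi (fun _ => Complex.continuous_normSq.measurable.aemeasurable)]
  refine Measure.pi_eq fun s hs => ?_
  rw [h, orthant_eq_pi, volume_pi, Measure.smul_apply, Measure.restrict_pi_pi, Measure.pi_pi]
  simp [Finset.prod_mul_distrib]

lemma lintegral_normSq_fin_add (n ν : ℕ) : ∃ c : ENNReal, c ≠ ⊤ ∧
    ∀ φ : (Fin n → ℝ) → ℝ → ENNReal, Measurable (Function.uncurry φ) →
      ∫⁻ g : Fin (n + (ν + 1)) → ℂ, φ (fun j => Complex.normSq (g (Fin.castAdd _ j)))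
          (normSqSum fun i => g (Fin.natAdd n i)) =
        c * ∫⁻ s in orthant n, ∫⁻ r in Set.Ioi (0 : ℝ), ENNReal.ofReal (r ^ ν) * φ s r := by
  obtain ⟨c₁, hc₁, h₁⟩ := map_pi_normSq n
  obtain ⟨c₂, hc₂, h₂⟩ := map_normSqSum ν
  refine ⟨c₁ * c₂, ENNReal.mul_ne_top hc₁ hc₂, fun φ hφ => ?_⟩
  have hm₁ : Measurable fun (g : Fin n → ℂ) i => Complex.normSq (g i) :=
    measurable_pi_iff.2 fun i => Complex.continuous_normSq.measurable.comp (measurable_pi_apply i)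
  have hm₂ : Measurable (normSqSum (k := ν + 1)) := continuous_normSqSum.measurable
  have e₁ := (volume_measurePreserving_piCongrLeft (fun _ : Fin (n + (ν + 1)) => ℂ)
    finSumFinEquiv)
  have e₂ := (volume_measurePreserving_sumPiEquivProdPi
    (fun _ : Fin n ⊕ Fin (ν + 1) => ℂ)).symm
  have e := e₁.comp e₂
  rw [← e.lintegral_comp_emb ((MeasurableEquiv.measurableEmbedding _).comp
    (MeasurableEquiv.measurableEmbedding _))]
  have hsplit : ∀ p : (Fin n → ℂ) × (Fin (ν + 1) → ℂ),
      φ (fun j => Complex.normSq (((MeasurableEquiv.piCongrLeft (fun _ : Fin (n + (ν + 1)) => ℂ)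
        finSumFinEquiv) ∘ (MeasurableEquiv.sumPiEquivProdPi
          (fun _ : Fin n ⊕ Fin (ν + 1) => ℂ)).symm) p (Fin.castAdd _ j)))
        (normSqSum fun i => ((MeasurableEquiv.piCongrLeft (fun _ : Fin (n + (ν + 1)) => ℂ)
        finSumFinEquiv) ∘ (MeasurableEquiv.sumPiEquivProdPi
          (fun _ : Fin n ⊕ Fin (ν + 1) => ℂ)).symm) p (Fin.natAdd n i)) =
      Function.uncurry φ (Prod.map (fun g i => Complex.normSq (g i)) normSqSum p) := by
    intro p
    have hl : ∀ j, ((MeasurableEquiv.piCongrLeft (fun _ : Fin (n + (ν + 1)) => ℂ)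
        finSumFinEquiv) ∘ (MeasurableEquiv.sumPiEquivProdPi
          (fun _ : Fin n ⊕ Fin (ν + 1) => ℂ)).symm) p (Fin.castAdd _ j) = p.1 j := by
      intro j
      rw [← finSumFinEquiv_apply_left]
      exact Equiv.piCongrLeft_sumInl (fun _ => ℂ) finSumFinEquiv p.1 p.2 j
    have hr : ∀ j, ((MeasurableEquiv.piCongrLeft (fun _ : Fin (n + (ν + 1)) => ℂ)
        finSumFinEquiv) ∘ (MeasurableEquiv.sumPiEquivProdPi
          (fun _ : Fin n ⊕ Fin (ν + 1) => ℂ)).symm) p (Fin.natAdd n j) = p.2 j := by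
      intro j
      rw [← finSumFinEquiv_apply_right]
      exact Equiv.piCongrLeft_sumInr (fun _ => ℂ) finSumFinEquiv p.1 p.2 j
    simp only [hl, hr]
    rfl
  simp_rw [hsplit]
  have hρ : Measurable fun r : ℝ => ENNReal.ofReal (r ^ ν) := by fun_prop
  have hinner : Measurable fun s => ∫⁻ r in Set.Ioi (0 : ℝ), ENNReal.ofReal (r ^ ν) * φ s r :=
    Measurable.lintegral_prod_right' (f := fun p : (Fin n → ℝ) × ℝ =>
      ENNReal.ofReal (p.2 ^ ν) * φ p.1 p.2) ((hρ.comp measurable_snd).mul hφ)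
  have hs : ∀ s, ∫⁻ r, Function.uncurry φ (s, r)
      ∂(c₂ • (volume.restrict (Set.Ioi (0 : ℝ))).withDensity fun r => ENNReal.ofReal (r ^ ν)) =
      c₂ * ∫⁻ r in Set.Ioi (0 : ℝ), ENNReal.ofReal (r ^ ν) * φ s r := by
    intro s
    have hs : Measurable fun r => φ s r := hφ.comp measurable_prodMk_left
    rw [lintegral_smul_measure, smul_eq_mul]
    congr 1
    exact lintegral_withDensity_eq_lintegral_mul _ hρ hs
  rw [← lintegral_map hφ (hm₁.prodMap hm₂), Measure.volume_eq_prod,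
    ← Measure.map_prod_map _ _ hm₁ hm₂, h₁, h₂]
  lift c₁ to NNReal using hc₁
  lift c₂ to NNReal using hc₂
  have hsf : SFinite ((c₂ : ENNReal) • (volume.restrict (Set.Ioi (0 : ℝ))).withDensity
      fun r => ENNReal.ofReal (r ^ ν)) := inferInstance
  rw [lintegral_prod _ hφ.aemeasurable]
  simp_rw [hs]
  rw [lintegral_smul_measure, smul_eq_mul, lintegral_const_mul _ hinner, mul_assoc]

/-! ### The law of a row of a Haar distributed unitary matrix -/

lemma ofReal_normSqSum {k : ℕ} (g : Fin k → ℂ) : (normSqSum g : ℂ) = g ⬝ᵥ star g := by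
  simp [normSqSum, dotProduct, Complex.mul_conj]

lemma normSqSum_vecMul {k : ℕ} {V : Matrix (Fin k) (Fin k) ℂ} (hV : V ∈ Matrix.unitaryGroup _ ℂ)
    (g : Fin k → ℂ) : normSqSum (Matrix.vecMul g V) = normSqSum g := by
  apply Complex.ofReal_injective
  rw [ofReal_normSqSum, ofReal_normSqSum, Matrix.star_vecMul, ← Matrix.dotProduct_mulVec,
    Matrix.mulVec_mulVec, ← Matrix.star_eq_conjTranspose, Matrix.mem_unitaryGroup_iff.1 hV,
    Matrix.one_mulVec]

lemma normSqSum_row {k : ℕ} {V : Matrix (Fin k) (Fin k) ℂ} (hV : V ∈ Matrix.unitaryGroup _ ℂ)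
    (i : Fin k) : normSqSum (V i) = 1 := by
  apply Complex.ofReal_injective
  rw [ofReal_normSqSum, Complex.ofReal_one]
  have h := congrFun (congrFun (Matrix.mem_unitaryGroup_iff.1 hV) i) i
  simpa [Matrix.mul_apply, dotProduct] using h

lemma volume_normSqSum_lt_one_ne_zero (k : ℕ) :
    volume {g : Fin k → ℂ | normSqSum g < 1} ≠ 0 :=
  (IsOpen.measure_pos _ (isOpen_lt continuous_normSqSum continuous_const)
    ⟨0, by simp [normSqSum]⟩).ne'

lemma volume_normSqSum_lt_one_ne_top (k : ℕ) :
    volume {g : Fin k → ℂ | normSqSum g < 1} ≠ ⊤ := by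
  refine ((measure_mono (t := Metric.closedBall (0 : Fin k → ℂ) 1) fun x hx => ?_).trans_lt
      measure_closedBall_lt_top).ne
  have h1 : ‖x‖ ^ 2 ≤ 1 := (sq_norm_le_normSqSum x).trans (le_of_lt hx)
  rw [mem_closedBall_zero_iff]
  exact (sq_le_one_iff₀ (norm_nonneg x)).1 h1

/-- A unitary map preserves Lebesgue measure because it preserves the unit ball. -/
lemma measurePreserving_vecMul {k : ℕ} {V : Matrix (Fin k) (Fin k) ℂ}
    (hV : V ∈ Matrix.unitaryGroup _ ℂ) :
    MeasurePreserving (fun g : Fin k → ℂ => Matrix.vecMul g V) := by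
  set f : (Fin k → ℂ) →ₗ[ℝ] (Fin k → ℂ) := (Matrix.vecMulLinear V).restrictScalars ℝ with hf
  set f' : (Fin k → ℂ) →ₗ[ℝ] (Fin k → ℂ) := (Matrix.vecMulLinear (star V)).restrictScalars ℝ
    with hf'
  have hfg : f ∘ₗ f' = LinearMap.id := by
    refine LinearMap.ext fun g => ?_
    change Matrix.vecMul (Matrix.vecMul g (star V)) V = g
    rw [Matrix.vecMul_vecMul, Matrix.mem_unitaryGroup_iff'.1 hV, Matrix.vecMul_one]
  have hdet : LinearMap.det f ≠ 0 := by
    intro h0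
    have := congrArg LinearMap.det hfg
    rw [LinearMap.det_comp, h0, zero_mul, LinearMap.det_id] at this
    exact zero_ne_one this
  have hball : ENNReal.ofReal |(LinearMap.det f)⁻¹| = 1 := by
    have h1 := Measure.addHaar_preimage_linearMap volume hdet {g : Fin k → ℂ | normSqSum g < 1}
    have h2 : f ⁻¹' {g : Fin k → ℂ | normSqSum g < 1} = {g | normSqSum g < 1} := by
      ext g
      change normSqSum (Matrix.vecMul g V) < 1 ↔ _
      rw [normSqSum_vecMul hV]
      rfl
    rw [h2] at h1
    refine ((ENNReal.mul_left_inj (volume_normSqSum_lt_one_ne_zero k)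
      (volume_normSqSum_lt_one_ne_top k)).1 ?_)
    rw [one_mul, ← h1]
  refine ⟨?_, ?_⟩
  · exact (LinearMap.continuous_of_finiteDimensional f).measurable
  · have h := Measure.map_linearMap_addHaar_eq_smul_addHaar (volume : Measure (Fin k → ℂ)) hdet
    rw [hball, one_smul] at h
    exact h

lemma exists_unitary_row {k : ℕ} (i : Fin k) {g : Fin k → ℂ} (hg : normSqSum g = 1) :
    ∃ V ∈ Matrix.unitaryGroup (Fin k) ℂ, V i = g := by
  have hnorm : ‖WithLp.toLp 2 g‖ = 1 := by
    have h : ‖WithLp.toLp 2 g‖ ^ 2 = 1 := by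
      rw [EuclideanSpace.norm_sq_eq, ← hg]
      exact Finset.sum_congr rfl fun j _ => (Complex.normSq_eq_norm_sq _).symm
    exact (pow_eq_one_iff_of_nonneg (norm_nonneg _) two_ne_zero).1 h
  obtain ⟨b, hb⟩ := Orthonormal.exists_orthonormalBasis_extension_of_card_eq (𝕜 := ℂ)
    (E := EuclideanSpace ℂ (Fin k)) (ι := Fin k) (by simp)
    (v := fun _ => WithLp.toLp 2 g) (s := {i}) (by
      rw [orthonormal_iff_ite]
      rintro ⟨x, hx⟩ ⟨y, hy⟩
      obtain rfl : x = i := hx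
      obtain rfl : y = x := hy
      simp [Set.domRestrict, hnorm])
  have hmem := (EuclideanSpace.basisFun (Fin k) ℂ).toMatrix_orthonormalBasis_mem_unitary b
  refine ⟨((EuclideanSpace.basisFun (Fin k) ℂ).toBasis.toMatrix b).transpose, ?_, ?_⟩
  · exact Matrix.transpose_mem_unitaryGroup_iff.2 hmem
  · ext j
    simp [Module.Basis.toMatrix_apply, hb i rfl]

/-- The squared moduli of the first `n` entries of the last row. -/
noncomputable def lastRowWeight (n ν : ℕ) (V : Matrix (Fin (n + ν + 1)) (Fin (n + ν + 1)) ℂ)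
    (j : Fin n) : ℝ :=
  Complex.normSq (V (Fin.last (n + ν)) (Fin.castAdd (ν + 1) j : Fin (n + (ν + 1))))

/-- The squared moduli of the first `n` entries of a vector, normalized by its length. -/
noncomputable def projWeight (n ν : ℕ) (g : Fin (n + ν + 1) → ℂ) (j : Fin n) : ℝ :=
  Complex.normSq (g (Fin.castAdd (ν + 1) j : Fin (n + (ν + 1)))) / normSqSum g

lemma measurable_projWeight (n ν : ℕ) : Measurable (projWeight n ν) :=
  measurable_pi_iff.2 fun _ => (Complex.continuous_normSq.measurable.comp
    (measurable_pi_apply _)).div continuous_normSqSum.measurable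

lemma projWeight_smul {n ν : ℕ} {t : ℝ} (ht : t ≠ 0) (g : Fin (n + ν + 1) → ℂ) :
    projWeight n ν (t • g) = projWeight n ν g := by
  ext j
  simp only [projWeight, Pi.smul_apply, normSq_real_smul, normSqSum_smul]
  exact mul_div_mul_left _ _ (pow_ne_zero 2 ht)

lemma normSqSum_fin_add {n ν : ℕ} (g : Fin (n + (ν + 1)) → ℂ) :
    normSqSum g = ∑ j, Complex.normSq (g (Fin.castAdd (ν + 1) j)) +
      normSqSum fun i => g (Fin.natAdd n i) := by
  simp only [normSqSum]
  exact Fin.sum_univ_add _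

lemma smul_mem_openSimplex_iff {n : ℕ} {S : ℝ} (hS : 0 < S) (w : Fin n → ℝ) :
    (S • w ∈ orthant n ∧ ∑ j, (S • w) j < S) ↔ w ∈ openSimplex n := by
  simp only [orthant, openSimplex, Set.mem_ofPred_eq, Pi.smul_apply, smul_eq_mul, Set.mem_Ioi,
    ← Finset.mul_sum]
  refine and_congr (forall_congr' fun i => ?_) ?_
  · exact mul_pos_iff_of_pos_left hS
  · exact mul_lt_iff_lt_one_right hS

lemma lintegral_smul_comp {n : ℕ} {S : ℝ} (hS : 0 < S) (F : (Fin n → ℝ) → ENNReal) :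
    ∫⁻ s, F s = ENNReal.ofReal (S ^ n) * ∫⁻ w, F (S • w) := by
  have hemb : MeasurableEmbedding fun w : Fin n → ℝ => S • w :=
    (Homeomorph.smulOfNeZero S hS.ne').measurableEmbedding
  rw [← hemb.lintegral_map, Measure.map_addHaar_smul volume hS.ne', lintegral_smul_measure,
    smul_eq_mul, ← mul_assoc, ← ENNReal.ofReal_mul (by positivity)]
  have h : S ^ n * |(S ^ Module.finrank ℝ (Fin n → ℝ))⁻¹| = 1 := by
    rw [Module.finrank_fin_fun, abs_of_pos (by positivity)]
    exact mul_inv_cancel₀ (by positivity)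
  rw [h, ENNReal.ofReal_one, one_mul]

/-- The normalized weights of a uniformly distributed vector of the ball follow a Dirichlet law. -/
lemma lintegral_ball_projWeight (n ν : ℕ) : ∃ c : ENNReal,
    ∀ φ : (Fin n → ℝ) → ENNReal, Measurable φ →
      ∫⁻ g in {g : Fin (n + ν + 1) → ℂ | normSqSum g < 1}, φ (projWeight n ν g) =
        c * ∫⁻ w in openSimplex n, ENNReal.ofReal ((1 - ∑ j, w j) ^ ν) * φ w := by
  obtain ⟨c, -, hc⟩ := lintegral_normSq_fin_add n ν
  refine ⟨c * ∫⁻ S in Set.Ioo (0 : ℝ) 1, ENNReal.ofReal (S ^ n * S ^ ν), fun φ hφ => ?_⟩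
  have hm : MeasurableSet {g : Fin (n + ν + 1) → ℂ | normSqSum g < 1} :=
    measurableSet_lt continuous_normSqSum.measurable measurable_const
  set ψ : (Fin n → ℝ) → ℝ → ENNReal := fun s S =>
    (Set.Iio (1 : ℝ)).indicator 1 S * φ (S⁻¹ • s) with hψ
  have hψm : Measurable (Function.uncurry ψ) := by
    refine Measurable.mul ?_ (hφ.comp ?_)
    · exact (measurable_one.indicator measurableSet_Iio).comp measurable_snd
    · fun_prop
  have h1 : ∫⁻ g in {g : Fin (n + ν + 1) → ℂ | normSqSum g < 1}, φ (projWeight n ν g) =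
      ∫⁻ g : Fin (n + (ν + 1)) → ℂ, (fun s r => ψ s (∑ j, s j + r))
        (fun j => Complex.normSq (g (Fin.castAdd _ j))) (normSqSum fun i => g (Fin.natAdd n i)) := by
    rw [← lintegral_indicator hm]
    refine lintegral_congr fun g => ?_
    simp only [hψ]
    rw [← normSqSum_fin_add (n := n) (ν := ν) g]
    have hp : ((normSqSum g)⁻¹ • fun j =>
        Complex.normSq (g (Fin.castAdd (ν + 1) j : Fin (n + (ν + 1))))) = projWeight n ν g := by
      ext j
      simp only [Pi.smul_apply, smul_eq_mul, projWeight]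
      rw [div_eq_inv_mul]
    rw [hp]
    by_cases hg : normSqSum g < 1
    · rw [Set.indicator_of_mem (by exact hg), Set.indicator_of_mem (by exact hg)]
      simp
    · rw [Set.indicator_of_notMem (by exact hg), Set.indicator_of_notMem (by exact hg), zero_mul]
  have hψm' : Measurable (Function.uncurry fun (s : Fin n → ℝ) r => ψ s (∑ j, s j + r)) :=
    hψm.comp (g := Function.uncurry ψ) (f := fun p : (Fin n → ℝ) × ℝ => (p.1, ∑ j, p.1 j + p.2))
      (by fun_prop)
  rw [h1, hc _ hψm', mul_assoc]
  congr 1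
  -- With `S = ∑ s_j + r` the integral becomes one over `S` of integrals over scaled simplices.
  set Φ : (Fin n → ℝ) → ℝ → ENNReal := fun s S =>
    (orthant n).indicator 1 s * ((Set.Ioi (0 : ℝ)).indicator 1 (S - ∑ j, s j) *
      (ENNReal.ofReal ((S - ∑ j, s j) ^ ν) * ψ s S)) with hΦ
  have hΦm : Measurable (Function.uncurry Φ) := by
    refine Measurable.mul ?_ (Measurable.mul ?_ (Measurable.mul ?_ hψm))
    · exact (measurable_one.indicator (measurableSet_orthant n)).comp measurable_fst
    · exact (measurable_one.indicator measurableSet_Ioi).comp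
        (f := fun p : (Fin n → ℝ) × ℝ => p.2 - ∑ j, p.1 j) (by fun_prop)
    · fun_prop
  have h2 : ∫⁻ s in orthant n, ∫⁻ r in Set.Ioi (0 : ℝ),
      ENNReal.ofReal (r ^ ν) * ψ s (∑ j, s j + r) = ∫⁻ s, ∫⁻ S, Φ s S := by
    rw [← lintegral_indicator (measurableSet_orthant n)]
    refine lintegral_congr fun s => ?_
    by_cases hs : s ∈ orthant n
    · rw [Set.indicator_of_mem hs, ← lintegral_indicator measurableSet_Ioi,
        ← lintegral_sub_right_eq_self _ (∑ j, s j)]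
      refine lintegral_congr fun S => ?_
      simp only [hΦ, Set.indicator_of_mem hs, Pi.one_apply, one_mul]
      by_cases hS : S - ∑ j, s j ∈ Set.Ioi (0 : ℝ)
      · rw [Set.indicator_of_mem hS, Set.indicator_of_mem hS]
        simp
      · rw [Set.indicator_of_notMem hS, Set.indicator_of_notMem hS, zero_mul]
    · simp [hΦ, Set.indicator_of_notMem hs]
  set D : ENNReal := ∫⁻ w in openSimplex n, ENNReal.ofReal ((1 - ∑ j, w j) ^ ν) * φ w with hD
  have h3 : ∀ S, ∫⁻ s, Φ s S =
      (Set.Ioo (0 : ℝ) 1).indicator (fun S => ENNReal.ofReal (S ^ n * S ^ ν) * D) S := by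
    intro S
    by_cases hS0 : 0 < S
    · rw [lintegral_smul_comp hS0]
      by_cases hS1 : S < 1
      · rw [Set.indicator_of_mem (by exact ⟨hS0, hS1⟩), ENNReal.ofReal_mul (by positivity),
          mul_assoc]
        congr 1
        rw [hD, ← lintegral_const_mul' _ _ ENNReal.ofReal_ne_top,
          ← lintegral_indicator (measurableSet_openSimplex n)]
        refine lintegral_congr fun w => ?_
        simp only [hΦ, hψ, smul_smul, inv_mul_cancel₀ hS0.ne', one_smul]
        rw [Set.indicator_of_mem (by exact hS1 : S ∈ Set.Iio (1 : ℝ))]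
        by_cases hw : w ∈ openSimplex n
        · obtain ⟨h4, h5⟩ := (smul_mem_openSimplex_iff hS0 w).2 hw
          rw [Set.indicator_of_mem hw, Set.indicator_of_mem h4,
            Set.indicator_of_mem (by exact sub_pos.2 h5)]
          have h6 : S - ∑ j, (S • w) j = S * (1 - ∑ j, w j) := by
            simp only [Pi.smul_apply, smul_eq_mul, ← Finset.mul_sum]
            ring
          have h7 := hw.2
          rw [h6, mul_pow, ENNReal.ofReal_mul (by positivity)]
          simp [mul_assoc]
        · rw [Set.indicator_of_notMem hw]
          by_cases h4 : S • w ∈ orthant n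
          · have h5 : ¬ ∑ j, (S • w) j < S := fun h5 =>
              hw ((smul_mem_openSimplex_iff hS0 w).1 ⟨h4, h5⟩)
            rw [Set.indicator_of_notMem (a := S - _) (by
              rw [Set.mem_Ioi, sub_pos]; exact h5), zero_mul, mul_zero]
          · rw [Set.indicator_of_notMem h4, zero_mul]
      · rw [Set.indicator_of_notMem (by exact fun h => hS1 h.2)]
        simp [hΦ, hψ, hS1]
    · rw [Set.indicator_of_notMem (by exact fun h => hS0 h.1)]
      have hz : ∀ s, Φ s S = 0 := by
        intro s
        by_cases hs : s ∈ orthant n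
        · have h4 : S - ∑ j, s j ∉ Set.Ioi (0 : ℝ) := by
            have h5 : 0 ≤ ∑ j, s j := Finset.sum_nonneg fun j _ => (hs j).le
            simp only [Set.mem_Ioi]
            linarith
          simp only [hΦ]
          rw [Set.indicator_of_notMem h4, zero_mul, mul_zero]
        · simp only [hΦ]
          rw [Set.indicator_of_notMem hs, zero_mul]
      simp [hz]
  rw [h2, lintegral_lintegral_swap hΦm.aemeasurable]
  simp_rw [h3]
  rw [lintegral_indicator measurableSet_Ioo, lintegral_mul_const _ (by fun_prop)]

/-- Under Haar measure on the unitary group, the squared moduli of `n` entries of a row follow a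
Dirichlet law. A vector of the ball multiplied by an independent Haar distributed unitary matrix
has, on the one hand, the law of the vector itself and, on the other hand, up to its length, the
law of a row of the unitary matrix. -/
lemma haar_lastRowWeight (n ν : ℕ) (μ : Measure (Matrix.unitaryGroup (Fin (n + ν + 1)) ℂ))
    [IsProbabilityMeasure μ] [μ.IsMulLeftInvariant]
    (W : Matrix.unitaryGroup (Fin (n + ν + 1)) ℂ) : ∃ c : ENNReal,
    ∀ φ : (Fin n → ℝ) → ENNReal, Measurable φ →
      ∫⁻ V, φ (lastRowWeight n ν (V * W : Matrix.unitaryGroup (Fin (n + ν + 1)) ℂ)) ∂μ =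
        c * ∫⁻ w in openSimplex n, ENNReal.ofReal ((1 - ∑ j, w j) ^ ν) * φ w := by
  obtain ⟨c, hc⟩ := lintegral_ball_projWeight n ν
  set b := volume {g : Fin (n + ν + 1) → ℂ | normSqSum g < 1} with hb
  have hb0 : b ≠ 0 := volume_normSqSum_lt_one_ne_zero _
  have hbt : b ≠ ⊤ := volume_normSqSum_lt_one_ne_top _
  have hm : MeasurableSet {g : Fin (n + ν + 1) → ℂ | normSqSum g < 1} :=
    measurableSet_lt continuous_normSqSum.measurable measurable_const
  refine ⟨b⁻¹ * c, fun φ hφ => ?_⟩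
  set L := ∫⁻ V, φ (lastRowWeight n ν (V * W : Matrix.unitaryGroup (Fin (n + ν + 1)) ℂ)) ∂μ with hL
  have hjoint : Measurable (Function.uncurry
      fun (V : Matrix.unitaryGroup (Fin (n + ν + 1)) ℂ) (g : Fin (n + ν + 1) → ℂ) =>
        φ (projWeight n ν (Matrix.vecMul g ((V * W : Matrix.unitaryGroup _ ℂ) : Matrix _ _ ℂ)))) := by
    refine hφ.comp ((measurable_projWeight n ν).comp ?_)
    refine Continuous.measurable ?_
    simp only [Submonoid.coe_mul]
    fun_prop
  have h1 : ∀ V : Matrix.unitaryGroup (Fin (n + ν + 1)) ℂ,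
      ∫⁻ g in {g : Fin (n + ν + 1) → ℂ | normSqSum g < 1},
        φ (projWeight n ν (Matrix.vecMul g ((V * W : Matrix.unitaryGroup _ ℂ) : Matrix _ _ ℂ))) =
      ∫⁻ g in {g : Fin (n + ν + 1) → ℂ | normSqSum g < 1}, φ (projWeight n ν g) := by
    intro V
    have hpres := measurePreserving_vecMul (V * W).2
    have hpre : (fun g : Fin (n + ν + 1) → ℂ =>
        Matrix.vecMul g ((V * W : Matrix.unitaryGroup (Fin (n + ν + 1)) ℂ) :
          Matrix (Fin (n + ν + 1)) (Fin (n + ν + 1)) ℂ)) ⁻¹'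
          {g | normSqSum g < 1} = {g | normSqSum g < 1} := by
      ext g
      simp only [Set.mem_preimage, Set.mem_ofPred_eq]
      rw [normSqSum_vecMul (V * W).2]
    have := hpres.setLIntegral_comp_preimage hm (hφ.comp (measurable_projWeight n ν))
    rw [hpre] at this
    exact this
  have h2 : ∀ g : Fin (n + ν + 1) → ℂ, g ≠ 0 → ∫⁻ V, φ (projWeight n ν
      (Matrix.vecMul g ((V * W : Matrix.unitaryGroup _ ℂ) : Matrix _ _ ℂ))) ∂μ = L := by
    intro g hg
    have hpos : 0 < normSqSum g :=
      lt_of_lt_of_le (by have := norm_pos_iff.2 hg; positivity) (sq_norm_le_normSqSum g)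
    set t := Real.sqrt (normSqSum g) with ht
    have htpos : 0 < t := Real.sqrt_pos.2 hpos
    obtain ⟨R, hR, hRg⟩ := exists_unitary_row (Fin.last (n + ν)) (g := t⁻¹ • g) (by
      rw [normSqSum_smul, inv_pow, ht, Real.sq_sqrt hpos.le, inv_mul_cancel₀ hpos.ne'])
    rw [hL, ← lintegral_mul_left_eq_self
      (fun V : Matrix.unitaryGroup (Fin (n + ν + 1)) ℂ => φ (lastRowWeight n ν
        (V * W : Matrix.unitaryGroup (Fin (n + ν + 1)) ℂ))) ⟨R, hR⟩]
    refine lintegral_congr fun V => congrArg φ ?_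
    have hrow : ((⟨R, hR⟩ * V * W : Matrix.unitaryGroup (Fin (n + ν + 1)) ℂ) :
        Matrix (Fin (n + ν + 1)) (Fin (n + ν + 1)) ℂ) (Fin.last (n + ν)) =
        t⁻¹ • Matrix.vecMul g ((V * W : Matrix.unitaryGroup _ ℂ) : Matrix _ _ ℂ) := by
      rw [mul_assoc, Submonoid.coe_mul, ← Matrix.smul_vecMul, ← hRg]
      rfl
    ext j
    have hone := normSqSum_row (⟨R, hR⟩ * V * W : Matrix.unitaryGroup (Fin (n + ν + 1)) ℂ).2
      (Fin.last (n + ν))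
    rw [hrow] at hone
    rw [← projWeight_smul (inv_ne_zero htpos.ne'), ← hrow, projWeight, hrow, hone, div_one, ← hrow]
    rfl
  have h3 : L * b = c * ∫⁻ w in openSimplex n, ENNReal.ofReal ((1 - ∑ j, w j) ^ ν) * φ w := by
    rw [← hc φ hφ]
    calc L * b = ∫⁻ g in {g : Fin (n + ν + 1) → ℂ | normSqSum g < 1}, L := by
          rw [lintegral_const, Measure.restrict_apply_univ]
      _ = ∫⁻ g in {g : Fin (n + ν + 1) → ℂ | normSqSum g < 1}, ∫⁻ V, φ (projWeight n ν
            (Matrix.vecMul g ((V * W : Matrix.unitaryGroup _ ℂ) : Matrix _ _ ℂ))) ∂μ := by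
          refine lintegral_congr_ae (ae_restrict_of_ae ?_)
          have h0 : ∀ᵐ g : Fin (n + ν + 1) → ℂ, g ≠ 0 := by
            have := Measure.ae_ne (volume : Measure (Fin (n + ν + 1) → ℂ)) 0
            exact this
          filter_upwards [h0] with g hg
          exact (h2 g hg).symm
      _ = ∫⁻ V, (∫⁻ g in {g : Fin (n + ν + 1) → ℂ | normSqSum g < 1}, φ (projWeight n ν
            (Matrix.vecMul g ((V * W : Matrix.unitaryGroup _ ℂ) : Matrix _ _ ℂ)))) ∂μ :=
          (lintegral_lintegral_swap hjoint.aemeasurable).symm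
      _ = ∫⁻ g in {g : Fin (n + ν + 1) → ℂ | normSqSum g < 1}, φ (projWeight n ν g) := by
          simp_rw [h1]
          rw [lintegral_const, measure_univ, mul_one]
  rw [mul_assoc, ← h3, mul_comm L, ← mul_assoc, ENNReal.inv_mul_cancel hb0 hbt, one_mul]

/-! ### Spectra and the secular equation -/

section Spectrum

open Polynomial

variable {n ν : ℕ}

/-- The eigenvalues of `A`, with multiplicities, are `y_1, …, y_n` and `ν` times `0`. -/
def HasSpectrum (ν : ℕ) (A : Matrix (Fin (n + ν)) (Fin (n + ν)) ℂ) (y : Fin n → ℝ) : Prop :=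
  A.charpoly = X ^ ν * ∏ j, (X - C (y j : ℂ))

/-- The matrices with `n` distinct positive eigenvalues, whose increasing enumeration belongs to
`B`, and the `ν`-fold eigenvalue `0`. -/
def spectralSet (n ν : ℕ) (B : Set (Fin n → ℝ)) : Set (Matrix (Fin (n + ν)) (Fin (n + ν)) ℂ) :=
  {A | ∃ y ∈ B ∩ chamber n, HasSpectrum ν A y}

lemma eq_of_nodal_eq {y z : Fin n → ℝ} (hy : y ∈ chamber n) (hz : z ∈ chamber n)
    (h : ∏ j, (X - C (y j : ℂ)) = ∏ j, (X - C (z j : ℂ))) : y = z := by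
  have hroot : ∀ {y z : Fin n → ℝ}, ∏ j, (X - C (y j : ℂ)) = ∏ j, (X - C (z j : ℂ)) →
      Set.range y ⊆ Set.range z := by
    rintro y z h _ ⟨j, rfl⟩
    have h1 := congrArg (eval (y j : ℂ)) h
    rw [eval_prod, eval_prod, Finset.prod_eq_zero (Finset.mem_univ j) (by simp)] at h1
    obtain ⟨k, -, hk⟩ := Finset.prod_eq_zero_iff.1 h1.symm
    refine ⟨k, ?_⟩
    simp only [eval_sub, eval_X, eval_C, sub_eq_zero] at hk
    exact (Complex.ofReal_injective hk).symm
  exact (StrictMono.range_inj hy.1 hz.1).1 ((hroot h).antisymm (hroot h.symm))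

lemma HasSpectrum.unique {A : Matrix (Fin (n + ν)) (Fin (n + ν)) ℂ} {y z : Fin n → ℝ}
    (hy : y ∈ chamber n) (hz : z ∈ chamber n) (hAy : HasSpectrum ν A y)
    (hAz : HasSpectrum ν A z) : y = z :=
  eq_of_nodal_eq hy hz (mul_left_cancel₀ (pow_ne_zero ν X_ne_zero) (hAy.symm.trans hAz))

/-- The values of the polynomial `t ^ ν ∏ (t - y_j)` at the natural numbers. -/
noncomputable def nodalValues (n ν : ℕ) (y : Fin n → ℝ) (k : ℕ) : ℂ :=
  (k : ℂ) ^ ν * ∏ j, ((k : ℂ) - y j)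

/-- The values of the characteristic polynomial at the natural numbers. -/
noncomputable def charpolyValues {N : ℕ} (A : Matrix (Fin N) (Fin N) ℂ) (k : ℕ) : ℂ :=
  A.charpoly.eval (k : ℂ)

lemma measurable_nodalValues (n ν : ℕ) : Measurable (nodalValues n ν) :=
  measurable_pi_iff.2 fun k => by
    unfold nodalValues
    refine Continuous.measurable ?_
    fun_prop

lemma measurable_charpolyValues {N : ℕ} : Measurable (charpolyValues (N := N)) :=
  measurable_pi_iff.2 fun k => by
    unfold charpolyValues
    simp only [Matrix.eval_charpoly]
    refine Continuous.measurable ?_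
    fun_prop

lemma eq_of_eval_natCast {p q : ℂ[X]} (h : ∀ k : ℕ, p.eval (k : ℂ) = q.eval (k : ℂ)) : p = q := by
  refine eq_of_infinite_eval_eq p q ((Set.infinite_range_of_injective
    (f := fun k : ℕ => (k : ℂ)) Nat.cast_injective).mono ?_)
  rintro _ ⟨k, rfl⟩
  exact h k

lemma eval_nodal_mul (y : Fin n → ℝ) (k : ℕ) :
    (X ^ ν * ∏ j, (X - C (y j : ℂ))).eval (k : ℂ) = nodalValues n ν y k := by
  simp [nodalValues, eval_prod]

lemma hasSpectrum_iff {A : Matrix (Fin (n + ν)) (Fin (n + ν)) ℂ} {y : Fin n → ℝ} :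
    HasSpectrum ν A y ↔ nodalValues n ν y = charpolyValues A := by
  constructor
  · intro h
    ext k
    rw [charpolyValues, h, eval_nodal_mul]
  · intro h
    refine eq_of_eval_natCast fun k => ?_
    rw [eval_nodal_mul, h]
    rfl

lemma injOn_nodalValues (n ν : ℕ) : Set.InjOn (nodalValues n ν) (chamber n) := by
  intro y hy z hz h
  refine eq_of_nodal_eq hy hz (mul_left_cancel₀ (pow_ne_zero ν X_ne_zero)
    (eq_of_eval_natCast fun k => ?_))
  rw [eval_nodal_mul, eval_nodal_mul, h]

lemma measurableSet_spectralSet {B : Set (Fin n → ℝ)} (hB : MeasurableSet B) :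
    MeasurableSet (spectralSet n ν B) := by
  have h : spectralSet n ν B = charpolyValues ⁻¹' (nodalValues n ν '' (B ∩ chamber n)) := by
    ext A
    exact exists_congr fun y => and_congr_right fun _ => hasSpectrum_iff
  rw [h]
  exact measurable_charpolyValues ((hB.inter (measurableSet_chamber n)).image_of_measurable_injOn
    (measurable_nodalValues n ν) ((injOn_nodalValues n ν).mono Set.inter_subset_right))

/-- The increasing enumeration of the non-zero eigenvalues depends measurably on the matrix: by the
Lusin–Souslin theorem, the injective measurable map from the chamber to the values of the
characteristic polynomial has a measurable inverse. -/
lemma exists_measurable_spectrum (n ν : ℕ) :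
    ∃ E : Matrix (Fin (n + ν)) (Fin (n + ν)) ℂ → Fin n → ℝ, Measurable E ∧
      ∀ A, ∀ y ∈ chamber n, HasSpectrum ν A y → E A = y := by
  have hst : StandardBorelSpace (chamber n) := (measurableSet_chamber n).standardBorel
  have hemb : MeasurableEmbedding fun y : chamber n => nodalValues n ν y :=
    Measurable.measurableEmbedding ((measurable_nodalValues n ν).comp measurable_subtype_coe)
      fun y z h => Subtype.ext (injOn_nodalValues n ν y.2 z.2 h)
  obtain ⟨g, hg, hgy⟩ := hemb.exists_measurable_extend
    (g := fun y : chamber n => (y : Fin n → ℝ)) measurable_subtype_coe fun _ => inferInstance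
  refine ⟨fun A => g (charpolyValues A), hg.comp measurable_charpolyValues, fun A y hy hA => ?_⟩
  change g (charpolyValues A) = y
  rw [← hasSpectrum_iff.1 hA]
  exact congrFun hgy ⟨y, hy⟩

/-- The vector `(a_1, …, a_n, 0, …, 0)`. -/
noncomputable def paddedVector (k : ℕ) (a : Fin n → ℝ) : Fin (n + k) → ℂ :=
  Fin.append (fun j => (a j : ℂ)) fun _ => 0

lemma charpoly_diagonal_paddedVector (k : ℕ) (a : Fin n → ℝ) :
    (Matrix.diagonal (paddedVector k a)).charpoly = X ^ k * ∏ j, (X - C (a j : ℂ)) := by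
  rw [Matrix.charpoly_diagonal, Fin.prod_univ_add]
  simp [paddedVector, mul_comm]

/-- Hermitian matrices with the same eigenvalues are unitarily equivalent. -/
lemma exists_unitary_diagonalization {k : ℕ} {A : Matrix (Fin (n + k)) (Fin (n + k)) ℂ}
    (hA : A.IsHermitian) {a : Fin n → ℝ} (hsp : HasSpectrum k A a) :
    ∃ W : Matrix.unitaryGroup (Fin (n + k)) ℂ,
      A = (W : Matrix (Fin (n + k)) (Fin (n + k)) ℂ) * Matrix.diagonal (paddedVector k a) *
        star (W : Matrix (Fin (n + k)) (Fin (n + k)) ℂ) := by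
  have hD : (Matrix.diagonal (paddedVector k a)).IsHermitian := by
    rw [Matrix.isHermitian_diagonal_iff]
    intro i
    refine Fin.addCases (fun j => ?_) (fun j => ?_) i
    · rw [paddedVector, Fin.append_left, IsSelfAdjoint]
      exact Complex.conj_ofReal _
    · rw [paddedVector, Fin.append_right]
      exact IsSelfAdjoint.zero _
  have heig : hA.eigenvalues = hD.eigenvalues := by
    rw [Matrix.IsHermitian.eigenvalues_eq_eigenvalues_iff, hsp, charpoly_diagonal_paddedVector]
  have h1 := hA.spectral_theorem
  have h2 := hD.spectral_theorem
  rw [Unitary.conjStarAlgAut_apply] at h1 h2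
  rw [heig] at h1
  set Λ := Matrix.diagonal (RCLike.ofReal ∘ hD.eigenvalues : _ → ℂ)
  set P := hA.eigenvectorUnitary
  set Q := hD.eigenvectorUnitary
  refine ⟨P * star Q, ?_⟩
  rw [h2, h1]
  have hQ : star (Q : Matrix (Fin (n + k)) (Fin (n + k)) ℂ) * Q = 1 := Unitary.coe_star_mul_self Q
  simp only [Submonoid.coe_mul, Unitary.coe_star, star_mul, star_star]
  calc (P : Matrix (Fin (n + k)) (Fin (n + k)) ℂ) * Λ * star (P : Matrix (Fin (n + k)) (Fin (n + k)) ℂ)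
      = P * (star (Q : Matrix (Fin (n + k)) (Fin (n + k)) ℂ) * Q) * Λ *
        (star (Q : Matrix (Fin (n + k)) (Fin (n + k)) ℂ) * Q) * star (P : Matrix (Fin (n + k)) (Fin (n + k)) ℂ) := by
        rw [hQ, mul_one, mul_one]
    _ = _ := by simp only [mul_assoc]

lemma adjugate_unitary_conj {N : ℕ} {R : Matrix (Fin N) (Fin N) ℂ}
    (hR : R ∈ Matrix.unitaryGroup (Fin N) ℂ) (Z : Matrix (Fin N) (Fin N) ℂ) :
    (R * Z * star R).adjugate = R * Z.adjugate * star R := by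
  have h1 : R * star R = 1 := Matrix.mem_unitaryGroup_iff.1 hR
  have h2 : star R * R = 1 := Matrix.mem_unitaryGroup_iff'.1 hR
  have hdet : R.det * (star R).det = 1 := by rw [← Matrix.det_mul, h1, Matrix.det_one]
  have h3 : R.adjugate = R.det • star R := by
    calc R.adjugate = star R * R * R.adjugate := by rw [h2, one_mul]
      _ = _ := by rw [mul_assoc, Matrix.mul_adjugate, Matrix.mul_smul, mul_one]
  have h4 : (star R).adjugate = (star R).det • R := by
    calc (star R).adjugate = R * star R * (star R).adjugate := by rw [h1, one_mul]
      _ = _ := by rw [mul_assoc, Matrix.mul_adjugate, Matrix.mul_smul, mul_one]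
  rw [Matrix.adjugate_mul_distrib, Matrix.adjugate_mul_distrib, h3, h4]
  simp only [Matrix.smul_mul, Matrix.mul_smul, smul_smul, hdet, one_smul, mul_assoc]

/-- The characteristic polynomial of a principal submatrix of codimension one is an entry of the
adjugate of the characteristic matrix. -/
lemma eval_charpoly_submatrix_castSucc {N : ℕ} {R : Matrix (Fin (N + 1)) (Fin (N + 1)) ℂ}
    (hR : R ∈ Matrix.unitaryGroup (Fin (N + 1)) ℂ) (d : Fin (N + 1) → ℂ) (t : ℂ) :
    ((R * Matrix.diagonal d * star R).submatrix Fin.castSucc Fin.castSucc).charpoly.eval t =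
      ∑ i, (Complex.normSq (R (Fin.last N) i) : ℂ) * ∏ j ∈ Finset.univ.erase i, (t - d j) := by
  have h1 : R * star R = 1 := Matrix.mem_unitaryGroup_iff.1 hR
  have hs : Matrix.scalar (Fin (N + 1)) t - R * Matrix.diagonal d * star R =
      R * Matrix.diagonal (fun i => t - d i) * star R := by
    have : Matrix.diagonal (fun i => t - d i) = Matrix.scalar (Fin (N + 1)) t - Matrix.diagonal d := by
      rw [Matrix.scalar_apply, Matrix.diagonal_sub]
    rw [this, mul_sub, sub_mul, ← (Matrix.scalar_commute t (fun _ => mul_comm _ _) R).eq,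
      mul_assoc (Matrix.scalar _ t), h1, mul_one]
  have hsub : Matrix.scalar (Fin N) t -
      (R * Matrix.diagonal d * star R).submatrix Fin.castSucc Fin.castSucc =
      (Matrix.scalar (Fin (N + 1)) t - R * Matrix.diagonal d * star R).submatrix
        (Fin.last N).succAbove (Fin.last N).succAbove := by
    ext i j
    simp [Matrix.scalar_apply, Matrix.diagonal_apply]
  have hadj := Matrix.adjugate_fin_succ_eq_det_submatrix
    (Matrix.scalar (Fin (N + 1)) t - R * Matrix.diagonal d * star R) (Fin.last N) (Fin.last N)
  rw [Matrix.eval_charpoly, hsub]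
  have hsign : (-1 : ℂ) ^ ((Fin.last N : ℕ) + (Fin.last N : ℕ)) = 1 := by
    rw [← two_mul, pow_mul]
    simp
  rw [hsign, one_mul] at hadj
  rw [← hadj, hs, adjugate_unitary_conj hR, Matrix.adjugate_diagonal, Matrix.mul_apply]
  refine Finset.sum_congr rfl fun i _ => ?_
  rw [Matrix.mul_diagonal, Matrix.star_apply, Complex.normSq_eq_conj_mul_self, starRingEnd_apply]
  ring

/-- The secular equation: the non-zero eigenvalues of the truncation are the roots of the secular
polynomial whose weights are the squared moduli of the entries of the last row. -/
lemma charpoly_truncation {R : Matrix (Fin (n + ν + 1)) (Fin (n + ν + 1)) ℂ}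
    (hR : R ∈ Matrix.unitaryGroup (Fin (n + ν + 1)) ℂ) (a : Fin n → ℝ) :
    ((R * Matrix.diagonal (paddedVector (ν + 1) a : Fin (n + ν + 1) → ℂ) * star R).submatrix
      Fin.castSucc Fin.castSucc).charpoly =
      X ^ ν * (secularPoly a (lastRowWeight n ν R)).map Complex.ofRealHom := by
  set w := lastRowWeight n ν R with hw
  set d : Fin (n + ν + 1) → ℂ := paddedVector (ν + 1) a with hd
  have hinf : {t : ℂ | t ≠ 0 ∧ ∀ j, t ≠ a j}.Infinite := by
    have hfin : (({0} : Set ℂ) ∪ Set.range fun j => (a j : ℂ)).Finite :=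
      (Set.finite_singleton _).union (Set.finite_range _)
    refine hfin.infinite_compl.mono fun t ht => ?_
    simp only [Set.mem_compl_iff, Set.mem_union, Set.mem_singleton_iff, Set.mem_range,
      not_or, not_exists] at ht
    exact ⟨ht.1, fun j h => ht.2 j h.symm⟩
  refine eq_of_infinite_eval_eq _ _ (hinf.mono ?_)
  · rintro t ⟨ht0, hta⟩
    have hta' : ∀ j, t - a j ≠ 0 := fun j => sub_ne_zero.2 (hta j)
    have hdl : ∀ j : Fin n, d (Fin.castAdd (ν + 1) j : Fin (n + (ν + 1))) = a j := fun j => by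
      rw [hd, paddedVector, Fin.append_left]
    have hdr : ∀ j : Fin (ν + 1), d (Fin.natAdd n j) = 0 := fun j => by
      rw [hd, paddedVector, Fin.append_right]
    have hdne : ∀ i, t - d i ≠ 0 := fun i => by
      refine Fin.addCases (m := n) (n := ν + 1) (fun j => ?_) (fun j => ?_) i
      · rw [hdl]; exact hta' j
      · rw [hdr, sub_zero]; exact ht0
    have herase : ∀ i, ∏ j ∈ Finset.univ.erase i, (t - d j) = (∏ j, (t - d j)) / (t - d i) :=
      fun i => by
        rw [eq_div_iff (hdne i), mul_comm,
          Finset.mul_prod_erase _ (fun j => t - d j) (Finset.mem_univ i)]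
    have herase' : ∀ i, ∏ j ∈ Finset.univ.erase i, (t - (a j : ℂ)) =
        (∏ j, (t - (a j : ℂ))) / (t - a i) := fun i => by
        rw [eq_div_iff (hta' i), mul_comm,
          Finset.mul_prod_erase _ (fun j => t - (a j : ℂ)) (Finset.mem_univ i)]
    have hprod : ∏ j, (t - d j) = (∏ j, (t - (a j : ℂ))) * t ^ (ν + 1) := by
      have h := Fin.prod_univ_add (a := n) (b := ν + 1) fun j => t - d j
      refine h.trans ?_
      simp [hdl, hdr]
    have hone : ∑ j, (w j : ℂ) +
        ∑ j : Fin (ν + 1), (Complex.normSq (R (Fin.last (n + ν)) (Fin.natAdd n j)) : ℂ) = 1 := by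
      have h := normSqSum_fin_add (n := n) (ν := ν) (R (Fin.last (n + ν)))
      rw [normSqSum_row hR] at h
      have h2 := congrArg (fun x : ℝ => (x : ℂ)) h
      simp only [normSqSum] at h2
      push_cast at h2
      exact h2.symm
    rw [Set.mem_ofPred_eq, eval_charpoly_submatrix_castSucc hR]
    simp_rw [herase, hprod]
    have hsum := Fin.sum_univ_add (a := n) (b := ν + 1) fun i : Fin (n + (ν + 1)) =>
      (Complex.normSq (R (Fin.last (n + ν)) i) : ℂ) *
        ((∏ j, (t - (a j : ℂ))) * t ^ (ν + 1) / (t - d i))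
    refine hsum.trans ?_
    simp_rw [hdl, hdr, sub_zero]
    rw [← Finset.sum_mul, eq_sub_of_add_eq' hone]
    have hmap : ((secularPoly a w).map Complex.ofRealHom).eval t =
        ∏ j, (t - (a j : ℂ)) + ∑ i, (w i : ℂ) * a i * ((∏ j, (t - (a j : ℂ))) / (t - a i)) := by
      simp [secularPoly, Polynomial.map_add, Polynomial.map_sum, Polynomial.map_prod, eval_add,
        eval_finsetSum, eval_prod, herase']
    rw [eval_mul, eval_pow, eval_X, hmap]
    set q := ∏ j, (t - (a j : ℂ))
    have hterm : ∀ j, (w j : ℂ) * (q * t ^ (ν + 1) / (t - a j)) =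
        t ^ ν * (w j * a j * (q / (t - a j))) + t ^ ν * q * w j := by
      intro j
      have := hta' j
      field_simp
      ring
    change ∑ j, (w j : ℂ) * _ + _ = _
    simp_rw [hterm]
    have hdiv : q * t ^ (ν + 1) / t = q * t ^ ν := by
      rw [pow_succ, ← mul_assoc, mul_div_cancel_right₀ _ ht0]
    rw [Finset.sum_add_distrib, ← Finset.mul_sum, ← Finset.mul_sum, hdiv]
    ring

end Spectrum

/-! ### Truncation of a fixed matrix after a random rotation -/

/-- The mass of the density `(1 - ∑ w_i) ^ ν` on the simplex. -/
noncomputable def dirichletMass (n ν : ℕ) : ENNReal :=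
  ∫⁻ w in openSimplex n, ENNReal.ofReal ((1 - ∑ j, w j) ^ ν)

/-- Normalized Haar measure on the unitary group. -/
noncomputable def unitaryHaar (N : ℕ) : Measure (Matrix.unitaryGroup (Fin N) ℂ) :=
  Measure.haarMeasure ⊤

instance (N : ℕ) : IsProbabilityMeasure (unitaryHaar N) :=
  ⟨by simpa [unitaryHaar] using
    Measure.haarMeasure_self (K₀ := (⊤ : TopologicalSpace.PositiveCompacts
      (Matrix.unitaryGroup (Fin N) ℂ)))⟩

instance (N : ℕ) : (unitaryHaar N).IsMulLeftInvariant :=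
  inferInstanceAs (Measure.haarMeasure _).IsMulLeftInvariant

lemma dirichletMass_spec (n ν : ℕ) : dirichletMass n ν ≠ 0 ∧ dirichletMass n ν ≠ ⊤ ∧
    ∀ (W : Matrix.unitaryGroup (Fin (n + ν + 1)) ℂ) (φ : (Fin n → ℝ) → ENNReal), Measurable φ →
      ∫⁻ V, φ (lastRowWeight n ν (V * W : Matrix.unitaryGroup (Fin (n + ν + 1)) ℂ))
          ∂(unitaryHaar (n + ν + 1)) =
        (dirichletMass n ν)⁻¹ *
          ∫⁻ w in openSimplex n, ENNReal.ofReal ((1 - ∑ j, w j) ^ ν) * φ w := by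
  have hone : ∀ c : ENNReal, (∀ φ : (Fin n → ℝ) → ENNReal, Measurable φ →
      ∫⁻ V, φ (lastRowWeight n ν (V * 1 : Matrix.unitaryGroup (Fin (n + ν + 1)) ℂ))
          ∂(unitaryHaar (n + ν + 1)) =
        c * ∫⁻ w in openSimplex n, ENNReal.ofReal ((1 - ∑ j, w j) ^ ν) * φ w) →
      1 = c * dirichletMass n ν := by
    intro c hc
    have h := hc (fun _ => 1) measurable_const
    simpa [dirichletMass] using h
  obtain ⟨c, hc⟩ := haar_lastRowWeight n ν (unitaryHaar (n + ν + 1)) 1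
  have h1 := hone c hc
  have h0 : dirichletMass n ν ≠ 0 := fun h => by simp [h] at h1
  have ht : dirichletMass n ν ≠ ⊤ := fun h => by
    rw [h] at h1
    by_cases hc0 : c = 0
    · simp [hc0] at h1
    · simp [ENNReal.mul_top hc0] at h1
  refine ⟨h0, ht, fun W φ hφ => ?_⟩
  obtain ⟨c', hc'⟩ := haar_lastRowWeight n ν (unitaryHaar (n + ν + 1)) W
  have h2 : 1 = c' * dirichletMass n ν := by
    have h := hc' (fun _ => 1) measurable_const
    simpa [dirichletMass] using h
  rw [hc' φ hφ, ENNReal.eq_inv_of_mul_eq_one_left h2.symm]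

/-- Up to the factor `(dirichletMass n ν)⁻¹`, the density at `y` of the non-zero eigenvalues of a
corank one truncation, when those of the full matrix are `a_1, …, a_n`. -/
noncomputable def truncationDensity (n ν : ℕ) (a y : Fin n → ℝ) : ℝ :=
  (∏ j, y j) ^ ν * vandermondeProd y / ((∏ j, a j) ^ (ν + 1) * vandermondeProd a)

lemma setLIntegral_openSimplex_dirichlet {n : ℕ} (ν : ℕ) {a : Fin n → ℝ} (ha : a ∈ chamber n)
    (φ : (Fin n → ℝ) → ENNReal) :
    ∫⁻ w in openSimplex n, ENNReal.ofReal ((1 - ∑ j, w j) ^ ν) * φ w =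
      ∫⁻ y in interlaceRegion a,
        ENNReal.ofReal (truncationDensity n ν a y) * φ (secularWeight a y) := by
  rw [setLIntegral_openSimplex ha]
  refine setLIntegral_congr_fun (measurableSet_interlaceRegion a) fun y hy => ?_
  have hy' := interlaceRegion_subset_chamber a hy
  have h1 : 0 < ∏ j, a j := Finset.prod_pos fun j _ => ha.2 j
  have h2 := vandermondeProd_pos ha.1
  have h3 := vandermondeProd_pos hy'.1
  rw [← mul_assoc, ← ENNReal.ofReal_mul (by positivity), one_sub_sum_secularWeight ha]
  congr 2
  rw [truncationDensity, div_pow, pow_succ]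
  field_simp

lemma lintegral_truncationDensity {n : ℕ} (ν : ℕ) {a : Fin n → ℝ} (ha : a ∈ chamber n) :
    ∫⁻ y in interlaceRegion a, ENNReal.ofReal (truncationDensity n ν a y) =
      dirichletMass n ν := by
  have h := setLIntegral_openSimplex_dirichlet ν ha (fun _ => 1)
  simpa [dirichletMass] using h.symm

/-- Removal of the last row and column. -/
def truncate {N : ℕ} (A : Matrix (Fin (N + 1)) (Fin (N + 1)) ℂ) : Matrix (Fin N) (Fin N) ℂ :=
  A.submatrix Fin.castSucc Fin.castSucc

lemma continuous_truncate {N : ℕ} : Continuous (truncate (N := N)) :=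
  Continuous.matrix_submatrix continuous_id _ _

lemma measurable_truncate {N : ℕ} : Measurable (truncate (N := N)) :=
  continuous_truncate.measurable

/-- Conjugation by a unitary matrix. -/
def conjUnitary {N : ℕ} (V : Matrix.unitaryGroup (Fin N) ℂ) (A : Matrix (Fin N) (Fin N) ℂ) :
    Matrix (Fin N) (Fin N) ℂ :=
  (V : Matrix (Fin N) (Fin N) ℂ) * A * star (V : Matrix (Fin N) (Fin N) ℂ)

lemma continuous_uncurry_conjUnitary {N : ℕ} :
    Continuous fun p : Matrix.unitaryGroup (Fin N) ℂ × Matrix (Fin N) (Fin N) ℂ =>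
      conjUnitary p.1 p.2 := by
  unfold conjUnitary
  fun_prop

lemma continuous_conjUnitary {N : ℕ} (V : Matrix.unitaryGroup (Fin N) ℂ) :
    Continuous (conjUnitary V) := by
  unfold conjUnitary
  fun_prop

lemma conjUnitary_mul {N : ℕ} (V W : Matrix.unitaryGroup (Fin N) ℂ)
    (A : Matrix (Fin N) (Fin N) ℂ) : conjUnitary (V * W) A = conjUnitary V (conjUnitary W A) := by
  simp only [conjUnitary, Submonoid.coe_mul, star_mul, mul_assoc]

/-- The law of the non-zero eigenvalues of a corank one truncation of a randomly rotated matrix. -/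
lemma haar_truncate_mem_spectralSet {n ν : ℕ}
    {A : Matrix (Fin (n + ν + 1)) (Fin (n + ν + 1)) ℂ} (hA : A.IsHermitian) {a : Fin n → ℝ}
    (ha : a ∈ chamber n) (hsp : HasSpectrum (n := n) (ν + 1) A a) {B : Set (Fin n → ℝ)}
    (hB : MeasurableSet B) :
    unitaryHaar (n + ν + 1) {V | truncate (conjUnitary V A) ∈ spectralSet n ν B} =
      (dirichletMass n ν)⁻¹ *
        ∫⁻ y in B ∩ interlaceRegion a, ENNReal.ofReal (truncationDensity n ν a y) := by
  obtain ⟨-, -, hHaar⟩ := dirichletMass_spec n ν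
  obtain ⟨W, hW⟩ := exists_unitary_diagonalization (n := n) (k := ν + 1) hA hsp
  set T := secularWeight a '' (B ∩ interlaceRegion a) with hT
  have hTm : MeasurableSet T := by
    refine (hB.inter (measurableSet_interlaceRegion a)).image_of_continuousOn_injOn
      (fun y _ => ?_) ((injOn_secularWeight ha).mono Set.inter_subset_right)
    exact (hasFDerivAt_secularWeight a y).continuousAt.continuousWithinAt
  set w : Matrix.unitaryGroup (Fin (n + ν + 1)) ℂ → Fin n → ℝ := fun V =>
    lastRowWeight n ν (V * W : Matrix.unitaryGroup (Fin (n + ν + 1)) ℂ) with hw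
  have hwm : Measurable w := by
    refine measurable_pi_iff.2 fun j => ?_
    refine Continuous.measurable ?_
    simp only [hw, lastRowWeight, Submonoid.coe_mul]
    refine Complex.continuous_normSq.comp ?_
    fun_prop
  have hae : ∀ᵐ V ∂(unitaryHaar (n + ν + 1)), w V ∈ openSimplex n := by
    have h := hHaar W ((openSimplex n)ᶜ.indicator 1)
      (measurable_one.indicator (measurableSet_openSimplex n).compl)
    have hz : ∫⁻ w in openSimplex n, ENNReal.ofReal ((1 - ∑ j, w j) ^ ν) *
        (openSimplex n)ᶜ.indicator 1 w = 0 := by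
      rw [setLIntegral_congr_fun (g := fun _ => 0) (measurableSet_openSimplex n) fun w hw => by
        simp [hw]]
      simp
    rw [hz, mul_zero] at h
    have hi : ∀ V : Matrix.unitaryGroup (Fin (n + ν + 1)) ℂ,
        (openSimplex n)ᶜ.indicator (1 : (Fin n → ℝ) → ENNReal) (w V) =
          (w ⁻¹' (openSimplex n)ᶜ).indicator 1 V := fun V => rfl
    change ∫⁻ V, (openSimplex n)ᶜ.indicator 1 (w V) ∂_ = 0 at h
    simp_rw [hi] at h
    rw [lintegral_indicator_one (hwm (measurableSet_openSimplex n).compl)] at h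
    exact h
  have hchar : ∀ V : Matrix.unitaryGroup (Fin (n + ν + 1)) ℂ,
      (truncate (conjUnitary V A)).charpoly =
        Polynomial.X ^ ν * (secularPoly a (w V)).map Complex.ofRealHom := by
    intro V
    have hconj : conjUnitary V A = ((V * W : Matrix.unitaryGroup (Fin (n + ν + 1)) ℂ) :
        Matrix (Fin (n + ν + 1)) (Fin (n + ν + 1)) ℂ) *
          Matrix.diagonal (paddedVector (ν + 1) a : Fin (n + ν + 1) → ℂ) *
          star ((V * W : Matrix.unitaryGroup (Fin (n + ν + 1)) ℂ) :
            Matrix (Fin (n + ν + 1)) (Fin (n + ν + 1)) ℂ) := by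
      rw [conjUnitary, hW]
      simp only [Submonoid.coe_mul, star_mul, mul_assoc]
    rw [hconj, truncate]
    exact charpoly_truncation (V * W).2 a
  have hmap : ∀ y : Fin n → ℝ, (∏ k, (Polynomial.X - Polynomial.C (y k))).map Complex.ofRealHom =
      ∏ k, (Polynomial.X - Polynomial.C (y k : ℂ)) := fun y => by
    simp [Polynomial.map_prod]
  have hiff : ∀ V : Matrix.unitaryGroup (Fin (n + ν + 1)) ℂ, w V ∈ openSimplex n →
      (truncate (conjUnitary V A) ∈ spectralSet n ν B ↔ w V ∈ T) := by
    intro V hV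
    obtain ⟨z, hz, hzw⟩ := exists_secularWeight_eq ha hV
    have hsz : HasSpectrum ν (truncate (conjUnitary V A)) z := by
      rw [HasSpectrum, hchar, ← hzw, secularPoly_secularWeight ha, hmap]
    constructor
    · rintro ⟨y, hy, hys⟩
      obtain rfl := HasSpectrum.unique hy.2 (interlaceRegion_subset_chamber a hz) hys hsz
      exact ⟨y, ⟨hy.1, hz⟩, hzw⟩
    · rintro ⟨y, hy, hyw⟩
      obtain rfl := injOn_secularWeight ha hy.2 hz (hyw.trans hzw.symm)
      exact ⟨y, ⟨hy.1, interlaceRegion_subset_chamber a hz⟩, hsz⟩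
  have h1 : unitaryHaar (n + ν + 1) {V | truncate (conjUnitary V A) ∈ spectralSet n ν B} =
      unitaryHaar (n + ν + 1) (w ⁻¹' T) := by
    refine measure_congr ?_
    filter_upwards [hae] with V hV
    exact propext (hiff V hV)
  have h2 := hHaar W (T.indicator 1) (measurable_one.indicator hTm)
  have h3 : ∫⁻ V, T.indicator 1 (lastRowWeight n ν
      (V * W : Matrix.unitaryGroup (Fin (n + ν + 1)) ℂ)) ∂(unitaryHaar (n + ν + 1)) =
        unitaryHaar (n + ν + 1) (w ⁻¹' T) := by
    rw [← lintegral_indicator_one (hwm hTm)]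
    rfl
  rw [h1, ← h3, h2, setLIntegral_openSimplex_dirichlet ν ha,
    ← setLIntegral_indicator hB]
  congr 1
  refine setLIntegral_congr_fun (measurableSet_interlaceRegion a) fun y hy => ?_
  by_cases hyB : y ∈ B
  · have hyT : secularWeight a y ∈ T := ⟨y, ⟨hyB, hy⟩, rfl⟩
    simp [hyB, hyT]
  · have hyT : secularWeight a y ∉ T := by
      rintro ⟨z, hz, hzy⟩
      exact hyB ((injOn_secularWeight ha hz.2 hy hzy) ▸ hz.1)
    simp [hyB, hyT]

/-- The unitary matrix acting as `V` on the first `N` coordinates. -/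
noncomputable def extendUnitary {N : ℕ} (V : Matrix.unitaryGroup (Fin N) ℂ) :
    Matrix.unitaryGroup (Fin (N + 1)) ℂ :=
  ⟨(Matrix.fromBlocks (V : Matrix (Fin N) (Fin N) ℂ) 0 0 (1 : Matrix (Fin 1) (Fin 1) ℂ)).submatrix
    finSumFinEquiv.symm finSumFinEquiv.symm, by
    have hV : (V : Matrix (Fin N) (Fin N) ℂ) * (V : Matrix (Fin N) (Fin N) ℂ).conjTranspose = 1 :=
      Matrix.mem_unitaryGroup_iff.1 V.2
    rw [Matrix.mem_unitaryGroup_iff, Matrix.star_eq_conjTranspose, Matrix.conjTranspose_submatrix,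
      Matrix.submatrix_mul_equiv, Matrix.fromBlocks_conjTranspose, Matrix.fromBlocks_multiply]
    simp [hV]⟩

lemma extendUnitary_castSucc_castSucc {N : ℕ} (V : Matrix.unitaryGroup (Fin N) ℂ) (i j : Fin N) :
    (extendUnitary V : Matrix (Fin (N + 1)) (Fin (N + 1)) ℂ) i.castSucc j.castSucc =
      (V : Matrix (Fin N) (Fin N) ℂ) i j := by
  have h : ∀ i : Fin N, finSumFinEquiv.symm i.castSucc = (Sum.inl i : Fin N ⊕ Fin 1) := fun i =>
    finSumFinEquiv_symm_apply_castAdd i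
  simp [extendUnitary, h]

lemma extendUnitary_castSucc_last {N : ℕ} (V : Matrix.unitaryGroup (Fin N) ℂ) (i : Fin N) :
    (extendUnitary V : Matrix (Fin (N + 1)) (Fin (N + 1)) ℂ) i.castSucc (Fin.last N) = 0 := by
  have h : ∀ i : Fin N, finSumFinEquiv.symm i.castSucc = (Sum.inl i : Fin N ⊕ Fin 1) := fun i =>
    finSumFinEquiv_symm_apply_castAdd i
  have h' : finSumFinEquiv.symm (Fin.last N) = (Sum.inr 0 : Fin N ⊕ Fin 1) :=
    finSumFinEquiv_symm_apply_natAdd (0 : Fin 1)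
  simp [extendUnitary, h, h']

lemma truncate_conjUnitary_extendUnitary {N : ℕ} (V : Matrix.unitaryGroup (Fin N) ℂ)
    (A : Matrix (Fin (N + 1)) (Fin (N + 1)) ℂ) :
    truncate (conjUnitary (extendUnitary V) A) = conjUnitary V (truncate A) := by
  ext i j
  simp only [truncate, conjUnitary, Matrix.submatrix_apply, Matrix.mul_apply, Matrix.star_apply,
    Fin.sum_univ_castSucc, extendUnitary_castSucc_castSucc, extendUnitary_castSucc_last]
  simp

/-! ### The transform of a polynomial ensemble under a corank one truncation -/

/-- The kernel `y ^ ν / t ^ (ν + 1)` on `y < t`. -/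
noncomputable def truncKernel (ν : ℕ) (y t : ℝ) : ℝ := if y < t then y ^ ν * (t ^ (ν + 1))⁻¹ else 0

/-- The effect of a corank one truncation on the functions of a polynomial ensemble. -/
noncomputable def truncTransform {n : ℕ} (ν : ℕ) (h : Fin n → ℝ → ℝ) (k : Fin n) (y : ℝ) : ℝ :=
  ∫ t in Set.Ioi 0, h k t * truncKernel ν y t

lemma measurable_uncurry_truncKernel (ν : ℕ) : Measurable (Function.uncurry (truncKernel ν)) := by
  unfold truncKernel Function.uncurry
  refine Measurable.ite (measurableSet_lt measurable_fst measurable_snd) ?_ measurable_const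
  fun_prop

lemma truncKernel_nonneg (ν : ℕ) {y t : ℝ} (hy : 0 < y) : 0 ≤ truncKernel ν y t := by
  rw [truncKernel]
  split_ifs with h
  · have := hy.trans h
    positivity
  · exact le_rfl

lemma norm_truncKernel_le (ν : ℕ) {y : ℝ} (hy : 0 < y) (t : ℝ) :
    ‖truncKernel ν y t‖ ≤ y ^ ν * (y ^ (ν + 1))⁻¹ := by
  rw [Real.norm_of_nonneg (truncKernel_nonneg ν hy), truncKernel]
  split_ifs with h
  · gcongr
  · positivity

lemma integrable_mul_truncKernel (ν : ℕ) {h : ℝ → ℝ} (hh : IntegrableOn h (Set.Ioi 0)) {y : ℝ}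
    (hy : 0 < y) : IntegrableOn (fun t => h t * truncKernel ν y t) (Set.Ioi 0) :=
  Integrable.mul_bdd (c := y ^ ν * (y ^ (ν + 1))⁻¹) hh
    ((measurable_uncurry_truncKernel ν).comp measurable_prodMk_left).aestronglyMeasurable
    (Filter.Eventually.of_forall fun t => norm_truncKernel_le ν hy t)

lemma integrableOn_truncTransform {n : ℕ} (ν j : ℕ) {h : Fin n → ℝ → ℝ} {k : Fin n}
    (hh : IntegrableOn (h k) (Set.Ioi 0))
    (hj : IntegrableOn (fun t => t ^ j * h k t) (Set.Ioi 0)) :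
    IntegrableOn (fun y => y ^ j * truncTransform ν h k y) (Set.Ioi 0) := by
  set μ := volume.restrict (Set.Ioi (0 : ℝ)) with hμ
  have hslice : ∀ t : ℝ, (fun y => y ^ j * (h k t * truncKernel ν y t)) =
      (Set.Iio t).indicator fun y => h k t * (t ^ (ν + 1))⁻¹ * y ^ (j + ν) := by
    intro t
    ext y
    by_cases hyt : y < t
    · rw [Set.indicator_of_mem (by exact hyt), truncKernel, if_pos hyt, pow_add]
      ring
    · rw [Set.indicator_of_notMem (by exact hyt), truncKernel, if_neg hyt, mul_zero, mul_zero]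
  have hIoo : ∀ t : ℝ, Set.Iio t ∩ Set.Ioi 0 = Set.Ioo 0 t := fun t => by
    rw [Set.inter_comm, Set.Ioi_inter_Iio]
  have hF : Integrable (fun p : ℝ × ℝ => p.1 ^ j * (h k p.2 * truncKernel ν p.1 p.2))
      (μ.prod μ) := by
    have hmeas : AEStronglyMeasurable
        (fun p : ℝ × ℝ => p.1 ^ j * (h k p.2 * truncKernel ν p.1 p.2)) (μ.prod μ) := by
      refine AEStronglyMeasurable.mul (by fun_prop) (AEStronglyMeasurable.mul ?_ ?_)
      · exact hh.aestronglyMeasurable.comp_snd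
      · exact (measurable_uncurry_truncKernel ν).aestronglyMeasurable
    rw [integrable_prod_iff' hmeas]
    constructor
    · refine Filter.Eventually.of_forall fun t => ?_
      rw [hslice, hμ, integrable_indicator_iff measurableSet_Iio, IntegrableOn,
        Measure.restrict_restrict measurableSet_Iio, hIoo]
      exact ((continuous_const.mul (continuous_pow _)).integrableOn_Icc (a := 0) (b := t)).mono_set
        Set.Ioo_subset_Icc_self
    · have hnorm : ∀ t ∈ Set.Ioi (0 : ℝ),
          ∫ y, ‖y ^ j * (h k t * truncKernel ν y t)‖ ∂μ = ‖t ^ j * h k t‖ * (1 / (j + ν + 1)) := by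
        intro t ht
        have ht0 : (0 : ℝ) < t := ht
        have h1 : ∀ y, ‖y ^ j * (h k t * truncKernel ν y t)‖ =
            (Set.Iio t).indicator (fun y => |h k t| * (t ^ (ν + 1))⁻¹ * |y ^ (j + ν)|) y := by
          intro y
          rw [congrFun (hslice t) y, norm_indicator_eq_indicator_norm]
          congr 1
          ext y
          rw [Real.norm_eq_abs, abs_mul, abs_mul, abs_of_pos (a := (t ^ (ν + 1))⁻¹) (by positivity)]
        have h2 : ∫ y in Set.Ioo 0 t, |y ^ (j + ν)| = t ^ (j + ν + 1) / (j + ν + 1) := by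
          rw [setIntegral_congr_fun (g := fun y => y ^ (j + ν)) measurableSet_Ioo
            fun y hy => abs_of_nonneg (pow_nonneg hy.1.le _), ← integral_Ioc_eq_integral_Ioo,
            ← intervalIntegral.integral_of_le ht0.le, integral_pow]
          simp
        simp_rw [h1]
        rw [integral_indicator measurableSet_Iio, hμ, Measure.restrict_restrict measurableSet_Iio,
          hIoo, integral_const_mul, h2, norm_mul, Real.norm_eq_abs, Real.norm_eq_abs,
          abs_of_pos (pow_pos ht0 j)]
        have h3 : (j : ℝ) + ν + 1 ≠ 0 := by positivity
        rw [show t ^ (j + ν + 1) = t ^ j * t ^ (ν + 1) by ring]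
        field_simp
      refine (hj.norm.mul_const (1 / ((j : ℝ) + ν + 1))).congr ?_
      filter_upwards [ae_restrict_mem measurableSet_Ioi] with t ht
      exact (hnorm t ht).symm
  refine hF.integral_prod_left.congr (Filter.Eventually.of_forall fun y => ?_)
  simp only [truncTransform, integral_const_mul]
  rfl

section Symmetry

variable {n : ℕ}

lemma det_of_comp_perm (f : Fin n → ℝ → ℝ) (x : Fin n → ℝ) (σ : Equiv.Perm (Fin n)) :
    (Matrix.of fun j k : Fin n => f k ((x ∘ σ) j)).det =
      ((Equiv.Perm.sign σ : ℤ) : ℝ) * (Matrix.of fun j k : Fin n => f k (x j)).det :=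
  Matrix.det_permute σ (Matrix.of fun j k : Fin n => f k (x j))

lemma vandermondeProd_comp_perm (x : Fin n → ℝ) (σ : Equiv.Perm (Fin n)) :
    vandermondeProd (x ∘ σ) = ((Equiv.Perm.sign σ : ℤ) : ℝ) * vandermondeProd x := by
  rw [vandermondeProd_eq_det, vandermondeProd_eq_det]
  exact Matrix.det_permute σ (Matrix.vandermonde x)

lemma sign_mul_mul_sign_mul (σ : Equiv.Perm (Fin n)) (u v : ℝ) :
    ((Equiv.Perm.sign σ : ℤ) : ℝ) * u * (((Equiv.Perm.sign σ : ℤ) : ℝ) * v) = u * v := by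
  rcases Int.units_eq_one_or (Equiv.Perm.sign σ) with h | h <;> simp [h]

lemma polyEnsembleFun_comp_perm (f : Fin n → ℝ → ℝ) (Z : ℝ) (x : Fin n → ℝ)
    (σ : Equiv.Perm (Fin n)) : polyEnsembleFun f Z (x ∘ σ) = polyEnsembleFun f Z x := by
  rw [polyEnsembleFun, vandermondeProd_comp_perm, det_of_comp_perm, sign_mul_mul_sign_mul,
    polyEnsembleFun]

lemma det_of_eq_zero_of_not_injective (f : Fin n → ℝ → ℝ) {x : Fin n → ℝ}
    (hx : ¬ Function.Injective x) : (Matrix.of fun j k : Fin n => f k (x j)).det = 0 := by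
  obtain ⟨i, j, hij, hne⟩ : ∃ i j, x i = x j ∧ i ≠ j := by
    simpa [Function.Injective] using hx
  refine Matrix.det_zero_of_row_eq hne ?_
  ext k
  simp [hij]

lemma polyEnsembleFun_eq_zero_of_not_injective (f : Fin n → ℝ → ℝ) (Z : ℝ) {x : Fin n → ℝ}
    (hx : ¬ Function.Injective x) : polyEnsembleFun f Z x = 0 := by
  rw [polyEnsembleFun, det_of_eq_zero_of_not_injective f hx, mul_zero, mul_zero]

/-- Rescaling the functions, off the half-line arbitrarily, amounts to rescaling the constant. -/
lemma polyEnsembleFun_smul {f g : Fin n → ℝ → ℝ} {c : ℝ}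
    (hfg : ∀ k, ∀ t, 0 < t → f k t = c * g k t) (Z : ℝ) {x : Fin n → ℝ} (hx : x ∈ orthant n) :
    polyEnsembleFun f Z x = c ^ n * polyEnsembleFun g Z x := by
  have h : (Matrix.of fun j k : Fin n => f k (x j)) = c • Matrix.of fun j k : Fin n => g k (x j) := by
    ext j k
    simp [hfg k (x j) (hx j)]
  rw [polyEnsembleFun, polyEnsembleFun, h, Matrix.det_smul, Fintype.card_fin]
  ring

lemma polyEnsembleFun_mul_const (f : Fin n → ℝ → ℝ) (Z c : ℝ) (x : Fin n → ℝ) :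
    polyEnsembleFun f (Z * c⁻¹) x = c * polyEnsembleFun f Z x := by
  rw [polyEnsembleFun, polyEnsembleFun, mul_inv, inv_inv]
  ring

lemma mem_interlaceRegion_iff {a y : Fin n → ℝ} (hy : ∀ j, 0 < y j) (hne : ∀ i j, a i ≠ y j) :
    y ∈ interlaceRegion a ↔ Interlaces a y := by
  constructor
  · intro h i j
    refine ⟨fun hlt => ?_, (h.2 i j).1⟩
    by_contra hij
    exact lt_asymm hlt ((h.2 i j).2 (not_le.1 hij))
  · intro h
    refine ⟨hy, fun i j => ⟨(h i j).2, fun hij => ?_⟩⟩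
    have h1 : ¬ y j < a i := fun h1 => not_le.2 hij ((h i j).1 h1)
    exact lt_of_le_of_ne (not_lt.1 h1) (hne i j)

open Classical in
lemma det_truncKernel (ν : ℕ) {a y : Fin n → ℝ} (ha : a ∈ chamber n) (hy : y ∈ chamber n) :
    (Matrix.of fun i j => truncKernel ν (y j) (a i)).det =
      (∏ j, y j) ^ ν * ((∏ i, a i) ^ (ν + 1))⁻¹ * if Interlaces a y then 1 else 0 := by
  have h : (Matrix.of fun i j => truncKernel ν (y j) (a i)) = Matrix.of fun i j =>
      (fun i => (a i ^ (ν + 1))⁻¹) i * (Matrix.of fun i j => (fun j => y j ^ ν) j *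
        (Matrix.of fun i j => if y j < a i then (1 : ℝ) else 0) i j) i j := by
    ext i j
    simp only [Matrix.of_apply, truncKernel]
    split_ifs <;> ring
  rw [h, Matrix.det_mul_column, Matrix.det_mul_row, det_indicator_lt ha.1 hy.1,
    Finset.prod_inv_distrib, Finset.prod_pow, Finset.prod_pow]
  ring

lemma det_truncKernel_nonneg (ν : ℕ) {a y : Fin n → ℝ} (ha : a ∈ chamber n) (hy : y ∈ chamber n) :
    0 ≤ (Matrix.of fun i j => truncKernel ν (y j) (a i)).det := by
  rw [det_truncKernel ν ha hy]
  have h1 : 0 < ∏ j, y j := Finset.prod_pos fun j _ => hy.2 j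
  have h2 : 0 < ∏ j, a j := Finset.prod_pos fun j _ => ha.2 j
  split_ifs <;> positivity

end Symmetry

section Transform

variable {n : ℕ} {h : Fin n → ℝ → ℝ} {Z : ℝ}

lemma det_mul_det_truncKernel_nonneg (hnn : ∀ x ∈ orthant n, 0 ≤ polyEnsembleFun h Z x) (ν : ℕ)
    {y : Fin n → ℝ} (hy : y ∈ chamber n) {a : Fin n → ℝ} (ha : a ∈ orthant n) :
    0 ≤ Z⁻¹ * ((Matrix.of fun i k => h k (a i)).det *
      (Matrix.of fun i j => truncKernel ν (y j) (a i)).det) := by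
  have hsorted : ∀ a ∈ chamber n, 0 ≤ Z⁻¹ * ((Matrix.of fun i k => h k (a i)).det *
      (Matrix.of fun i j => truncKernel ν (y j) (a i)).det) := by
    intro a ha
    have h1 := hnn a (chamber_subset_orthant n ha)
    rw [polyEnsembleFun, mul_left_comm] at h1
    have h2 := nonneg_of_mul_nonneg_right h1 (vandermondeProd_pos ha.1)
    rw [← mul_assoc]
    exact mul_nonneg h2 (det_truncKernel_nonneg ν ha hy)
  by_cases hinj : Function.Injective a
  · have h1 := hsorted _ (comp_sort_mem_chamber hinj ha)
    rwa [det_of_comp_perm, det_of_comp_perm (fun j t => truncKernel ν (y j) t),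
      sign_mul_mul_sign_mul] at h1
  · rw [det_of_eq_zero_of_not_injective h hinj]
    simp

lemma volume_restrict_orthant :
    (volume : Measure (Fin n → ℝ)).restrict (orthant n) =
      Measure.pi fun _ => volume.restrict (Set.Ioi (0 : ℝ)) := by
  rw [orthant_eq_pi, volume_pi, Measure.restrict_pi_pi]

/-- Andréief's identity for the kernel of a corank one truncation. -/
lemma setLIntegral_det_truncKernel (hint : ∀ k, IntegrableOn (h k) (Set.Ioi 0))
    (hnn : ∀ x ∈ orthant n, 0 ≤ polyEnsembleFun h Z x) (ν : ℕ)
    {y : Fin n → ℝ} (hy : y ∈ chamber n) :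
    0 ≤ polyEnsembleFun (truncTransform ν h) Z y ∧
    ∫⁻ a in chamber n, ENNReal.ofReal (Z⁻¹ * vandermondeProd y *
        ((Matrix.of fun i k => h k (a i)).det *
          (Matrix.of fun i j => truncKernel ν (y j) (a i)).det)) =
      ENNReal.ofReal (polyEnsembleFun (truncTransform ν h) Z y) := by
  set G : (Fin n → ℝ) → ℝ := fun a => (Matrix.of fun i k => h k (a i)).det *
    (Matrix.of fun i j => truncKernel ν (y j) (a i)).det with hG
  have hV := vandermondeProd_pos hy.1
  obtain ⟨hGi, hGe⟩ := andreief (volume.restrict (Set.Ioi (0 : ℝ))) h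
    (fun j t => truncKernel ν (y j) t) fun k j => integrable_mul_truncKernel ν (hint k) (hy.2 j)
  rw [← volume_restrict_orthant] at hGi hGe
  have hpos : ∀ a ∈ orthant n, 0 ≤ Z⁻¹ * vandermondeProd y * G a := by
    intro a ha
    have := mul_nonneg hV.le (det_mul_det_truncKernel_nonneg hnn ν hy ha)
    calc (0 : ℝ) ≤ _ := this
      _ = _ := by simp only [hG]; ring
  have hval : ∫ a in orthant n, Z⁻¹ * vandermondeProd y * G a =
      n.factorial * polyEnsembleFun (truncTransform ν h) Z y := by
    rw [integral_const_mul, hGe, polyEnsembleFun]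
    simp only [truncTransform]
    ring
  have hfac : (0 : ℝ) < n.factorial := by exact_mod_cast n.factorial_pos
  have h1 : ∫⁻ a in orthant n, ENNReal.ofReal (Z⁻¹ * vandermondeProd y * G a) =
      ENNReal.ofReal (n.factorial * polyEnsembleFun (truncTransform ν h) Z y) := by
    rw [← hval, ofReal_integral_eq_lintegral_ofReal (hGi.const_mul _)]
    filter_upwards [ae_restrict_mem (measurableSet_orthant n)] with a ha using hpos a ha
  have h2 := setLIntegral_orthant_eq
    (fun a => ENNReal.ofReal (Z⁻¹ * vandermondeProd y * G a))
    (fun σ a => by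
      simp only [hG]
      rw [det_of_comp_perm, det_of_comp_perm (fun j t => truncKernel ν (y j) t),
        sign_mul_mul_sign_mul])
    (fun a ha => by
      simp only [hG]
      rw [det_of_eq_zero_of_not_injective h ha]
      simp)
  have hnonneg : 0 ≤ n.factorial * polyEnsembleFun (truncTransform ν h) Z y := by
    rw [← hval]
    exact setIntegral_nonneg (measurableSet_orthant n) hpos
  refine ⟨nonneg_of_mul_nonneg_right hnonneg hfac, ?_⟩
  rw [h1, ENNReal.ofReal_mul hfac.le, ENNReal.ofReal_natCast] at h2
  exact ((ENNReal.mul_right_inj (by exact_mod_cast n.factorial_ne_zero)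
    (ENNReal.natCast_ne_top _)).1 h2).symm

lemma polyEnsembleFun_truncTransform_nonneg (hint : ∀ k, IntegrableOn (h k) (Set.Ioi 0))
    (hnn : ∀ x ∈ orthant n, 0 ≤ polyEnsembleFun h Z x) (ν : ℕ)
    {y : Fin n → ℝ} (hy : y ∈ orthant n) : 0 ≤ polyEnsembleFun (truncTransform ν h) Z y := by
  by_cases hinj : Function.Injective y
  · rw [← polyEnsembleFun_comp_perm _ _ y (Tuple.sort y)]
    exact (setLIntegral_det_truncKernel hint hnn ν (comp_sort_mem_chamber hinj hy)).1
  · rw [polyEnsembleFun_eq_zero_of_not_injective _ _ hinj]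

lemma aemeasurable_polyEnsembleFun (hint : ∀ k, IntegrableOn (h k) (Set.Ioi 0)) :
    AEMeasurable (polyEnsembleFun h Z) (volume.restrict (orthant n)) := by
  have hent : ∀ j k : Fin n, AEMeasurable (fun x : Fin n → ℝ => h k (x j))
      (volume.restrict (orthant n)) := by
    intro j k
    rw [volume_restrict_orthant]
    exact (hint k).aestronglyMeasurable.aemeasurable.comp_quasiMeasurePreserving
      (Measure.quasiMeasurePreserving_eval _ j)
  unfold polyEnsembleFun
  refine AEMeasurable.const_mul (AEMeasurable.mul ?_ ?_) _
  · unfold vandermondeProd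
    exact (Continuous.measurable (by fun_prop)).aemeasurable
  · simp only [Matrix.det_apply']
    refine Finset.aemeasurable_fun_sum _ fun σ _ => AEMeasurable.const_mul ?_ _
    exact Finset.aemeasurable_fun_prod _ fun i _ => hent _ _

end Transform

/-! ### Spectral laws of invariant random matrices -/

/-- The law `M` of a random Hermitian matrix is invariant under unitary conjugation, and the
increasing enumeration of its non-zero eigenvalues has density `n! Z⁻¹ Δ_n(y) det [h_k(y_j)]` on the
chamber. -/
structure HasSpectralLaw (n ν : ℕ) (M : Measure (Matrix (Fin (n + ν)) (Fin (n + ν)) ℂ))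
    (h : Fin n → ℝ → ℝ) (Z : ℝ) : Prop where
  hermitian : ∀ᵐ A ∂M, A.IsHermitian
  invariant : ∀ V, M.map (conjUnitary V) = M
  density : IsPolyEnsembleDensity (Set.Ioi 0) h Z
  law : ∀ B, MeasurableSet B → M (spectralSet n ν B) =
    n.factorial * ∫⁻ y in B ∩ chamber n, ENNReal.ofReal (polyEnsembleFun h Z y)

section Law

variable {n ν : ℕ}

lemma setLIntegral_orthant_polyEnsembleFun (h : Fin n → ℝ → ℝ) (Z : ℝ) :
    ∫⁻ y in orthant n, ENNReal.ofReal (polyEnsembleFun h Z y) =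
      n.factorial * ∫⁻ y in chamber n, ENNReal.ofReal (polyEnsembleFun h Z y) :=
  setLIntegral_orthant_eq _ (fun σ y => by rw [polyEnsembleFun_comp_perm]) fun y hy => by
    rw [polyEnsembleFun_eq_zero_of_not_injective _ _ hy, ENNReal.ofReal_zero]

lemma IsPolyEnsembleDensity.integrableOn {h : Fin n → ℝ → ℝ} {Z : ℝ} (hn : 1 ≤ n)
    (hd : IsPolyEnsembleDensity (Set.Ioi 0) h Z) (k : Fin n) :
    IntegrableOn (h k) (Set.Ioi 0) := by
  have := hd.moments ⟨0, hn⟩ k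
  simpa using this

lemma HasSpectralLaw.measure_spectralSet_univ
    {M : Measure (Matrix (Fin (n + ν)) (Fin (n + ν)) ℂ)} {h : Fin n → ℝ → ℝ} {Z : ℝ}
    (hM : HasSpectralLaw n ν M h Z) : M (spectralSet n ν Set.univ) = 1 := by
  rw [hM.law _ MeasurableSet.univ, Set.univ_inter, ← setLIntegral_orthant_polyEnsembleFun]
  exact hM.density.normalized

lemma HasSpectralLaw.ae_mem_spectralSet
    {M : Measure (Matrix (Fin (n + ν)) (Fin (n + ν)) ℂ)} [IsProbabilityMeasure M]
    {h : Fin n → ℝ → ℝ} {Z : ℝ} (hM : HasSpectralLaw n ν M h Z) :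
    ∀ᵐ A ∂M, A ∈ spectralSet n ν Set.univ :=
  (prob_compl_eq_zero_iff (measurableSet_spectralSet MeasurableSet.univ)).2
    hM.measure_spectralSet_univ

lemma mem_spectralSet_iff {E : Matrix (Fin (n + ν)) (Fin (n + ν)) ℂ → Fin n → ℝ}
    (hE : ∀ A, ∀ y ∈ chamber n, HasSpectrum ν A y → E A = y)
    {A : Matrix (Fin (n + ν)) (Fin (n + ν)) ℂ} (hA : A ∈ spectralSet n ν Set.univ)
    (B : Set (Fin n → ℝ)) : A ∈ spectralSet n ν B ↔ E A ∈ B := by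
  obtain ⟨y, hy, hAy⟩ := hA
  constructor
  · rintro ⟨z, hz, hAz⟩
    rw [hE A z hz.2 hAz]
    exact hz.1
  · intro h
    rw [hE A y hy.2 hAy] at h
    exact ⟨y, ⟨h, hy.2⟩, hAy⟩

lemma HasSpectralLaw.lintegral_spectrum
    {M : Measure (Matrix (Fin (n + ν)) (Fin (n + ν)) ℂ)} [IsProbabilityMeasure M]
    {h : Fin n → ℝ → ℝ} {Z : ℝ} (hn : 1 ≤ n) (hM : HasSpectralLaw n ν M h Z)
    {E : Matrix (Fin (n + ν)) (Fin (n + ν)) ℂ → Fin n → ℝ} (hEm : Measurable E)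
    (hE : ∀ A, ∀ y ∈ chamber n, HasSpectrum ν A y → E A = y)
    {φ : (Fin n → ℝ) → ENNReal} (hφ : Measurable φ) :
    ∫⁻ A, φ (E A) ∂M =
      n.factorial * ∫⁻ a in chamber n, ENNReal.ofReal (polyEnsembleFun h Z a) * φ a := by
  have hD : AEMeasurable (fun a => ENNReal.ofReal (polyEnsembleFun h Z a))
      (volume.restrict (chamber n)) :=
    ((aemeasurable_polyEnsembleFun (hM.density.integrableOn hn)).mono_measure
      (Measure.restrict_mono (chamber_subset_orthant n) le_rfl)).ennreal_ofReal
  have hmap : M.map E = (n.factorial : ENNReal) • (volume.restrict (chamber n)).withDensity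
      fun a => ENNReal.ofReal (polyEnsembleFun h Z a) := by
    ext B hB
    rw [Measure.map_apply hEm hB, Measure.smul_apply, withDensity_apply _ hB,
      Measure.restrict_restrict hB, smul_eq_mul, ← hM.law B hB]
    refine measure_congr ?_
    filter_upwards [hM.ae_mem_spectralSet] with A hA
    exact propext (mem_spectralSet_iff hE hA B).symm
  rw [← lintegral_map hφ hEm, hmap, lintegral_smul_measure, smul_eq_mul,
    lintegral_withDensity_eq_lintegral_mul₀ hD hφ.aemeasurable]
  rfl

/-- The density of the eigenvalues of a corank one truncation, extended by zero. -/
noncomputable def truncationWeight (n ν : ℕ) (B : Set (Fin n → ℝ)) (a y : Fin n → ℝ) : ENNReal :=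
  {p : (Fin n → ℝ) × (Fin n → ℝ) | p.2 ∈ B ∩ interlaceRegion p.1}.indicator
    (fun p => ENNReal.ofReal (truncationDensity n ν p.1 p.2)) (a, y)

lemma measurable_uncurry_truncationWeight {B : Set (Fin n → ℝ)} (hB : MeasurableSet B) :
    Measurable (Function.uncurry (truncationWeight n ν B)) := by
  have hS : MeasurableSet {p : (Fin n → ℝ) × (Fin n → ℝ) | p.2 ∈ B ∩ interlaceRegion p.1} := by
    have h : {p : (Fin n → ℝ) × (Fin n → ℝ) | p.2 ∈ B ∩ interlaceRegion p.1} =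
        Prod.snd ⁻¹' B ∩ ((⋂ j, {p : (Fin n → ℝ) × (Fin n → ℝ) | 0 < p.2 j}) ∩
          ⋂ i, ⋂ j, ({p : (Fin n → ℝ) × (Fin n → ℝ) | j ≤ i → p.2 j < p.1 i} ∩
            {p : (Fin n → ℝ) × (Fin n → ℝ) | i < j → p.1 i < p.2 j})) := by
      ext p
      simp [interlaceRegion]
    rw [h]
    refine (measurable_snd hB).inter (MeasurableSet.inter (MeasurableSet.iInter fun j => ?_)
      (MeasurableSet.iInter fun i => MeasurableSet.iInter fun j => MeasurableSet.inter ?_ ?_))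
    · exact measurableSet_lt (by fun_prop) (by fun_prop)
    · by_cases hij : j ≤ i
      · simpa [hij] using measurableSet_lt (by fun_prop) (by fun_prop)
      · simp [hij]
    · by_cases hij : i < j
      · simpa [hij] using measurableSet_lt (by fun_prop) (by fun_prop)
      · simp [hij]
  have hf : Measurable fun p : (Fin n → ℝ) × (Fin n → ℝ) =>
      ENNReal.ofReal (truncationDensity n ν p.1 p.2) := by
    unfold truncationDensity vandermondeProd
    refine Measurable.ennreal_ofReal (Measurable.div ?_ ?_)
    · exact Continuous.measurable (by fun_prop)
    · exact Continuous.measurable (by fun_prop)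
  exact hf.indicator hS

lemma lintegral_truncationWeight {B : Set (Fin n → ℝ)} (hB : MeasurableSet B) (a : Fin n → ℝ) :
    ∫⁻ y, truncationWeight n ν B a y =
      ∫⁻ y in B ∩ interlaceRegion a, ENNReal.ofReal (truncationDensity n ν a y) := by
  rw [← lintegral_indicator (hB.inter (measurableSet_interlaceRegion a))]
  rfl

/-- Weighted with the polynomial ensemble density in `a`, the density of the truncation becomes, by
Andréief's identity, a polynomial ensemble density in `y`. -/
lemma setLIntegral_mul_truncationWeight {h : Fin n → ℝ → ℝ} {Z : ℝ}
    (hint : ∀ k, IntegrableOn (h k) (Set.Ioi 0))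
    (hnn : ∀ x ∈ orthant n, 0 ≤ polyEnsembleFun h Z x) (B : Set (Fin n → ℝ)) (y : Fin n → ℝ) :
    ∫⁻ a in chamber n, ENNReal.ofReal (polyEnsembleFun h Z a) * truncationWeight n ν B a y =
      (B ∩ chamber n).indicator
        (fun y => ENNReal.ofReal (polyEnsembleFun (truncTransform ν h) Z y)) y := by
  by_cases hy : y ∈ B ∩ chamber n
  · rw [Set.indicator_of_mem hy, ← (setLIntegral_det_truncKernel hint hnn ν hy.2).2]
    have hne : ∀ᵐ a : Fin n → ℝ, ∀ i j, a i ≠ y j := by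
      rw [ae_all_iff]
      intro i
      rw [ae_all_iff]
      intro j
      rw [ae_iff]
      simp only [ne_eq, not_not]
      exact Measure.pi_hyperplane (fun _ : Fin n => (volume : Measure ℝ)) i (y j)
    refine lintegral_congr_ae ?_
    filter_upwards [ae_restrict_mem (measurableSet_chamber n), ae_restrict_of_ae hne] with a ha hay
    have hVa := vandermondeProd_pos ha.1
    have hVy := vandermondeProd_pos hy.2.1
    have hpa : 0 < ∏ j, a j := Finset.prod_pos fun j _ => ha.2 j
    have hD := hnn a (chamber_subset_orthant n ha)
    rw [det_truncKernel ν ha hy.2, truncationWeight]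
    by_cases hI : Interlaces a y
    · have hmem : (a, y) ∈
          {p : (Fin n → ℝ) × (Fin n → ℝ) | p.2 ∈ B ∩ interlaceRegion p.1} :=
        ⟨hy.1, (mem_interlaceRegion_iff hy.2.2 hay).2 hI⟩
      rw [Set.indicator_of_mem hmem, ← ENNReal.ofReal_mul hD, if_pos hI]
      congr 1
      rw [polyEnsembleFun, truncationDensity]
      field_simp
    · have hmem : (a, y) ∉
          {p : (Fin n → ℝ) × (Fin n → ℝ) | p.2 ∈ B ∩ interlaceRegion p.1} :=
        fun hm => hI ((mem_interlaceRegion_iff hy.2.2 hay).1 hm.2)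
      rw [Set.indicator_of_notMem hmem, if_neg hI]
      simp
  · rw [Set.indicator_of_notMem hy]
    have hz : ∀ a, truncationWeight n ν B a y = 0 := by
      intro a
      rw [truncationWeight]
      refine Set.indicator_of_notMem (fun hm => hy ⟨hm.1, ?_⟩) _
      exact interlaceRegion_subset_chamber a hm.2
    simp [hz]

/-- By invariance a truncation has the law of the truncation of a randomly rotated matrix. -/
lemma measure_truncate_eq_lintegral {N : ℕ} (M : Measure (Matrix (Fin (N + 1)) (Fin (N + 1)) ℂ))
    [IsProbabilityMeasure M] (hM : ∀ V, M.map (conjUnitary V) = M)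
    {S : Set (Matrix (Fin N) (Fin N) ℂ)} (hS : MeasurableSet S) :
    M.map truncate S =
      ∫⁻ A, unitaryHaar (N + 1) {V | truncate (conjUnitary V A) ∈ S} ∂M := by
  have hjoint : MeasurableSet {p : Matrix.unitaryGroup (Fin (N + 1)) ℂ ×
      Matrix (Fin (N + 1)) (Fin (N + 1)) ℂ | truncate (conjUnitary p.1 p.2) ∈ S} := by
    have hc : Continuous fun p : Matrix.unitaryGroup (Fin (N + 1)) ℂ ×
        Matrix (Fin (N + 1)) (Fin (N + 1)) ℂ => truncate (conjUnitary p.1 p.2) :=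
      continuous_truncate.comp continuous_uncurry_conjUnitary
    exact hc.measurable hS
  have h1 : ∀ V, M {A | truncate (conjUnitary V A) ∈ S} = M.map truncate S := by
    intro V
    conv_rhs => rw [← hM V]
    rw [Measure.map_map measurable_truncate (continuous_conjUnitary V).measurable,
      Measure.map_apply (measurable_truncate.comp (continuous_conjUnitary V).measurable) hS]
    rfl
  have h2 := Measure.prod_apply (μ := unitaryHaar (N + 1)) (ν := M) hjoint
  have h3 := Measure.prod_apply_symm (μ := unitaryHaar (N + 1)) (ν := M) hjoint
  have h4 : ∫⁻ V, M (Prod.mk V ⁻¹' {p : Matrix.unitaryGroup (Fin (N + 1)) ℂ ×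
      Matrix (Fin (N + 1)) (Fin (N + 1)) ℂ | truncate (conjUnitary p.1 p.2) ∈ S})
      ∂(unitaryHaar (N + 1)) = M.map truncate S := by
    calc _ = ∫⁻ _, M.map truncate S ∂(unitaryHaar (N + 1)) := lintegral_congr fun V => h1 V
      _ = _ := by rw [lintegral_const, measure_univ, mul_one]
  rw [← h4, ← h2, h3]
  rfl

/-- The effect of a corank one truncation on the spectral law. -/
lemma HasSpectralLaw.map_truncate (hn : 1 ≤ n)
    {M : Measure (Matrix (Fin (n + ν + 1)) (Fin (n + ν + 1)) ℂ)} [IsProbabilityMeasure M]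
    {h : Fin n → ℝ → ℝ} {Z : ℝ} (hM : HasSpectralLaw n (ν + 1) M h Z) :
    ∃ Z', HasSpectralLaw n ν (M.map truncate) (truncTransform ν h) Z' := by
  obtain ⟨hm0, hmt, -⟩ := dirichletMass_spec n ν
  obtain ⟨E, hEm, hE⟩ := exists_measurable_spectrum n (ν + 1)
  have hint := hM.density.integrableOn hn
  set c : ENNReal := (dirichletMass n ν)⁻¹ with hc
  have hct : c ≠ ⊤ := ENNReal.inv_ne_top.2 hm0
  have hc0 : c ≠ 0 := ENNReal.inv_ne_zero.2 hmt
  have hcr : 0 < c.toReal := ENNReal.toReal_pos hc0 hct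
  have haeE : ∀ᵐ A ∂M, E A ∈ chamber n ∧ HasSpectrum (n := n) (ν + 1) A (E A) := by
    filter_upwards [hM.ae_mem_spectralSet] with A hA
    obtain ⟨y, hy, hAy⟩ := hA
    rw [hE A y hy.2 hAy]
    exact ⟨hy.2, hAy⟩
  have hker : ∀ B, MeasurableSet B → M.map truncate (spectralSet n ν B) =
      ∫⁻ A, (c * ∫⁻ y, truncationWeight n ν B (E A) y) ∂M := by
    intro B hB
    rw [measure_truncate_eq_lintegral M hM.invariant (measurableSet_spectralSet hB)]
    refine lintegral_congr_ae ?_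
    filter_upwards [haeE, hM.hermitian] with A hA hherm
    rw [lintegral_truncationWeight hB, haar_truncate_mem_spectralSet hherm hA.1 hA.2 hB]
  have hlaw : ∀ B, MeasurableSet B → M.map truncate (spectralSet n ν B) =
      n.factorial * ∫⁻ y in B ∩ chamber n,
        ENNReal.ofReal (polyEnsembleFun (truncTransform ν h) (Z * c.toReal⁻¹) y) := by
    intro B hB
    have hwm := measurable_uncurry_truncationWeight (n := n) (ν := ν) hB
    have hD : AEMeasurable (fun a => ENNReal.ofReal (polyEnsembleFun h Z a))
        (volume.restrict (chamber n)) :=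
      ((aemeasurable_polyEnsembleFun hint).mono_measure
        (Measure.restrict_mono (chamber_subset_orthant n) le_rfl)).ennreal_ofReal
    have hφ : Measurable fun a => c * ∫⁻ y, truncationWeight n ν B a y :=
      (Measurable.lintegral_prod_right' (f := Function.uncurry (truncationWeight n ν B))
        hwm).const_mul c
    refine (hker B hB).trans ((hM.lintegral_spectrum hn hEm hE hφ).trans ?_)
    congr 1
    calc ∫⁻ a in chamber n, ENNReal.ofReal (polyEnsembleFun h Z a) *
          (c * ∫⁻ y, truncationWeight n ν B a y)
        = c * ∫⁻ a in chamber n, ∫⁻ y, ENNReal.ofReal (polyEnsembleFun h Z a) *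
            truncationWeight n ν B a y := by
          rw [← lintegral_const_mul' _ _ hct]
          refine lintegral_congr fun a => ?_
          rw [lintegral_const_mul' _ _ ENNReal.ofReal_ne_top, mul_left_comm]
      _ = c * ∫⁻ y, ∫⁻ a in chamber n, ENNReal.ofReal (polyEnsembleFun h Z a) *
            truncationWeight n ν B a y := by
          rw [lintegral_lintegral_swap]
          exact (hD.comp_fst).mul hwm.aemeasurable
      _ = c * ∫⁻ y in B ∩ chamber n,
            ENNReal.ofReal (polyEnsembleFun (truncTransform ν h) Z y) := by
          rw [← lintegral_indicator (hB.inter (measurableSet_chamber n))]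
          congr 1
          exact lintegral_congr fun y =>
            setLIntegral_mul_truncationWeight hint hM.density.nonneg B y
      _ = _ := by
          rw [← lintegral_const_mul' _ _ hct]
          refine lintegral_congr fun y => ?_
          rw [polyEnsembleFun_mul_const, ENNReal.ofReal_mul hcr.le, ENNReal.ofReal_toReal hct]
  refine ⟨Z * c.toReal⁻¹, ?_, ?_, ⟨?_, ?_, ?_⟩, hlaw⟩
  · have hclosed : MeasurableSet {A : Matrix (Fin (n + ν)) (Fin (n + ν)) ℂ | A.IsHermitian} :=
      (isClosed_eq (by fun_prop) continuous_id).measurableSet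
    rw [ae_map_iff measurable_truncate.aemeasurable hclosed]
    filter_upwards [hM.hermitian] with A hA
    exact hA.submatrix _
  · intro V
    conv_rhs => rw [← hM.invariant (extendUnitary V)]
    rw [Measure.map_map (continuous_conjUnitary V).measurable measurable_truncate,
      Measure.map_map measurable_truncate (continuous_conjUnitary _).measurable]
    congr 1
    ext1 A
    exact (truncate_conjUnitary_extendUnitary V A).symm
  · exact fun j k => integrableOn_truncTransform ν j (hint k) (hM.density.moments j k)
  · intro y hy
    rw [polyEnsembleFun_mul_const]
    exact mul_nonneg hcr.le
      (polyEnsembleFun_truncTransform_nonneg hint hM.density.nonneg ν hy)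
  · have h1 := setLIntegral_orthant_polyEnsembleFun (truncTransform ν h) (Z * c.toReal⁻¹)
    have h2 := hlaw Set.univ MeasurableSet.univ
    rw [Set.univ_inter, ← h1] at h2
    change ∫⁻ y in orthant n, _ = 1
    rw [← h2, hker _ MeasurableSet.univ]
    have h3 : ∀ᵐ A ∂M, c * ∫⁻ y, truncationWeight n ν Set.univ (E A) y = 1 := by
      filter_upwards [haeE] with A hA
      rw [lintegral_truncationWeight MeasurableSet.univ, Set.univ_inter,
        lintegral_truncationDensity ν hA.1, hc, ENNReal.inv_mul_cancel hm0 hmt]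
    exact (lintegral_congr_ae h3).trans (by simp)

end Law

/-! ### Composition of the kernels of successive truncations -/

/-- The kernel `(y / t) ^ ν (1 - y / t) ^ r / t` on `y < t`. -/
noncomputable def powKernel (ν r : ℕ) (y t : ℝ) : ℝ :=
  if y < t then (y / t) ^ ν * (1 - y / t) ^ r / t else 0

/-- Up to a constant factor, the effect of a truncation of corank `r + 1` on the functions of a
polynomial ensemble. -/
noncomputable def powTransform {n : ℕ} (ν r : ℕ) (f : Fin n → ℝ → ℝ) (k : Fin n) (y : ℝ) : ℝ :=
  ∫ t in Set.Ioi 0, f k t * powKernel ν r y t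

lemma measurable_uncurry_powKernel (ν r : ℕ) : Measurable (Function.uncurry (powKernel ν r)) := by
  unfold powKernel Function.uncurry
  refine Measurable.ite (measurableSet_lt measurable_fst measurable_snd) ?_ measurable_const
  fun_prop

lemma powKernel_nonneg (ν r : ℕ) {y t : ℝ} (hy : 0 < y) : 0 ≤ powKernel ν r y t := by
  rw [powKernel]
  split_ifs with h
  · have ht := hy.trans h
    have h1 : 0 ≤ 1 - y / t := sub_nonneg.2 ((div_le_one ht).2 h.le)
    positivity
  · exact le_rfl

lemma norm_powKernel_le (ν r : ℕ) {y : ℝ} (hy : 0 < y) (t : ℝ) :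
    ‖powKernel ν r y t‖ ≤ y⁻¹ := by
  rw [Real.norm_of_nonneg (powKernel_nonneg ν r hy), powKernel]
  split_ifs with h
  · have ht := hy.trans h
    have h1 : 0 ≤ 1 - y / t := sub_nonneg.2 ((div_le_one ht).2 h.le)
    have h2 : 1 - y / t ≤ 1 := sub_le_self _ (by positivity)
    have h3 : y / t ≤ 1 := (div_le_one ht).2 h.le
    calc (y / t) ^ ν * (1 - y / t) ^ r / t ≤ 1 * 1 / t := by
          gcongr
          · exact pow_le_one₀ (by positivity) h3
          · exact pow_le_one₀ h1 h2
      _ = t⁻¹ := by rw [one_mul, one_div]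
      _ ≤ y⁻¹ := by gcongr
  · positivity

lemma integrable_mul_powKernel (ν r : ℕ) {h : ℝ → ℝ} (hh : IntegrableOn h (Set.Ioi 0)) {y : ℝ}
    (hy : 0 < y) : IntegrableOn (fun t => h t * powKernel ν r y t) (Set.Ioi 0) :=
  Integrable.mul_bdd (c := y⁻¹) hh
    ((measurable_uncurry_powKernel ν r).comp measurable_prodMk_left).aestronglyMeasurable
    (Filter.Eventually.of_forall fun t => norm_powKernel_le ν r hy t)

lemma powKernel_zero (ν : ℕ) {y : ℝ} (t : ℝ) : powKernel ν 0 y t = truncKernel ν y t := by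
  rw [powKernel, truncKernel]
  split_ifs
  · rw [pow_zero, mul_one, div_pow, pow_succ, mul_inv, div_eq_mul_inv, div_eq_mul_inv, mul_assoc]
  · rfl

lemma powTransform_zero {n : ℕ} (ν : ℕ) (f : Fin n → ℝ → ℝ) :
    powTransform ν 0 f = truncTransform ν f := by
  ext k y
  simp only [powTransform, truncTransform, powKernel_zero]

lemma integral_one_sub_div_pow (r : ℕ) (y : ℝ) {t : ℝ} (ht : t ≠ 0) :
    ∫ s in y..t, (1 - s / t) ^ r = t * (1 - y / t) ^ (r + 1) / (r + 1) := by
  have hr : (r : ℝ) + 1 ≠ 0 := by positivity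
  have hderiv : ∀ s ∈ Set.uIcc y t, HasDerivAt
      (fun s => -(t / (r + 1)) * (1 - s / t) ^ (r + 1)) ((1 - s / t) ^ r) s := by
    intro s _
    have h1 : HasDerivAt (fun s : ℝ => 1 - s / t) (-(1 / t)) s :=
      ((hasDerivAt_id s).div_const t).const_sub 1
    refine ((h1.fun_pow (r + 1)).const_mul (-(t / ((r : ℝ) + 1)))).congr_deriv ?_
    generalize 1 - s / t = q
    rw [Nat.add_sub_cancel]
    push_cast
    field_simp
  rw [intervalIntegral.integral_eq_sub_of_hasDerivAt hderiv
    (Continuous.intervalIntegrable (by fun_prop) _ _), div_self ht]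
  simp
  ring

/-- The kernels of successive truncations compose. -/
lemma powKernel_mul_truncKernel (ν r : ℕ) {y : ℝ} (hy : 0 < y) (t : ℝ) :
    IntegrableOn (fun s => powKernel (ν + 1) r s t * truncKernel ν y s) (Set.Ioi 0) ∧
    ∫ s in Set.Ioi 0, powKernel (ν + 1) r s t * truncKernel ν y s =
      ((r : ℝ) + 1)⁻¹ * powKernel ν (r + 1) y t := by
  have hslice : (fun s => powKernel (ν + 1) r s t * truncKernel ν y s) =
      (Set.Ioo y t).indicator fun s => y ^ ν * (t ^ (ν + 2))⁻¹ * (1 - s / t) ^ r := by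
    ext s
    by_cases hs : s ∈ Set.Ioo y t
    · have hs0 : 0 < s := hy.trans hs.1
      have ht0 : 0 < t := hs0.trans hs.2
      rw [Set.indicator_of_mem hs, powKernel, truncKernel, if_pos hs.2, if_pos hs.1, div_pow]
      generalize (1 - s / t) ^ r = q
      field_simp
      ring
    · rw [Set.indicator_of_notMem hs]
      by_cases h1 : y < s
      · have h2 : ¬ s < t := fun h2 => hs ⟨h1, h2⟩
        rw [powKernel, if_neg h2, zero_mul]
      · rw [truncKernel, if_neg h1, mul_zero]
  have hsub : Set.Ioo y t ∩ Set.Ioi 0 = Set.Ioo y t :=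
    Set.inter_eq_left.2 fun s hs => hy.trans hs.1
  rw [hslice]
  constructor
  · rw [IntegrableOn, integrable_indicator_iff measurableSet_Ioo, IntegrableOn,
      Measure.restrict_restrict measurableSet_Ioo, hsub]
    have hc : Continuous fun s : ℝ => y ^ ν * (t ^ (ν + 2))⁻¹ * (1 - s / t) ^ r := by fun_prop
    exact (hc.integrableOn_Icc (a := y) (b := t)).mono_set Set.Ioo_subset_Icc_self
  · rw [integral_indicator measurableSet_Ioo, Measure.restrict_restrict measurableSet_Ioo, hsub,
      powKernel]
    split_ifs with h
    · have ht0 := hy.trans h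
      rw [← integral_Ioc_eq_integral_Ioo, ← intervalIntegral.integral_of_le h.le,
        intervalIntegral.integral_const_mul, integral_one_sub_div_pow r y ht0.ne', div_pow]
      generalize (1 - y / t) ^ (r + 1) = q
      field_simp
      ring
    · rw [Set.Ioo_eq_empty h]
      simp

lemma truncTransform_powTransform {n : ℕ} (ν r : ℕ) {f : Fin n → ℝ → ℝ} {k : Fin n}
    (hf : IntegrableOn (f k) (Set.Ioi 0)) {y : ℝ} (hy : 0 < y) :
    truncTransform ν (powTransform (ν + 1) r f) k y =
      ((r : ℝ) + 1)⁻¹ * powTransform ν (r + 1) f k y := by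
  set μ := volume.restrict (Set.Ioi (0 : ℝ)) with hμ
  have hslice := fun t => powKernel_mul_truncKernel ν r hy t
  have hF : Integrable (fun p : ℝ × ℝ =>
      f k p.2 * (powKernel (ν + 1) r p.1 p.2 * truncKernel ν y p.1)) (μ.prod μ) := by
    have hmeas : AEStronglyMeasurable (fun p : ℝ × ℝ =>
        f k p.2 * (powKernel (ν + 1) r p.1 p.2 * truncKernel ν y p.1)) (μ.prod μ) := by
      refine hf.aestronglyMeasurable.comp_snd.mul (AEStronglyMeasurable.mul ?_ ?_)
      · exact (measurable_uncurry_powKernel (ν + 1) r).aestronglyMeasurable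
      · exact (((measurable_uncurry_truncKernel ν).comp
          measurable_prodMk_left).comp measurable_fst).aestronglyMeasurable
    rw [integrable_prod_iff' hmeas]
    constructor
    · exact Filter.Eventually.of_forall fun t => (hslice t).1.const_mul (f k t)
    · have hnorm : ∀ t, ∫ s, ‖f k t * (powKernel (ν + 1) r s t * truncKernel ν y s)‖ ∂μ =
          ‖f k t‖ * powKernel ν (r + 1) y t * ((r : ℝ) + 1)⁻¹ := by
        intro t
        have h1 : ∀ s ∈ Set.Ioi (0 : ℝ),
            ‖f k t * (powKernel (ν + 1) r s t * truncKernel ν y s)‖ =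
              ‖f k t‖ * (powKernel (ν + 1) r s t * truncKernel ν y s) := by
          intro s hs
          rw [norm_mul, Real.norm_of_nonneg (mul_nonneg
            (powKernel_nonneg (ν + 1) r hs) (truncKernel_nonneg ν hy))]
        rw [hμ, setIntegral_congr_fun measurableSet_Ioi h1, integral_const_mul, (hslice t).2]
        ring
      simp_rw [hnorm]
      exact (integrable_mul_powKernel ν (r + 1) hf.norm hy).mul_const _
  calc truncTransform ν (powTransform (ν + 1) r f) k y
      = ∫ s, ∫ t, f k t * (powKernel (ν + 1) r s t * truncKernel ν y s) ∂μ ∂μ := by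
        rw [truncTransform]
        refine integral_congr_ae (Filter.Eventually.of_forall fun s => ?_)
        simp only [powTransform, ← mul_assoc, integral_mul_const]
        rfl
    _ = ∫ t, ∫ s, f k t * (powKernel (ν + 1) r s t * truncKernel ν y s) ∂μ ∂μ :=
        integral_integral_swap hF
    _ = ∫ t, ((r : ℝ) + 1)⁻¹ * (f k t * powKernel ν (r + 1) y t) ∂μ := by
        refine integral_congr_ae (Filter.Eventually.of_forall fun t => ?_)
        simp only
        rw [integral_const_mul, (hslice t).2]
        ring
    _ = _ := by rw [integral_const_mul, powTransform]

/-- The substitution `x = y / t` turns `powTransform` into a multiplicative convolution. -/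
lemma integrableOn_and_powTransform_eq {n : ℕ} (ν r : ℕ) {f : Fin n → ℝ → ℝ} {k : Fin n}
    (hf : IntegrableOn (f k) (Set.Ioi 0)) {y : ℝ} (hy : 0 < y) :
    IntegrableOn (fun x : ℝ => x ^ ν * (1 - x) ^ r * f k (y / x) / x) (Set.Ioo 0 1) ∧
    ∫ x in Set.Ioo (0 : ℝ) 1, x ^ ν * (1 - x) ^ r * f k (y / x) / x = powTransform ν r f k y := by
  have himg : (fun t : ℝ => y / t) '' Set.Ioi y = Set.Ioo 0 1 := by
    ext x
    constructor
    · rintro ⟨t, ht, rfl⟩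
      have ht0 : 0 < t := hy.trans ht
      exact ⟨by positivity, (div_lt_one ht0).2 ht⟩
    · rintro ⟨hx0, hx1⟩
      refine ⟨y / x, ?_, by field_simp⟩
      rw [Set.mem_Ioi, lt_div_iff₀ hx0]
      nlinarith
  have hderiv : ∀ t ∈ Set.Ioi y,
      HasDerivWithinAt (fun t : ℝ => y / t) (-(y / t ^ 2)) (Set.Ioi y) t := by
    intro t ht
    have ht0 : t ≠ 0 := (hy.trans ht).ne'
    have h := (hasDerivAt_inv ht0).const_mul y
    refine HasDerivAt.hasDerivWithinAt ?_
    simp only [div_eq_mul_inv]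
    exact h.congr_deriv (by ring)
  have hinj : Set.InjOn (fun t : ℝ => y / t) (Set.Ioi y) := by
    intro s hs t ht hst
    have hs0 : s ≠ 0 := (hy.trans hs).ne'
    have ht0 : t ≠ 0 := (hy.trans ht).ne'
    simp only at hst
    field_simp at hst
    exact hst.symm
  have hfun : ∀ t ∈ Set.Ioi y, |-(y / t ^ 2)| •
      ((y / t) ^ ν * (1 - y / t) ^ r * f k (y / (y / t)) / (y / t)) = f k t * powKernel ν r y t := by
    intro t ht
    have ht0 : 0 < t := hy.trans ht
    have h1 : y / (y / t) = t := by field_simp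
    rw [abs_neg, abs_of_pos (by positivity), powKernel, if_pos (show y < t from ht), h1,
      smul_eq_mul]
    generalize (1 - y / t) ^ r = q
    field_simp
  have hIoi := integrable_mul_powKernel ν r hf hy
  constructor
  · rw [← himg, integrableOn_image_iff_integrableOn_abs_deriv_smul measurableSet_Ioi hderiv hinj]
    exact (hIoi.mono_set (Set.Ioi_subset_Ioi hy.le)).congr_fun
      (fun t ht => (hfun t ht).symm) measurableSet_Ioi
  · rw [← himg, integral_image_eq_integral_abs_deriv_smul measurableSet_Ioi hderiv hinj,
      setIntegral_congr_fun measurableSet_Ioi hfun, powTransform]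
    have hsplit : ∀ t, f k t * powKernel ν r y t =
        (Set.Ioi y).indicator (fun t => f k t * powKernel ν r y t) t := by
      intro t
      by_cases ht : t ∈ Set.Ioi y
      · rw [Set.indicator_of_mem ht]
      · rw [Set.indicator_of_notMem ht, powKernel, if_neg (show ¬ y < t from ht), mul_zero]
    conv_rhs => rw [integral_congr_ae (Filter.Eventually.of_forall hsplit)]
    rw [integral_indicator measurableSet_Ioi, Measure.restrict_restrict measurableSet_Ioi,
      Set.inter_eq_left.2 (Set.Ioi_subset_Ioi hy.le)]

/-! ### Randomly rotated matrices and their compressions -/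

section Rescaling

variable {n ν : ℕ}

/-- The functions of a polynomial ensemble matter on the half-line only, and up to a common
constant. -/
lemma HasSpectralLaw.congr_const {M : Measure (Matrix (Fin (n + ν)) (Fin (n + ν)) ℂ)}
    {h h' : Fin n → ℝ → ℝ} {Z c : ℝ} (hM : HasSpectralLaw n ν M h Z) (hc : 0 < c)
    (hh : ∀ k, ∀ t, 0 < t → h k t = c * h' k t) : ∃ Z', HasSpectralLaw n ν M h' Z' := by
  have key : ∀ x ∈ orthant n, polyEnsembleFun h' (Z * (c ^ n)⁻¹) x = polyEnsembleFun h Z x := by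
    intro x hx
    rw [polyEnsembleFun_mul_const, polyEnsembleFun_smul hh Z hx]
  refine ⟨Z * (c ^ n)⁻¹, hM.hermitian, hM.invariant, ⟨fun j k => ?_, fun x hx => ?_, ?_⟩,
    fun B hB => ?_⟩
  · refine IntegrableOn.congr_fun ((hM.density.moments j k).const_mul c⁻¹) (fun t ht => ?_)
      measurableSet_Ioi
    simp only [hh k t ht]
    field_simp
  · rw [key x hx]
    exact hM.density.nonneg x hx
  · rw [← hM.density.normalized]
    refine setLIntegral_congr_fun (measurableSet_orthant n) fun x hx => ?_
    simp only [key x hx]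
  · rw [hM.law B hB]
    congr 1
    refine setLIntegral_congr_fun (hB.inter (measurableSet_chamber n)) fun x hx => ?_
    simp only [key x (chamber_subset_orthant n hx.2)]

/-- The vectors whose coordinates can be rearranged to a point of `B` in the chamber. -/
def symmetrization (B : Set (Fin n → ℝ)) : Set (Fin n → ℝ) :=
  {v | ∃ σ : Equiv.Perm (Fin n), v ∘ σ ∈ B ∩ chamber n}

lemma measurableSet_symmetrization {B : Set (Fin n → ℝ)} (hB : MeasurableSet B) :
    MeasurableSet (symmetrization B) := by
  have h : symmetrization B = ⋃ σ : Equiv.Perm (Fin n),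
      (fun v : Fin n → ℝ => v ∘ σ) ⁻¹' (B ∩ chamber n) := by
    ext v
    simp [symmetrization]
  rw [h]
  exact MeasurableSet.iUnion fun σ =>
    (measurableEmbedding_comp_perm σ).measurable (hB.inter (measurableSet_chamber n))

lemma comp_perm_mem_symmetrization {B : Set (Fin n → ℝ)} (τ : Equiv.Perm (Fin n))
    {v : Fin n → ℝ} : v ∘ τ ∈ symmetrization B ↔ v ∈ symmetrization B := by
  constructor
  · rintro ⟨σ, hσ⟩
    exact ⟨σ.trans τ, hσ⟩
  · rintro ⟨σ, hσ⟩
    refine ⟨σ.trans τ.symm, ?_⟩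
    convert hσ using 1
    ext i
    simp

lemma mem_symmetrization_iff {B : Set (Fin n → ℝ)} {v : Fin n → ℝ} (hv : v ∈ chamber n) :
    v ∈ symmetrization B ↔ v ∈ B := by
  constructor
  · rintro ⟨σ, hσ⟩
    have h : σ = Equiv.refl _ := strictMono_comp_perm_unique (y := v) hσ.2.1 hv.1
    rw [h] at hσ
    exact hσ.1
  · exact fun h => ⟨Equiv.refl _, h, hv⟩

/-- The mass of a symmetric set is `n!` times the mass of its part in the chamber. -/
lemma setLIntegral_inter_orthant (h : Fin n → ℝ → ℝ) (Z : ℝ) {S : Set (Fin n → ℝ)}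
    (hS : MeasurableSet S) (hsymm : ∀ (σ : Equiv.Perm (Fin n)) v, v ∘ σ ∈ S ↔ v ∈ S) :
    ∫⁻ v in S ∩ orthant n, ENNReal.ofReal (polyEnsembleFun h Z v) =
      n.factorial * ∫⁻ v in S ∩ chamber n, ENNReal.ofReal (polyEnsembleFun h Z v) := by
  have key := setLIntegral_orthant_eq
    (S.indicator fun v => ENNReal.ofReal (polyEnsembleFun h Z v))
    (fun σ y => by
      by_cases hy : y ∈ S
      · rw [Set.indicator_of_mem hy, Set.indicator_of_mem ((hsymm σ y).2 hy),
          polyEnsembleFun_comp_perm]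
      · rw [Set.indicator_of_notMem hy, Set.indicator_of_notMem (fun h => hy ((hsymm σ y).1 h))])
    (fun y hy => by
      rw [Set.indicator_apply_eq_zero]
      intro _
      rw [polyEnsembleFun_eq_zero_of_not_injective _ _ hy, ENNReal.ofReal_zero])
  rwa [lintegral_indicator hS, lintegral_indicator hS, Measure.restrict_restrict hS,
    Measure.restrict_restrict hS] at key

end Rescaling

section Eigenvalues

open Polynomial

variable {n ν : ℕ}

lemma nonzeroEigenvalues_of_charpoly_eq {A : Matrix (Fin (n + ν)) (Fin (n + ν)) ℂ} {y : Fin n → ℝ}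
    (hA : HasSpectrum ν A y) (hy : ∀ j, 0 < y j) :
    nonzeroEigenvalues A = (Finset.univ : Finset (Fin n)).val.map y := by
  have hne : (∏ j, (X - C (y j : ℂ)) : ℂ[X]) ≠ 0 :=
    Finset.prod_ne_zero_iff.2 fun j _ => X_sub_C_ne_zero _
  have hroots : A.charpoly.roots =
      ν • {0} + (Finset.univ : Finset (Fin n)).val.map fun j => (y j : ℂ) := by
    rw [hA, roots_mul (mul_ne_zero (pow_ne_zero _ X_ne_zero) hne), roots_X_pow,
      roots_prod _ _ hne]
    congr 1
    simp
  have h0 : Multiset.filter (fun z : ℂ => z ≠ 0) (ν • {0}) = 0 := by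
    rw [Multiset.filter_eq_nil]
    intro z hz
    rw [Multiset.nsmul_singleton] at hz
    simp [Multiset.eq_of_mem_replicate hz]
  have h1 : Multiset.filter (fun z : ℂ => z ≠ 0)
      ((Finset.univ : Finset (Fin n)).val.map fun j => (y j : ℂ)) =
      (Finset.univ : Finset (Fin n)).val.map fun j => (y j : ℂ) := by
    rw [Multiset.filter_eq_self]
    intro z hz
    obtain ⟨j, -, rfl⟩ := Multiset.mem_map.1 hz
    exact_mod_cast (hy j).ne'
  rw [nonzeroEigenvalues, hroots, Multiset.filter_add, h0, h1, zero_add, Multiset.map_map]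
  simp

lemma hasSpectrum_of_nonzeroEigenvalues {A : Matrix (Fin (n + ν)) (Fin (n + ν)) ℂ}
    (hA : A.IsHermitian) (h0 : A.charpoly.rootMultiplicity 0 = ν) {x : Fin n → ℝ}
    (hx : nonzeroEigenvalues A = (Finset.univ : Finset (Fin n)).val.map x) :
    HasSpectrum ν A x := by
  have hreal : ∀ z ∈ A.charpoly.roots, ((z.re : ℝ) : ℂ) = z := by
    intro z hz
    rw [hA.roots_charpoly_eq_eigenvalues] at hz
    obtain ⟨i, -, rfl⟩ := Multiset.mem_map.1 hz
    simp
  have hnz : A.charpoly.roots.filter (fun z => z ≠ 0) =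
      (Finset.univ : Finset (Fin n)).val.map fun j => (x j : ℂ) := by
    have h := congrArg (Multiset.map fun t : ℝ => (t : ℂ)) hx
    rw [nonzeroEigenvalues, Multiset.map_map, Multiset.map_map] at h
    exact ((Multiset.map_congr rfl fun z hz => hreal z (Multiset.mem_of_mem_filter hz)).trans
      (Multiset.map_id' _)).symm.trans h
  have hz : A.charpoly.roots.filter (fun z => z = 0) = Multiset.replicate ν 0 := by
    rw [Multiset.filter_eq', count_roots, h0]
  have hroots : A.charpoly.roots = Multiset.replicate ν 0 +
      (Finset.univ : Finset (Fin n)).val.map fun j => (x j : ℂ) := by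
    rw [← Multiset.filter_add_not (fun z => z = 0) A.charpoly.roots, hz, ← hnz]
  rw [HasSpectrum, (IsAlgClosed.splits A.charpoly).eq_prod_roots_of_monic A.charpoly_monic, hroots]
  simp [Function.comp_def, List.prod_ofFn]

lemma HasSpectrum.comp_perm {A : Matrix (Fin (n + ν)) (Fin (n + ν)) ℂ} {x : Fin n → ℝ}
    (hA : HasSpectrum ν A x) (σ : Equiv.Perm (Fin n)) : HasSpectrum ν A (x ∘ σ) := by
  rw [HasSpectrum, hA]
  congr 1
  exact (Equiv.prod_comp σ fun j => X - C (x j : ℂ)).symm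

lemma mem_spectralSet_iff_mem_symmetrization {A : Matrix (Fin (n + ν)) (Fin (n + ν)) ℂ}
    {x : Fin n → ℝ} (hA : HasSpectrum ν A x)
    (hx : nonzeroEigenvalues A = (Finset.univ : Finset (Fin n)).val.map x) (B : Set (Fin n → ℝ)) :
    A ∈ spectralSet n ν B ↔ x ∈ symmetrization B := by
  constructor
  · rintro ⟨y, hy, hAy⟩
    have hxy : (Finset.univ : Finset (Fin n)).val.map x =
        (Finset.univ : Finset (Fin n)).val.map y :=
      hx.symm.trans (nonzeroEigenvalues_of_charpoly_eq hAy hy.2.2)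
    have hinj : Function.Injective x := by
      have hnodup : ((Finset.univ : Finset (Fin n)).val.map x).Nodup := by
        rw [hxy]
        exact Finset.univ.nodup.map hy.2.1.injective
      intro i j hij
      exact Multiset.inj_on_of_nodup_map hnodup i (Finset.mem_univ i) j (Finset.mem_univ j) hij
    have hpos : ∀ j, 0 < x j := by
      intro j
      have hj : x j ∈ (Finset.univ : Finset (Fin n)).val.map y := by
        rw [← hxy]
        exact Multiset.mem_map_of_mem x (Finset.mem_univ j)
      obtain ⟨i, -, hi⟩ := Multiset.mem_map.1 hj
      rw [← hi]
      exact hy.2.2 i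
    have hc := comp_sort_mem_chamber hinj hpos
    refine ⟨Tuple.sort x, ?_⟩
    rwa [HasSpectrum.unique hc hy.2 (hA.comp_perm _) hAy]
  · rintro ⟨σ, hσ⟩
    exact ⟨x ∘ σ, hσ, hA.comp_perm σ⟩

lemma charpoly_conjUnitary {N : ℕ} (V : Matrix.unitaryGroup (Fin N) ℂ)
    (A : Matrix (Fin N) (Fin N) ℂ) : (conjUnitary V A).charpoly = A.charpoly := by
  rw [conjUnitary, Matrix.charpoly_mul_comm, ← mul_assoc, Unitary.coe_star_mul_self, one_mul]

lemma isHermitian_conjUnitary {N : ℕ} (V : Matrix.unitaryGroup (Fin N) ℂ)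
    {A : Matrix (Fin N) (Fin N) ℂ} (hA : A.IsHermitian) : (conjUnitary V A).IsHermitian :=
  Matrix.isHermitian_mul_mul_conjTranspose _ hA

end Eigenvalues

section RandomRotation

variable {Ω : Type*} [MeasurableSpace Ω] {P : Measure Ω} [IsProbabilityMeasure P]

lemma measurable_uncurry_conjUnitary {N : ℕ} :
    Measurable fun p : Matrix.unitaryGroup (Fin N) ℂ × Matrix (Fin N) (Fin N) ℂ =>
      conjUnitary p.1 p.2 := by
  have h := continuous_uncurry_conjUnitary (N := N)
  exact h.measurable

lemma measurable_conjUnitary_comp {N : ℕ} {X : Ω → Matrix (Fin N) (Fin N) ℂ} (hX : Measurable X)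
    {U : Ω → Matrix.unitaryGroup (Fin N) ℂ} (hU : Measurable U) :
    Measurable fun ω => conjUnitary (U ω) (X ω) := by
  have h := measurable_uncurry_conjUnitary.comp (hU.prodMk hX)
  simpa only [Function.comp_def] using h

/-- A deterministic rotation does not change the law of a randomly rotated matrix. -/
lemma map_conjUnitary_mul {N : ℕ} {X : Ω → Matrix (Fin N) (Fin N) ℂ} (hX : Measurable X)
    {U : Ω → Matrix.unitaryGroup (Fin N) ℂ} (hU : Measurable U)
    (hUhaar : (P.map U).IsHaarMeasure) (hindep : IndepFun U X P)
    (V : Matrix.unitaryGroup (Fin N) ℂ) :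
    P.map (fun ω => conjUnitary (V * U ω) (X ω)) = P.map fun ω => conjUnitary (U ω) (X ω) := by
  have hVU : Measurable fun ω => V * U ω := hU.const_mul V
  have hindep' : IndepFun (fun ω => V * U ω) X P :=
    hindep.comp (measurable_const_mul V) measurable_id
  have hlaw : P.map (fun ω => V * U ω) = P.map U := by
    rw [← map_mul_left_eq_self (P.map U) V, Measure.map_map (measurable_const_mul V) hU]
    rfl
  have h1 := (indepFun_iff_map_prod_eq_prod_map_map hU.aemeasurable hX.aemeasurable).1 hindep
  have h2 := (indepFun_iff_map_prod_eq_prod_map_map hVU.aemeasurable hX.aemeasurable).1 hindep'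
  rw [hlaw, ← h1] at h2
  have h3 := congrArg (Measure.map fun p : Matrix.unitaryGroup (Fin N) ℂ ×
    Matrix (Fin N) (Fin N) ℂ => conjUnitary p.1 p.2) h2
  rw [Measure.map_map measurable_uncurry_conjUnitary (hVU.prodMk hX),
    Measure.map_map measurable_uncurry_conjUnitary (hU.prodMk hX)] at h3
  simpa only [Function.comp_def] using h3

/-- The spectral law of the randomly rotated matrix itself. -/
lemma hasSpectralLaw_conjUnitary {n ν : ℕ} {f : Fin n → ℝ → ℝ}
    {X : Ω → Matrix (Fin (n + ν)) (Fin (n + ν)) ℂ} (hX : Measurable X)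
    (hXherm : ∀ᵐ ω ∂P, (X ω).IsHermitian)
    (hXzero : ∀ᵐ ω ∂P, (X ω).charpoly.rootMultiplicity 0 = ν)
    (hXens : IsPolyEnsemble P (fun ω => nonzeroEigenvalues (X ω)) (Set.Ioi 0) f)
    {U : Ω → Matrix.unitaryGroup (Fin (n + ν)) ℂ} (hU : Measurable U)
    (hUhaar : (P.map U).IsHaarMeasure) (hindep : IndepFun U X P) :
    ∃ Z, HasSpectralLaw n ν (P.map fun ω => conjUnitary (U ω) (X ω)) f Z := by
  obtain ⟨Z, x, hd, hxm, hxe, hxlaw⟩ := hXens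
  have hm := measurable_conjUnitary_comp hX hU
  refine ⟨Z, ?_, fun V => ?_, hd, fun B hB => ?_⟩
  · have hclosed : MeasurableSet {A : Matrix (Fin (n + ν)) (Fin (n + ν)) ℂ | A.IsHermitian} :=
      (isClosed_eq (by fun_prop) continuous_id).measurableSet
    rw [ae_map_iff hm.aemeasurable hclosed]
    filter_upwards [hXherm] with ω hω
    exact isHermitian_conjUnitary _ hω
  · rw [Measure.map_map (continuous_conjUnitary V).measurable hm,
      ← map_conjUnitary_mul hX hU hUhaar hindep V]
    congr 1
    ext1 ω
    exact (conjUnitary_mul V (U ω) (X ω)).symm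
  · rw [Measure.map_apply hm (measurableSet_spectralSet hB)]
    have h1 : P ((fun ω => conjUnitary (U ω) (X ω)) ⁻¹' spectralSet n ν B) =
        P {ω | x ω ∈ symmetrization B} := by
      refine measure_congr ?_
      filter_upwards [hXherm, hXzero, hxe] with ω hω h0 hx
      have hsp : HasSpectrum ν (X ω) (x ω) := hasSpectrum_of_nonzeroEigenvalues hω h0 hx
      have hchar : conjUnitary (U ω) (X ω) ∈ spectralSet n ν B ↔ X ω ∈ spectralSet n ν B := by
        simp only [spectralSet, HasSpectrum, Set.mem_ofPred_eq, charpoly_conjUnitary]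
      exact propext (hchar.trans (mem_spectralSet_iff_mem_symmetrization hsp hx B))
    rw [h1, hxlaw _ (measurableSet_symmetrization hB)
      fun σ v hv => (comp_perm_mem_symmetrization σ).2 hv]
    refine (setLIntegral_inter_orthant f Z (measurableSet_symmetrization hB)
      fun σ v => comp_perm_mem_symmetrization σ).trans ?_
    have hset : symmetrization B ∩ chamber n = B ∩ chamber n := by
      ext v
      exact and_congr_left fun hv => mem_symmetrization_iff hv
    rw [hset]

/-- The embedding `e` is a permutation, which its permutation matrix carries out. -/
lemma exists_conjUnitary_eq_submatrix {N : ℕ} (e : Fin N ↪ Fin N) :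
    ∃ Q : Matrix.unitaryGroup (Fin N) ℂ, ∀ A, conjUnitary Q A = A.submatrix e e := by
  have h : ∀ A : Matrix (Fin N) (Fin N) ℂ, (1 : Matrix (Fin N) (Fin N) ℂ).submatrix e id * A *
      star ((1 : Matrix (Fin N) (Fin N) ℂ).submatrix e id) = A.submatrix e e := by
    intro A
    ext i j
    simp [Matrix.mul_apply, Matrix.one_apply, Matrix.star_apply]
  have hQ : (1 : Matrix (Fin N) (Fin N) ℂ).submatrix e id ∈ Matrix.unitaryGroup (Fin N) ℂ := by
    rw [Matrix.mem_unitaryGroup_iff]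
    have h1 := h 1
    rw [mul_one] at h1
    rw [h1, Matrix.submatrix_one e e.injective]
  exact ⟨⟨_, hQ⟩, h⟩

lemma measurable_compressedMatrix {m N : ℕ} {X : Ω → Matrix (Fin m) (Fin m) ℂ}
    (hX : Measurable X) {U : Ω → Matrix.unitaryGroup (Fin m) ℂ} (hU : Measurable U)
    (e : Fin N ↪ Fin m) : Measurable fun ω => compressedMatrix e (U ω) (X ω) := by
  have hc : Continuous fun A : Matrix (Fin m) (Fin m) ℂ => A.submatrix e e :=
    Continuous.matrix_submatrix continuous_id _ _
  exact hc.measurable.comp (measurable_conjUnitary_comp hX hU)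

lemma exists_truncate_compressedMatrix {m N : ℕ} (hN : N < m) (e : Fin N ↪ Fin m) :
    ∃ e' : Fin (N + 1) ↪ Fin m, ∀ U X,
      compressedMatrix e U X = truncate (compressedMatrix e' U X) := by
  obtain ⟨i, hi⟩ : ∃ i, i ∉ Set.range e := by
    by_contra hsurj
    push Not at hsurj
    have := Fintype.card_le_of_surjective e hsurj
    simp only [Fintype.card_fin] at this
    omega
  refine ⟨⟨Fin.snoc e i, ?_⟩, fun U X => ?_⟩
  · exact Fin.snoc_injective_iff.2 ⟨e.injective, hi⟩
  · ext a b
    simp [compressedMatrix, truncate]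

/-- The law of a truncation of corank `r + 1`: one row and column are removed at a time. -/
lemma hasSpectralLaw_compressedMatrix {n N : ℕ} (hn : 1 ≤ n) {f : Fin n → ℝ → ℝ}
    {X : Ω → Matrix (Fin (n + N)) (Fin (n + N)) ℂ} (hX : Measurable X)
    (hXherm : ∀ᵐ ω ∂P, (X ω).IsHermitian)
    (hXzero : ∀ᵐ ω ∂P, (X ω).charpoly.rootMultiplicity 0 = N)
    (hXens : IsPolyEnsemble P (fun ω => nonzeroEigenvalues (X ω)) (Set.Ioi 0) f)
    {U : Ω → Matrix.unitaryGroup (Fin (n + N)) ℂ} (hU : Measurable U)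
    (hUhaar : (P.map U).IsHaarMeasure) (hindep : IndepFun U X P) (r : ℕ) :
    ∀ ν, ν + r + 1 = N → ∀ e : Fin (n + ν) ↪ Fin (n + N),
      ∃ Z, HasSpectralLaw n ν (P.map fun ω => compressedMatrix e (U ω) (X ω))
        (powTransform ν r f) Z := by
  have hf : ∀ k, IntegrableOn (f k) (Set.Ioi 0) := by
    obtain ⟨Z, -, hd, -⟩ := hXens
    exact hd.integrableOn hn
  have htrunc : ∀ {K : ℕ} (e : Fin K ↪ Fin (n + N)) (e' : Fin (K + 1) ↪ Fin (n + N)),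
      (∀ U X, compressedMatrix e U X = truncate (compressedMatrix e' U X)) →
      P.map (fun ω => compressedMatrix e (U ω) (X ω)) =
        (P.map fun ω => compressedMatrix e' (U ω) (X ω)).map truncate := by
    intro K e e' he
    rw [Measure.map_map measurable_truncate (measurable_compressedMatrix hX hU e')]
    congr 1
    ext1 ω
    exact he _ _
  induction r with
  | zero =>
    rintro ν rfl e
    obtain ⟨e', he'⟩ := exists_truncate_compressedMatrix (by omega) e
    obtain ⟨Q, hQ⟩ := exists_conjUnitary_eq_submatrix e'
    obtain ⟨Z, hZ⟩ := hasSpectralLaw_conjUnitary hX hXherm hXzero hXens hU hUhaar hindep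
    have hlaw : P.map (fun ω => compressedMatrix e' (U ω) (X ω)) =
        P.map fun ω => conjUnitary (U ω) (X ω) := by
      rw [← map_conjUnitary_mul hX hU hUhaar hindep Q]
      congr 1
      ext1 ω
      rw [conjUnitary_mul, hQ]
      rfl
    have : IsProbabilityMeasure (P.map fun ω => conjUnitary (U ω) (X ω)) :=
      Measure.isProbabilityMeasure_map (measurable_conjUnitary_comp hX hU).aemeasurable
    rw [htrunc e e' he', hlaw, powTransform_zero]
    exact HasSpectralLaw.map_truncate hn hZ
  | succ r ih =>
    intro ν hν e
    obtain ⟨e', he'⟩ := exists_truncate_compressedMatrix (by omega) e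
    obtain ⟨Z, hZ⟩ := ih (ν + 1) (by omega) e'
    have : IsProbabilityMeasure (P.map fun ω => compressedMatrix e' (U ω) (X ω)) :=
      Measure.isProbabilityMeasure_map (measurable_compressedMatrix hX hU e').aemeasurable
    obtain ⟨Z', hZ'⟩ := HasSpectralLaw.map_truncate hn hZ
    rw [htrunc e e' he']
    refine hZ'.congr_const (c := ((r : ℝ) + 1)⁻¹) (by positivity) fun k t ht => ?_
    exact truncTransform_powTransform ν r (hf k) ht

/-- A spectral law yields an ensemble of points without order, enumerated increasingly. -/
lemma HasSpectralLaw.isPolyEnsemble {n ν : ℕ} {Y : Ω → Matrix (Fin (n + ν)) (Fin (n + ν)) ℂ}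
    (hY : Measurable Y) {h : Fin n → ℝ → ℝ} {Z : ℝ} (hM : HasSpectralLaw n ν (P.map Y) h Z) :
    (∀ᵐ ω ∂P, (nonzeroEigenvalues (Y ω)).card = n ∧ (nonzeroEigenvalues (Y ω)).Nodup) ∧
      IsPolyEnsemble P (fun ω => nonzeroEigenvalues (Y ω)) (Set.Ioi 0) h := by
  have : IsProbabilityMeasure (P.map Y) := Measure.isProbabilityMeasure_map hY.aemeasurable
  have hae : ∀ᵐ ω ∂P, Y ω ∈ spectralSet n ν Set.univ :=
    ae_of_ae_map hY.aemeasurable hM.ae_mem_spectralSet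
  obtain ⟨E, hEm, hE⟩ := exists_measurable_spectrum n ν
  refine ⟨?_, Z, fun ω => E (Y ω), hM.density, hEm.comp hY, ?_, fun B hB hsymm => ?_⟩
  · filter_upwards [hae] with ω hω
    obtain ⟨y, hy, hYy⟩ := hω
    rw [nonzeroEigenvalues_of_charpoly_eq hYy hy.2.2]
    exact ⟨by simp, Finset.univ.nodup.map hy.2.1.injective⟩
  · filter_upwards [hae] with ω hω
    obtain ⟨y, hy, hYy⟩ := hω
    rw [hE _ y hy.2 hYy, nonzeroEigenvalues_of_charpoly_eq hYy hy.2.2]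
  · have h1 : P {ω | E (Y ω) ∈ B} = P.map Y (spectralSet n ν B) := by
      rw [Measure.map_apply hY (measurableSet_spectralSet hB)]
      refine measure_congr ?_
      filter_upwards [hae] with ω hω
      exact propext (mem_spectralSet_iff hE hω B).symm
    have hsymm' : ∀ (σ : Equiv.Perm (Fin n)) v, v ∘ σ ∈ B ↔ v ∈ B := by
      refine fun σ v => ⟨fun hv => ?_, hsymm σ v⟩
      have := hsymm σ.symm _ hv
      simpa [Function.comp_assoc] using this
    rw [h1, hM.law B hB]
    exact (setLIntegral_inter_orthant h Z hB hsymm').symm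

end RandomRotation

theorem theorem4p2 {Ω : Type*} [MeasurableSpace Ω] (P : Measure Ω) [IsProbabilityMeasure P]
    (n m ν : ℕ) (hn : 1 ≤ n) (hν : 1 ≤ ν) (hm : n + ν + 1 ≤ m)
    (f : Fin n → ℝ → ℝ)
    (X : Ω → Matrix (Fin m) (Fin m) ℂ) (hX : Measurable X)
    (hXpos : ∀ᵐ ω ∂P, (X ω).PosSemidef)
    (hXzero : ∀ᵐ ω ∂P, (X ω).charpoly.rootMultiplicity 0 = m - n)
    (hXens : IsPolyEnsemble P (fun ω => nonzeroEigenvalues (X ω)) (Set.Ioi 0) f)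
    (U : Ω → Matrix.unitaryGroup (Fin m) ℂ) (hU : Measurable U)
    (hUhaar : (P.map U).IsHaarMeasure) (hindep : IndepFun U X P)
    (e : Fin (n + ν) ↪ Fin m) :
    (∀ᵐ ω ∂P, (nonzeroEigenvalues (compressedMatrix e (U ω) (X ω))).card = n ∧
      (nonzeroEigenvalues (compressedMatrix e (U ω) (X ω))).Nodup) ∧
    (∀ (k : Fin n) (y : ℝ), 0 < y →
      IntegrableOn (fun x : ℝ => x ^ ν * (1 - x) ^ (m - n - ν - 1) * f k (y / x) / x)
        (Set.Ioo 0 1)) ∧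
    IsPolyEnsemble P (fun ω => nonzeroEigenvalues (compressedMatrix e (U ω) (X ω))) (Set.Ioi 0)
      (fun k y => ∫ x in Set.Ioo (0 : ℝ) 1,
        x ^ ν * (1 - x) ^ (m - n - ν - 1) * f k (y / x) / x) := by
  obtain ⟨r, rfl⟩ := Nat.exists_eq_add_of_le hm
  obtain ⟨N, hN⟩ : ∃ N, n + ν + 1 + r = n + N := ⟨ν + 1 + r, by omega⟩
  have hr : n + ν + 1 + r - n - ν - 1 = r := by omega
  have hνN : ν + r + 1 = N := by omega
  have hzero : n + ν + 1 + r - n = N := by omega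
  simp only [hr]
  rw [hzero] at hXzero
  clear hr hzero hm
  generalize n + ν + 1 + r = m at *
  subst hN
  obtain ⟨Z, hZ⟩ := hasSpectralLaw_compressedMatrix hn hX (hXpos.mono fun _ h => h.isHermitian)
    hXzero hXens hU hUhaar hindep r ν hνN e
  have hf : ∀ k, IntegrableOn (f k) (Set.Ioi 0) := by
    obtain ⟨Z, -, hd, -⟩ := hXens
    exact hd.integrableOn hn
  obtain ⟨Z', hZ'⟩ := hZ.congr_const (h' := fun k y => ∫ x in Set.Ioo (0 : ℝ) 1,
    x ^ ν * (1 - x) ^ r * f k (y / x) / x) one_pos fun k y hy => by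
      rw [one_mul, (integrableOn_and_powTransform_eq ν r (hf k) hy).2]
  obtain ⟨h1, h2⟩ := hZ'.isPolyEnsemble (measurable_compressedMatrix hX hU e)
  exact ⟨h1, fun k y hy => (integrableOn_and_powTransform_eq ν r (hf k) hy).1, h2⟩
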